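/- Let $d\ge 1$ and $p\ge 4$ be fixed, write $L^q=L^q(\mathbb R^d)$ with norm $|\cdot|_q$, let $B_\rho$ be the closed ball of radius $\rho$ about $0$ in $\mathbb R^d$, and let $\nabla$, $\operatorname{div}$ be taken in the sense of distributions in the space variable. For $u_0\in L^2$ and $T>0$, the weak solution on $[0,T]$ of the parabolic $p$-Laplace equation $$\frac{\partial u}{\partial t}=\operatorname{div}(|\nabla u|^{p-2}\nabla u),\qquad u(0)=u_0,$$ is the function $u\in C([0,T];L^2)$ with $u\in W^{1,2}([\delta,T];L^2)$ for all $0<\delta<T$ and $u(0)=u_0$ such that, for a.e. $t\in(0,T)$, $\nabla u(t)\in L^p$, $\operatorname{div}(|\nabla u(t)|^{p-2}\nabla u(t))\in L^2$ and $\frac{du}{dt}(t)=\operatorname{div}(|\nabla u(t)|^{p-2}\nabla u(t))$. **Theorem.** There is a constant $C>0$, depending only on $d$ and $p$, such that the following holds. Let $R\ge 0$, let $u_0\in L^2$ have support in $B_R$ and $|\nabla u_0|\in L^\infty$, let $T>0$, and let $u$ be the weak solution on $[0,T]$ with initial value $u_0$. Put $$R(t)=C\,t^{\frac1{d(p-2)+p}}\,|u_0|_1^{\frac{p-2}{d(p-2)+p}},\qquad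 \mu(T,R)=\operatorname{Vol}(B_{2R+R(T)}).$$ Then the support of $u(t)$ is contained in $B_{2R+R(t)}$ for all $t\in[0,T]$, one has $\nabla u\in L^\infty(0,T;L^\infty)$, the functions $|\nabla u|^{p-2}$ and $|\nabla u|^{p/2}$ have weak spatial gradients that are respectively integrable and square integrable on $(0,T)\times\mathbb R^d$, and $$\int_0^T\!\!\int_{\mathbb R^d}|\nabla u|^{p-2}\,dx\,dt\le (T\mu(T,R))^{\frac2p}\,|u_0|_2^{\frac{2(p-2)}p},$$ $$\int_0^T\!\!\int_{\mathbb R^d}\bigl|\nabla(|\nabla u|^{p-2})\bigr|\,dx\,dt\le \frac{\sqrt d\,(p-2)}2\,(2T\mu(T,R))^{\frac2p}\,|u_0|_2^{\frac{p-4}p}\,|\nabla u_0|_2,$$ $$\int_0^T\!\!\int_{\mathbb R^d}\bigl|\nabla(|\nabla u|^{\frac p2})\bigr|^2\,dx\,dt\le \frac{d\,p^2}8\,|\nabla u_0|_2^2 .$$ (For $p=4$ the factor $|u_0|_2^{(p-4)/p}$ is read as $1$.) -/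

import Mathlib

open MeasureTheory Set
open scoped ContDiff

/-- `G` is the distributional gradient of `f` on `ℝ^d`
(`f` and `G` locally integrable, tested against smooth compactly supported functions). -/
def HasWeakGradient {d : ℕ} (f : EuclideanSpace ℝ (Fin d) → ℝ)
    (G : EuclideanSpace ℝ (Fin d) → EuclideanSpace ℝ (Fin d)) : Prop :=
  LocallyIntegrable f volume ∧ LocallyIntegrable G volume ∧
    ∀ φ : EuclideanSpace ℝ (Fin d) → ℝ, ContDiff ℝ ∞ φ → HasCompactSupport φ →
      ∀ v : EuclideanSpace ℝ (Fin d),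
        ∫ x, f x * fderiv ℝ φ x v = - ∫ x, φ x * inner ℝ (G x) v

/-- `h` is the distributional divergence of the vector field `F` on `ℝ^d`.
Here `fderiv ℝ φ x (F x)` is `F x · ∇φ x`. -/
def HasWeakDivergence {d : ℕ} (F : EuclideanSpace ℝ (Fin d) → EuclideanSpace ℝ (Fin d))
    (h : EuclideanSpace ℝ (Fin d) → ℝ) : Prop :=
  LocallyIntegrable F volume ∧ LocallyIntegrable h volume ∧
    ∀ φ : EuclideanSpace ℝ (Fin d) → ℝ, ContDiff ℝ ∞ φ → HasCompactSupport φ →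
      ∫ x, fderiv ℝ φ x (F x) = - ∫ x, h x * φ x

/-- The `p`-Laplace operator in `L²(ℝ^d)` as a graph: `v ∈ L²` has `∇v ∈ L^p`, and
`div(|∇v|^{p-2} ∇v) = w ∈ L²`, all derivatives in the sense of distributions. -/
def IsPLaplacian {d : ℕ} (p : ℝ) (v w : Lp ℝ 2 (volume : Measure (EuclideanSpace ℝ (Fin d)))) :
    Prop :=
  ∃ G : EuclideanSpace ℝ (Fin d) → EuclideanSpace ℝ (Fin d),
    HasWeakGradient v G ∧ MemLp G (ENNReal.ofReal p) volume ∧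
      HasWeakDivergence (fun x => ‖G x‖ ^ (p - 2) • G x) w

/-- `u` is the weak solution on `[0,T]` of `du/dt = div(|∇u|^{p-2} ∇u)`, `u(0) = u₀`:
`u ∈ C([0,T]; L²)`, `u ∈ W^{1,2}([δ,T]; L²)` for every `0 < δ < T`
(i.e. `u` is absolutely continuous on `[δ,T]` with derivative `u' ∈ L²(δ,T; L²)`), and for
almost every `t ∈ (0,T)` the function `u(t)` is in the domain of the `p`-Laplace operator
and `u'(t) = div(|∇u(t)|^{p-2} ∇u(t))`. -/
def IsWeakSolution {d : ℕ} (p T : ℝ) (u₀ : Lp ℝ 2 (volume : Measure (EuclideanSpace ℝ (Fin d))))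
    (u : ℝ → Lp ℝ 2 (volume : Measure (EuclideanSpace ℝ (Fin d)))) : Prop :=
  ContinuousOn u (Icc 0 T) ∧ u 0 = u₀ ∧
    ∃ u' : ℝ → Lp ℝ 2 (volume : Measure (EuclideanSpace ℝ (Fin d))),
      (∀ δ ∈ Ioo 0 T, MemLp u' 2 (volume.restrict (Ioo δ T))) ∧
      (∀ s t, 0 < s → s ≤ t → t ≤ T → u t - u s = ∫ τ in s..t, u' τ) ∧
      ∀ᵐ t ∂(volume.restrict (Ioo 0 T)), IsPLaplacian p (u t) (u' t)

/-- Lebesgue measure on the cylinder `(0,T) × ℝ^d`. -/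
noncomputable def cylinderMeasure (d : ℕ) (T : ℝ) : Measure (ℝ × EuclideanSpace ℝ (Fin d)) :=
  ((volume : Measure ℝ).restrict (Ioo 0 T)).prod volume

/-- `G` is (a version, jointly measurable in time and space, of) the distributional gradient
in the space variable of the time dependent function `f` on `(0,T) × ℝ^d`. -/
def IsSpatialGradient {d : ℕ} (T : ℝ) (f : ℝ → EuclideanSpace ℝ (Fin d) → ℝ)
    (G : ℝ → EuclideanSpace ℝ (Fin d) → EuclideanSpace ℝ (Fin d)) : Prop :=
  AEStronglyMeasurable (fun z : ℝ × EuclideanSpace ℝ (Fin d) => G z.1 z.2)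
      (cylinderMeasure d T) ∧
    ∀ᵐ t ∂(volume.restrict (Ioo 0 T)), HasWeakGradient (f t) (G t)

/-- The (essential) support of `f` lies in the closed ball of radius `ρ` about `0`. -/
def SupportedInBall {d : ℕ} (f : EuclideanSpace ℝ (Fin d) → ℝ) (ρ : ℝ) : Prop :=
  ∀ᵐ x ∂volume, ρ < ‖x‖ → f x = 0

/-- The `L^q` norm of a function on `ℝ^d`, as a real number. -/
noncomputable def lpNormReal {d : ℕ} {F : Type*} [NormedAddCommGroup F]
    (f : EuclideanSpace ℝ (Fin d) → F) (q : ENNReal) : ℝ :=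
  (eLpNorm f q volume).toReal

/-- `C t^{1/(d(p-2)+p)} m^{(p-2)/(d(p-2)+p)}`, with `m` standing for `|u₀|₁`. -/
noncomputable def propagationRadius (d : ℕ) (p C m t : ℝ) : ℝ :=
  C * t ^ (1 / (d * (p - 2) + p)) * m ^ ((p - 2) / (d * (p - 2) + p))

/-- The volume of the ball of radius `2R + ρ` in `ℝ^d`. -/
noncomputable def supportVolume (d : ℕ) (R ρ : ℝ) : ℝ :=
  (volume (Metric.closedBall (0 : EuclideanSpace ℝ (Fin d)) (2 * R + ρ))).toReal

set_option linter.unusedSectionVars false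

namespace PLaplace

open Filter Topology Metric ContinuousLinearMap
open scoped ENNReal NNReal Convolution

/-! The equation is the `L²` gradient flow of the convex functional `(1/p) ∫ |∇u|^p`, and every
estimate comes from testing it. For convex `j` with `β = j'`, `γ = j''` and a weight `ζ ≥ 0`, a path
with `v' = div B` and `∇v = G` satisfies, integrated in time, `d/dt ∫ ζ j(v) + ∫ B · (ζ γ(v) G +
β(v) ∇ζ) ≤ 0` (`IsFlow.test`, `IsFlow.test_lintegral`). Only this inequality is needed, and it
follows from the subgradient inequality for `j`, without a chain rule in time. Leaving `B` free
makes it apply both to `u` and to the differences `u(·+h) - u` (`IsFlow_translate_sub`), whose flux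
is monotone.

Global estimates. On `u`, the choice `j = s²/2` gives the energy bound `∬ |∇u|^p ≤ |u₀|₂²/2`, and
smooth versions of `|s|` give decay of the `L¹` norm. On differences, a `j` that vanishes exactly on
`(-∞, k]` shows that Lipschitz bounds persist, so `|∇u| ≤ |∇u₀|_∞`. On differences, `j = s²/2`
together with `(4/p²) (|a|^{p/2} - |b|^{p/2})² ≤ (|a|^{p-2}a - |b|^{p-2}b)·(a-b)`
(`le_inner_flux_sub`) bounds the `L²` norm squared of the increments of `|∇u|^{p/2}` by `(p²/8) |h|²
|∇u₀|₂²`. Taking `h` along the `d` coordinate axes gives the third estimate of the theorem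
(`hasWeakGradient_of_lintegral_sub_le`).

Propagation of supports. Testing with a cutoff that lives outside a ball bounds the energy outside
radius `ρ + δ` by `δ^{-p}` times the space-time integral of `|u|^p` outside radius `ρ`
(`exists_local_energy`). That integral is bounded through a Gagliardo–Nirenberg inequality at scale
`θδ` (`setLIntegral_rpow_le_gradient_add`), which gives a recursion for the energy in the tails
(`exists_tailBound_step`). Run with the `L¹` norm, it gives algebraic decay of the energy away from
the initial support (`exists_tailBound_of_mass`). Run with the `L²` norm, it is superlinear because
`p > 2`, so small energy becomes zero at finite distance (`exists_tailBound_zero`). Balancing the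
two yields the radius `C t^{1/(d(p-2)+p)} |u₀|₁^{(p-2)/(d(p-2)+p)}` (`exists_propagation`).

Conclusion. With the support confined to a ball for all times, Hölder's inequality turns the energy
bound into the bound for `|∇u|^{p-2}`. Since `|∇u|^{p-2}` is the power `2(p-2)/p ≥ 1` of
`|∇u|^{p/2}`, the chain rule and the Cauchy–Schwarz inequality give the bound for its gradient. -/

/-- The Euclidean space `ℝ^d`. -/
abbrev Euc (d : ℕ) : Type := EuclideanSpace ℝ (Fin d)

variable {d : ℕ} {F : Type*} [NormedAddCommGroup F] [NormedSpace ℝ F]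

/-! ### Mollification -/

/-- Bump functions at the origin with shrinking supports. -/
noncomputable def bump (d n : ℕ) : ContDiffBump (0 : Euc d) where
  rIn := 1 / (2 * ((n : ℝ) + 1))
  rOut := 1 / ((n : ℝ) + 1)
  rIn_pos := by positivity
  rIn_lt_rOut := by
    apply one_div_lt_one_div_of_lt (by positivity)
    have : (0 : ℝ) ≤ n := n.cast_nonneg
    linarith

/-- The standard mollifier of radius `1 / (n + 1)`. -/
noncomputable def eta (n : ℕ) : Euc d → ℝ := (bump d n).normed volume

lemma eta_nonneg (n : ℕ) (x : Euc d) : 0 ≤ eta n x := (bump d n).nonneg_normed x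

lemma eta_contDiff (n : ℕ) : ContDiff ℝ ∞ (eta n : Euc d → ℝ) := (bump d n).contDiff_normed

lemma eta_continuous (n : ℕ) : Continuous (eta n : Euc d → ℝ) := (eta_contDiff n).continuous

lemma eta_hasCompactSupport (n : ℕ) : HasCompactSupport (eta n : Euc d → ℝ) :=
  (bump d n).hasCompactSupport_normed

lemma eta_integral (n : ℕ) : ∫ x : Euc d, eta n x = 1 := (bump d n).integral_normed

lemma eta_eq_zero (n : ℕ) {x : Euc d} (hx : 1 / ((n : ℝ) + 1) ≤ ‖x‖) : eta n x = 0 := by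
  have h : Function.support (eta n : Euc d → ℝ) = ball 0 (bump d n).rOut :=
    (bump d n).support_normed_eq
  by_contra h0
  have h1 : x ∈ Function.support (eta n : Euc d → ℝ) := h0
  rw [h, mem_ball_zero_iff] at h1
  exact absurd hx (not_le.2 h1)

/-- The probability measure with density `eta n`. -/
noncomputable def etaMeasure (d n : ℕ) : Measure (Euc d) :=
  volume.withDensity fun x => ENNReal.ofReal (eta n x)

instance isProbabilityMeasure_etaMeasure (n : ℕ) : IsProbabilityMeasure (etaMeasure d n) := by
  constructor
  rw [etaMeasure, withDensity_apply _ MeasurableSet.univ, Measure.restrict_univ,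
    ← ofReal_integral_eq_lintegral_ofReal (f := eta n) ((bump d n).integrable_normed)
      (Eventually.of_forall (eta_nonneg n)), eta_integral, ENNReal.ofReal_one]

lemma etaMeasure_absolutelyContinuous (n : ℕ) : etaMeasure d n ≪ volume :=
  withDensity_absolutelyContinuous _ _

lemma ae_etaMeasure_norm_lt (n : ℕ) : ∀ᵐ y ∂(etaMeasure d n), ‖y‖ < 1 / ((n : ℝ) + 1) := by
  rw [etaMeasure, ae_withDensity_iff (by
    exact ENNReal.measurable_ofReal.comp (eta_continuous n).measurable)]
  refine Eventually.of_forall fun x hx => ?_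
  by_contra h
  exact hx (by rw [eta_eq_zero n (not_lt.1 h), ENNReal.ofReal_zero])

lemma integral_etaMeasure (n : ℕ) (g : Euc d → F) :
    ∫ y, g y ∂(etaMeasure d n) = ∫ y, eta n y • g y := by
  rw [etaMeasure, integral_withDensity_eq_integral_toReal_smul]
  · simp only [ENNReal.toReal_ofReal (eta_nonneg n _)]
  · exact ENNReal.measurable_ofReal.comp (eta_continuous n).measurable
  · exact Eventually.of_forall fun _ => ENNReal.ofReal_lt_top

lemma integrable_etaMeasure {n : ℕ} {g : Euc d → F} (hg : LocallyIntegrable g volume) :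
    Integrable g (etaMeasure d n) := by
  rw [etaMeasure, integrable_withDensity_iff_integrable_smul']
  · simp only [ENNReal.toReal_ofReal (eta_nonneg n _)]
    exact hg.integrable_smul_left_of_hasCompactSupport (eta_continuous n) (eta_hasCompactSupport n)
  · exact ENNReal.measurable_ofReal.comp (eta_continuous n).measurable
  · exact Eventually.of_forall fun _ => ENNReal.ofReal_lt_top

/-- The mollification of `f` at scale `1 / (n + 1)`. -/
noncomputable def moll (n : ℕ) (f : Euc d → F) : Euc d → F :=
  eta n ⋆[lsmul ℝ ℝ, volume] f

lemma moll_apply (n : ℕ) (f : Euc d → F) (x : Euc d) :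
    moll n f x = ∫ y, eta n y • f (x - y) := rfl

lemma moll_apply' (n : ℕ) (f : Euc d → F) (x : Euc d) :
    moll n f x = ∫ y, eta n (x - y) • f y := by
  rw [moll, convolution_eq_swap]; rfl

/-- Mollification is an average of translates over a probability measure, the form in which Jensen's
inequality applies. -/
lemma moll_eq_integral (n : ℕ) (f : Euc d → F) (x : Euc d) :
    moll n f x = ∫ y, f (x - y) ∂(etaMeasure d n) := by
  rw [integral_etaMeasure]; rfl

lemma ae_tendsto_moll [CompleteSpace F] {f : Euc d → F} (hf : LocallyIntegrable f volume) :
    ∀ᵐ x, Tendsto (fun n => moll n f x) atTop (𝓝 (f x)) := by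
  -- The outer radius is exactly twice the inner one, so Lebesgue differentiation applies along the
  -- family with the uniform ratio `2`.
  refine ContDiffBump.ae_convolution_tendsto_right_of_locallyIntegrable (φ := bump d) (K := 2)
    ?_ ?_ hf
  · exact tendsto_one_div_add_atTop_nhds_zero_nat
  · refine Eventually.of_forall fun n => le_of_eq ?_
    simp only [bump]
    field_simp

lemma moll_contDiff {n : ℕ} {f : Euc d → F} (hf : LocallyIntegrable f volume) :
    ContDiff ℝ ∞ (moll n f) :=
  (eta_hasCompactSupport n).contDiff_convolution_left _ (n := ⊤) (eta_contDiff n) hf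

lemma moll_hasCompactSupport {n : ℕ} {f : Euc d → F} (hf : HasCompactSupport f) :
    HasCompactSupport (moll n f) :=
  HasCompactSupport.convolution _ (eta_hasCompactSupport n) hf

lemma locallyIntegrable_comp_sub_left {f : Euc d → F} (hf : LocallyIntegrable f volume)
    (x : Euc d) : LocallyIntegrable (fun y => f (x - y)) volume := by
  intro y
  obtain ⟨s, hs, hi⟩ := hf (x - y)
  refine ⟨(fun z => x - z) ⁻¹' s, (by fun_prop : Continuous fun z : Euc d => x - z).continuousAt hs, ?_⟩
  have h := (Measure.measurePreserving_sub_left (volume : Measure (Euc d)) x)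
  exact (h.integrableOn_comp_preimage (Homeomorph.subLeft x).measurableEmbedding).2 hi

lemma locallyIntegrable_comp_add {f : Euc d → F} (hf : LocallyIntegrable f volume)
    (h : Euc d) : LocallyIntegrable (fun y => f (y + h)) volume := by
  intro y
  obtain ⟨s, hs, hi⟩ := hf (y + h)
  refine ⟨(fun z => z + h) ⁻¹' s, (by fun_prop : Continuous fun z : Euc d => z + h).continuousAt hs, ?_⟩
  exact ((measurePreserving_add_right volume h).integrableOn_comp_preimage
    (measurableEmbedding_addRight h)).2 hi

lemma moll_sub_self [CompleteSpace F] {n : ℕ} {f : Euc d → F} (hf : LocallyIntegrable f volume) (x : Euc d) :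
    moll n f x - f x = ∫ y, (f (x - y) - f x) ∂(etaMeasure d n) := by
  rw [integral_sub (integrable_etaMeasure (locallyIntegrable_comp_sub_left hf x))
    (integrable_const _), ← moll_eq_integral, integral_const]
  simp

lemma moll_comp_add (n : ℕ) (f : Euc d → F) (h x : Euc d) :
    moll n (fun y => f (y + h)) x = moll n f (x + h) := by
  simp only [moll_apply]
  congr 1; ext y
  congr 2; abel

/-! ### Jensen's inequality and translations in `L^q` -/

lemma lintegral_rpow_le_of_isProbabilityMeasure {Y : Type*} [MeasurableSpace Y] {ν : Measure Y}
    [IsProbabilityMeasure ν] {q : ℝ} (hq : 1 ≤ q) {f : Y → ℝ≥0∞} (hf : AEMeasurable f ν) :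
    (∫⁻ y, f y ∂ν) ^ q ≤ ∫⁻ y, f y ^ q ∂ν := by
  have hq0 : 0 < q := by linarith
  rcases hq.eq_or_lt with rfl | hq1
  · simp
  have hc := (Real.HolderConjugate.conjExponent hq1)
  have := ENNReal.lintegral_mul_le_Lp_mul_Lq ν hc hf (g := 1) aemeasurable_const
  simp only [Pi.mul_apply, Pi.one_apply, mul_one, ENNReal.one_rpow, lintegral_one,
    measure_univ] at this
  calc (∫⁻ y, f y ∂ν) ^ q ≤ ((∫⁻ y, f y ^ q ∂ν) ^ (1 / q)) ^ q :=
        ENNReal.rpow_le_rpow this hq0.le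
    _ = ∫⁻ y, f y ^ q ∂ν := by
        rw [← ENNReal.rpow_mul, one_div, inv_mul_cancel₀ hq0.ne', ENNReal.rpow_one]

/-- Jensen's inequality in `y`, then Tonelli. It serves three averages: mollifications, means over
balls, and the mean of a derivative along a segment. -/
lemma lintegral_enorm_integral_rpow_le {X Y : Type*} [MeasurableSpace X] [MeasurableSpace Y]
    {μ : Measure X} [SFinite μ] {ν : Measure Y} [IsProbabilityMeasure ν] {q : ℝ} (hq : 1 ≤ q)
    {k : X → Y → F} (hk : AEStronglyMeasurable (Function.uncurry k) (μ.prod ν)) :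
    ∫⁻ x, ‖∫ y, k x y ∂ν‖ₑ ^ q ∂μ ≤ ∫⁻ y, ∫⁻ x, ‖k x y‖ₑ ^ q ∂μ ∂ν := by
  have hm : AEMeasurable (Function.uncurry fun x y => ‖k x y‖ₑ ^ q) (μ.prod ν) :=
    hk.enorm.pow_const q
  rw [← lintegral_lintegral_swap hm]
  refine lintegral_mono_ae ?_
  filter_upwards [hk.prodMk_left] with x hx
  calc ‖∫ y, k x y ∂ν‖ₑ ^ q ≤ (∫⁻ y, ‖k x y‖ₑ ∂ν) ^ q :=
        ENNReal.rpow_le_rpow (enorm_integral_le_lintegral_enorm _) (by linarith)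
    _ ≤ _ := lintegral_rpow_le_of_isProbabilityMeasure hq hx.enorm

/-- Since `ν ≪ volume`, the pullback of `f` under `(x, y) ↦ x - y` does not depend on the
representative of `f`, almost everywhere. -/
lemma aestronglyMeasurable_uncurry_sub {f : Euc d → F} (hf : AEStronglyMeasurable f volume)
    {ν : Measure (Euc d)} [SFinite ν] (hν : ν ≪ volume) {S : Set (Euc d)} :
    AEStronglyMeasurable (Function.uncurry fun x y => f (x - y))
      (((volume : Measure (Euc d)).restrict S).prod ν) := by
  have h := hf.comp_quasiMeasurePreserving
    (quasiMeasurePreserving_sub (volume : Measure (Euc d)) volume)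
  exact h.mono_ac (Measure.restrict_le_self.absolutelyContinuous.prod hν)

lemma aestronglyMeasurable_uncurry_fst {f : Euc d → F} (hf : AEStronglyMeasurable f volume)
    {ν : Measure (Euc d)} [SFinite ν] {S : Set (Euc d)} :
    AEStronglyMeasurable (Function.uncurry fun x (_ : Euc d) => f x)
      (((volume : Measure (Euc d)).restrict S).prod ν) :=
  hf.restrict.comp_fst

/-- Translations are continuous in `L^q`, `1 ≤ q < ∞`. -/
lemma eLpNorm_translate_sub_le {q : ℝ≥0∞} (hq : 1 ≤ q) (hq' : q ≠ ⊤) {f : Euc d → F}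
    (hf : MemLp f q volume) {ε : ℝ≥0∞} (hε : ε ≠ 0) :
    ∃ δ : ℝ, 0 < δ ∧ ∀ y : Euc d, ‖y‖ < δ →
      eLpNorm (fun x => f (x + y) - f x) q volume ≤ ε := by
  have : Fact (1 ≤ q) := ⟨hq⟩
  let g : C(Euc d, C(Euc d, Euc d)) :=
    (ContinuousMap.mk (fun a : Euc d × Euc d => a.2 + a.1) (by fun_prop)).curry
  have hg : ∀ y, MeasurePreserving (g y) (volume : Measure (Euc d)) volume := fun y =>
    measurePreserving_add_right volume y
  have hc : Continuous fun y => Lp.compMeasurePreserving (g y) (hg y) (hf.toLp f) :=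
    Continuous.compMeasurePreservingLp continuous_const g.continuous hg hq'
  have h0 := hc.tendsto 0
  rw [EMetric.tendsto_nhds] at h0
  obtain ⟨δ, hδ, h⟩ := Metric.eventually_nhds_iff.1 (h0 ε (pos_iff_ne_zero.2 hε))
  refine ⟨δ, hδ, fun y hy => ?_⟩
  have h1 := h (y := y) (by simpa using hy)
  rw [Lp.edist_def] at h1
  refine le_trans (le_of_eq (eLpNorm_congr_ae ?_)) h1.le
  have e1 : ∀ z, (Lp.compMeasurePreserving (g z) (hg z) (hf.toLp f) : Euc d → F)
      =ᵐ[volume] fun x => f (x + z) := fun z => by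
    rw [Lp.toLp_compMeasurePreserving hf (hg z)]
    exact MemLp.coeFn_toLp _
  filter_upwards [e1 y, e1 0] with x hx1 hx2
  simp only [Pi.sub_apply, hx1, hx2, add_zero]

lemma eLpNorm_ofReal_rpow {X : Type*} [MeasurableSpace X] {μ : Measure X} {q : ℝ} (hq : 0 < q)
    (f : X → F) : eLpNorm f (ENNReal.ofReal q) μ ^ q = ∫⁻ x, ‖f x‖ₑ ^ q ∂μ := by
  rw [eLpNorm_eq_lintegral_rpow_enorm_toReal (by simpa using hq) ENNReal.ofReal_ne_top,
    ENNReal.toReal_ofReal hq.le, ← ENNReal.rpow_mul, one_div, inv_mul_cancel₀ hq.ne',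
    ENNReal.rpow_one]

lemma eLpNorm_ofReal_le_iff {X : Type*} [MeasurableSpace X] {μ : Measure X} {q : ℝ} (hq : 0 < q)
    (f : X → F) (c : ℝ≥0∞) :
    eLpNorm f (ENNReal.ofReal q) μ ≤ c ↔ ∫⁻ x, ‖f x‖ₑ ^ q ∂μ ≤ c ^ q := by
  rw [← eLpNorm_ofReal_rpow hq, ENNReal.rpow_le_rpow_iff hq]

lemma lintegral_moll_rpow_le {q : ℝ} (hq : 1 ≤ q) (n : ℕ) {f : Euc d → F}
    (hf : AEStronglyMeasurable f volume) :
    ∫⁻ x, ‖moll n f x‖ₑ ^ q ≤ ∫⁻ x, ‖f x‖ₑ ^ q := by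
  have h := lintegral_enorm_integral_rpow_le (μ := (volume : Measure (Euc d)).restrict univ)
    hq (aestronglyMeasurable_uncurry_sub hf (etaMeasure_absolutelyContinuous n))
  simp only [Measure.restrict_univ, ← moll_eq_integral] at h
  refine h.trans (le_of_eq ?_)
  have : ∀ y, ∫⁻ x, ‖f (x - y)‖ₑ ^ q = ∫⁻ x, ‖f x‖ₑ ^ q := fun y =>
    lintegral_sub_right_eq_self (fun x => ‖f x‖ₑ ^ q) y
  simp only [this, lintegral_const, measure_univ, mul_one]

lemma memLp_moll {q : ℝ} (hq : 1 ≤ q) (n : ℕ) {f : Euc d → F}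
    (hf : MemLp f (ENNReal.ofReal q) volume) : MemLp (moll n f) (ENNReal.ofReal q) volume := by
  have hl : LocallyIntegrable f volume := hf.locallyIntegrable (by simpa using hq)
  refine ⟨(moll_contDiff hl).continuous.aestronglyMeasurable, lt_of_le_of_lt ?_ hf.2⟩
  rw [eLpNorm_ofReal_le_iff (by linarith), eLpNorm_ofReal_rpow (by linarith)]
  exact lintegral_moll_rpow_le hq n hf.1

/-- The error is an average of the translation errors over `‖y‖ < 1/(n+1)`, and these are uniformly
small by continuity of translations in `L^q`. -/
lemma tendsto_eLpNorm_moll_sub [CompleteSpace F] {q : ℝ} (hq : 1 ≤ q) {f : Euc d → F}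
    (hf : MemLp f (ENNReal.ofReal q) volume) :
    Tendsto (fun n => eLpNorm (fun x => moll n f x - f x) (ENNReal.ofReal q) volume) atTop
      (𝓝 0) := by
  have hl : LocallyIntegrable f volume := hf.locallyIntegrable (by simpa using hq)
  rw [ENNReal.tendsto_nhds_zero]
  intro ε hε
  obtain ⟨δ, hδ, h⟩ := eLpNorm_translate_sub_le (by simpa using hq) ENNReal.ofReal_ne_top hf hε.ne'
  have ht : Tendsto (fun n : ℕ => 1 / ((n : ℝ) + 1)) atTop (𝓝 0) :=
    tendsto_one_div_add_atTop_nhds_zero_nat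
  filter_upwards [ht.eventually (gt_mem_nhds hδ)] with n hn
  rw [eLpNorm_ofReal_le_iff (by linarith)]
  simp only [moll_sub_self hl]
  have hm : AEStronglyMeasurable (Function.uncurry fun x y => f (x - y) - f x)
      (((volume : Measure (Euc d)).restrict univ).prod (etaMeasure d n)) :=
    (aestronglyMeasurable_uncurry_sub hf.1 (etaMeasure_absolutelyContinuous n)).sub
      (aestronglyMeasurable_uncurry_fst hf.1)
  have h2 := lintegral_enorm_integral_rpow_le hq hm
  rw [Measure.restrict_univ] at h2
  refine h2.trans ?_
  calc ∫⁻ y, ∫⁻ x, ‖f (x - y) - f x‖ₑ ^ q ∂volume ∂(etaMeasure d n)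
      ≤ ∫⁻ y, ε ^ q ∂(etaMeasure d n) := by
        refine lintegral_mono_ae ?_
        filter_upwards [ae_etaMeasure_norm_lt n] with y hy
        have := h (-y) (by rw [norm_neg]; exact hy.trans hn)
        rw [eLpNorm_ofReal_le_iff (by linarith)] at this
        simpa only [sub_eq_add_neg] using this
    _ = ε ^ q := by simp

/-- Mollifications converge in `L^1` on bounded sets. -/
lemma tendsto_lintegral_moll_sub [CompleteSpace F] {f : Euc d → F} (hf : LocallyIntegrable f volume) (r : ℝ) :
    Tendsto (fun n => ∫⁻ x in ball 0 r, ‖moll n f x - f x‖ₑ) atTop (𝓝 0) := by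
  -- Cutting `f` off at radius `r + 1` makes it integrable and does not change its mollifications on
  -- the ball of radius `r`, since the mollifiers have radius at most `1`.
  set g : Euc d → F := (ball 0 (r + 1)).indicator f with hg
  have hgi : MemLp g (ENNReal.ofReal 1) volume := by
    rw [ENNReal.ofReal_one, memLp_one_iff_integrable]
    refine IntegrableOn.integrable_indicator ?_ measurableSet_ball
    exact (hf.integrableOn_isCompact (isCompact_closedBall 0 (r + 1))).mono_set
      ball_subset_closedBall
  have h := tendsto_eLpNorm_moll_sub le_rfl hgi
  refine tendsto_of_tendsto_of_tendsto_of_le_of_le tendsto_const_nhds h (fun _ => bot_le)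
    fun n => ?_
  simp only [ENNReal.ofReal_one, eLpNorm_one_eq_lintegral_enorm]
  refine le_trans (le_of_eq (setLIntegral_congr_fun measurableSet_ball fun x hx => ?_))
    (setLIntegral_le_lintegral (ball 0 r) _)
  have hx' : ‖x‖ < r := by simpa using hx
  have e1 : g x = f x := indicator_of_mem (by simp; linarith) f
  have e2 : moll n g x = moll n f x := by
    rw [moll_eq_integral, moll_eq_integral]
    refine integral_congr_ae ?_
    filter_upwards [ae_etaMeasure_norm_lt n] with y hy
    refine indicator_of_mem ?_ f
    have h1 : 1 / ((n : ℝ) + 1) ≤ 1 := by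
      rw [div_le_one (by positivity)]; linarith [(n.cast_nonneg : (0 : ℝ) ≤ n)]
    rw [mem_ball_zero_iff]
    linarith [norm_sub_le x y]
  simp only [e1, e2]

end PLaplace

namespace PLaplace

open Filter Topology Metric ContinuousLinearMap
open scoped ENNReal NNReal Convolution Gradient

variable {d : ℕ} {F : Type*} [NormedAddCommGroup F] [NormedSpace ℝ F]

/-! ### Weak gradients: mollification, uniqueness and calculus rules -/

lemma locallyIntegrable_norm {f : Euc d → F} (hf : LocallyIntegrable f volume) :
    LocallyIntegrable (fun x => ‖f x‖) volume :=
  fun x => let ⟨s, hs, hi⟩ := hf x; ⟨s, hs, hi.norm⟩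

lemma integrable_mul_of_locallyIntegrable {f g : Euc d → ℝ} (hf : LocallyIntegrable f volume)
    (hg : Continuous g) (hgc : HasCompactSupport g) : Integrable (fun x => f x * g x) volume := by
  simpa only [smul_eq_mul] using hf.integrable_smul_right_of_hasCompactSupport hg hgc

lemma integrable_mul_inner_of_locallyIntegrable {G : Euc d → Euc d} {φ : Euc d → ℝ}
    (hG : LocallyIntegrable G volume) (hφ : Continuous φ) (hc : HasCompactSupport φ)
    (v : Euc d) : Integrable (fun x => φ x * inner ℝ (G x) v) volume := by
  have h := (hG.integrable_smul_left_of_hasCompactSupport hφ hc).inner_const (𝕜 := ℝ) v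
  simpa only [real_inner_smul_left] using h

lemma continuous_fderiv_apply {φ : Euc d → ℝ} (hφ : ContDiff ℝ ∞ φ) (v : Euc d) :
    Continuous fun x => fderiv ℝ φ x v :=
  (hφ.continuous_fderiv (by simp)).clm_apply continuous_const

lemma hasCompactSupport_fderiv_apply {φ : Euc d → ℝ} (hc : HasCompactSupport φ) (v : Euc d) :
    HasCompactSupport fun x => fderiv ℝ φ x v :=
  (hc.fderiv (𝕜 := ℝ)).comp_left (g := fun L : Euc d →L[ℝ] ℝ => L v) (by simp)

lemma contDiff_eta_sub (n : ℕ) (x : Euc d) : ContDiff ℝ ∞ fun y => eta n (x - y) :=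
  (eta_contDiff n).comp (contDiff_const.sub contDiff_id)

lemma hasCompactSupport_eta_sub (n : ℕ) (x : Euc d) : HasCompactSupport fun y => eta n (x - y) :=
  (eta_hasCompactSupport n).comp_homeomorph (Homeomorph.subLeft x)

/-- The derivative falls on the mollifier, so `f` is only locally integrable. The integral form is
also what yields joint measurability of gradients in time and space. -/
lemma fderiv_moll_eq_integral {f : Euc d → ℝ} (hf : LocallyIntegrable f volume) (n : ℕ)
    (x v : Euc d) : fderiv ℝ (moll n f) x v = ∫ y, f y * fderiv ℝ (eta n) (x - y) v := by
  have h1 := (eta_hasCompactSupport n).hasFDerivAt_convolution_left (lsmul ℝ ℝ)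
    ((eta_contDiff n).of_le (by simp)) hf x (μ := (volume : Measure (Euc d)))
  have hint : Integrable (fun y => f y • fderiv ℝ (eta n) (x - y)) volume := by
    refine hf.integrable_smul_right_of_hasCompactSupport ?_ ?_
    · exact ((eta_contDiff n).continuous_fderiv (by simp)).comp (by fun_prop)
    · exact ((eta_hasCompactSupport n).fderiv (𝕜 := ℝ)).comp_homeomorph (Homeomorph.subLeft x)
  have h5 : fderiv ℝ (moll n f) x = _ := h1.fderiv
  rw [h5, convolution_eq_swap]
  have : ∀ y, ((precompL (Euc d) (lsmul ℝ ℝ : ℝ →L[ℝ] ℝ →L[ℝ] ℝ)) (fderiv ℝ (eta n) (x - y)))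
      (f y) = f y • fderiv ℝ (eta n) (x - y) := fun y => by
    ext w
    simp [precompL_apply, mul_comm]
  simp only [this]
  rw [ContinuousLinearMap.integral_apply hint]
  rfl

/-- Testing the weak gradient with `y ↦ eta n (x - y)` shows that gradient and mollification
commute. -/
lemma fderiv_moll_apply {f : Euc d → ℝ} {G : Euc d → Euc d} (h : HasWeakGradient f G) (n : ℕ)
    (x v : Euc d) : fderiv ℝ (moll n f) x v = inner ℝ (moll n G x) v := by
  have hφ : ∀ y, fderiv ℝ (fun y => eta n (x - y)) y v = - fderiv ℝ (eta n) (x - y) v := fun y => by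
    have h2 : HasFDerivAt (eta n : Euc d → ℝ) (fderiv ℝ (eta n) (x - y)) (x - y) :=
      ((eta_contDiff n).differentiable (by simp) _).hasFDerivAt
    have h3 := h2.comp y ((hasFDerivAt_id y).const_sub x)
    have h4 : fderiv ℝ (fun y => eta n (x - y)) y = _ := h3.fderiv
    rw [h4]
    simp
  have h6 := h.2.2 _ (contDiff_eta_sub n x) (hasCompactSupport_eta_sub n x) v
  simp only [hφ, mul_neg, integral_neg, neg_inj] at h6
  have hG := h.2.1.integrable_smul_left_of_hasCompactSupport
    (contDiff_eta_sub n x).continuous (hasCompactSupport_eta_sub n x)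
  rw [fderiv_moll_eq_integral h.1, h6, moll_apply', real_inner_comm, ← integral_inner hG]
  simp only [real_inner_smul_right, real_inner_comm]

lemma gradient_moll {f : Euc d → ℝ} {G : Euc d → Euc d} (h : HasWeakGradient f G) (n : ℕ)
    (x : Euc d) : ∇ (moll n f) x = moll n G x := by
  refine ext_inner_right ℝ fun v => ?_
  rw [← fderiv_moll_apply h, gradient, InnerProductSpace.toDual_symm_apply]

/-- The distributional gradient, as the pointwise limit of the gradients of mollifications. -/
noncomputable def wgrad (f : Euc d → ℝ) (x : Euc d) : Euc d :=
  limUnder atTop fun n => ∇ (moll n f) x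

/-- The gradients of the mollifications of `f` are the mollifications of `G` and converge to `G`
almost everywhere. Hence weak gradients are unique and have a representative built from `f` alone,
with no choice at each time. -/
lemma wgrad_ae_eq {f : Euc d → ℝ} {G : Euc d → Euc d} (h : HasWeakGradient f G) :
    wgrad f =ᵐ[volume] G := by
  filter_upwards [ae_tendsto_moll h.2.1] with x hx
  rw [wgrad]
  simp only [gradient_moll h]
  exact hx.limUnder_eq

lemma HasWeakGradient_congr {f f' : Euc d → ℝ} {G G' : Euc d → Euc d} (h : HasWeakGradient f G)
    (hf : f =ᵐ[volume] f') (hG : G =ᵐ[volume] G') : HasWeakGradient f' G' := by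
  refine ⟨h.1.congr hf, h.2.1.congr hG, fun φ hφ hc v => ?_⟩
  have h1 := h.2.2 φ hφ hc v
  rw [integral_congr_ae (g := fun x => f' x * fderiv ℝ φ x v)] at h1
  · rw [h1, integral_congr_ae]
    filter_upwards [hG] with x hx
    rw [hx]
  · filter_upwards [hf] with x hx
    rw [hx]

lemma hasWeakGradient_wgrad {f : Euc d → ℝ} {G : Euc d → Euc d} (h : HasWeakGradient f G) :
    HasWeakGradient f (wgrad f) :=
  HasWeakGradient_congr h EventuallyEq.rfl (wgrad_ae_eq h).symm

lemma HasWeakGradient_sub {f f' : Euc d → ℝ} {G G' : Euc d → Euc d} (h : HasWeakGradient f G)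
    (h' : HasWeakGradient f' G') :
    HasWeakGradient (fun x => f x - f' x) (fun x => G x - G' x) := by
  refine ⟨h.1.sub h'.1, h.2.1.sub h'.2.1, fun φ hφ hc v => ?_⟩
  have hd := continuous_fderiv_apply hφ v
  have hdc := hasCompactSupport_fderiv_apply hc v
  simp only [sub_mul, inner_sub_left, mul_sub]
  rw [integral_sub (integrable_mul_of_locallyIntegrable h.1 hd hdc)
    (integrable_mul_of_locallyIntegrable h'.1 hd hdc), integral_sub
    (integrable_mul_inner_of_locallyIntegrable h.2.1 hφ.continuous hc v)
    (integrable_mul_inner_of_locallyIntegrable h'.2.1 hφ.continuous hc v), h.2.2 φ hφ hc v,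
    h'.2.2 φ hφ hc v]
  ring

lemma fderiv_comp_sub_const {φ : Euc d → ℝ} (h x : Euc d) :
    fderiv ℝ (fun y => φ (y - h)) x = fderiv ℝ φ (x - h) := by
  simpa only [sub_eq_add_neg] using fderiv_comp_add_right (f := φ) (x := x) (-h)

lemma HasWeakGradient_translate {f : Euc d → ℝ} {G : Euc d → Euc d} (hf : HasWeakGradient f G)
    (h : Euc d) : HasWeakGradient (fun x => f (x + h)) (fun x => G (x + h)) := by
  refine ⟨locallyIntegrable_comp_add hf.1 h, locallyIntegrable_comp_add hf.2.1 h,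
    fun φ hφ hc v => ?_⟩
  have h1 := hf.2.2 (fun y => φ (y - h)) (hφ.comp (contDiff_id.sub contDiff_const))
    (hc.comp_homeomorph (Homeomorph.subRight h)) v
  simp only [fderiv_comp_sub_const] at h1
  rw [← integral_add_right_eq_self _ h, ← integral_add_right_eq_self (fun x => φ (x - h) * _) h]
    at h1
  simpa only [add_sub_cancel_right] using h1

lemma HasWeakDivergence_translate {B : Euc d → Euc d} {w : Euc d → ℝ}
    (hf : HasWeakDivergence B w) (h : Euc d) :
    HasWeakDivergence (fun x => B (x + h)) (fun x => w (x + h)) := by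
  refine ⟨locallyIntegrable_comp_add hf.1 h, locallyIntegrable_comp_add hf.2.1 h,
    fun φ hφ hc => ?_⟩
  have h1 := hf.2.2 (fun y => φ (y - h)) (hφ.comp (contDiff_id.sub contDiff_const))
    (hc.comp_homeomorph (Homeomorph.subRight h))
  simp only [fderiv_comp_sub_const] at h1
  rw [← integral_add_right_eq_self _ h, ← integral_add_right_eq_self (fun x => w x * _) h]
    at h1
  simpa only [add_sub_cancel_right] using h1

lemma integrable_fderiv_apply_of_locallyIntegrable {B : Euc d → Euc d} {φ : Euc d → ℝ}
    (hB : LocallyIntegrable B volume) (hφ : ContDiff ℝ ∞ φ) (hc : HasCompactSupport φ) :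
    Integrable (fun x => fderiv ℝ φ x (B x)) volume := by
  obtain ⟨C, hC⟩ := (hφ.continuous_fderiv (by simp)).bounded_above_of_compact_support
    (hc.fderiv (𝕜 := ℝ))
  have hi : IntegrableOn B (tsupport φ) volume := hB.integrableOn_isCompact hc
  have h1 : IntegrableOn (fun x => fderiv ℝ φ x (B x)) (tsupport φ) volume := by
    refine (hi.norm.const_mul C).mono' ?_ (Eventually.of_forall fun x => ?_)
    · exact (ContinuousLinearMap.apply ℝ ℝ : Euc d →L[ℝ] (Euc d →L[ℝ] ℝ) →L[ℝ] ℝ).aestronglyMeasurable_comp₂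
        hi.1 (hφ.continuous_fderiv (by simp)).aestronglyMeasurable
    · exact (le_opNorm _ _).trans (by gcongr; exact hC x)
  refine (integrableOn_iff_integrable_of_support_subset fun x hx => ?_).1 h1
  by_contra hx'
  apply hx
  have : fderiv ℝ φ x = 0 := by
    have := support_fderiv_subset ℝ (f := φ)
    by_contra h0
    exact hx' (this h0)
  simp [this]

lemma HasWeakDivergence_sub {B B' : Euc d → Euc d} {w w' : Euc d → ℝ}
    (h : HasWeakDivergence B w) (h' : HasWeakDivergence B' w') :
    HasWeakDivergence (fun x => B x - B' x) (fun x => w x - w' x) := by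
  refine ⟨h.1.sub h'.1, h.2.1.sub h'.2.1, fun φ hφ hc => ?_⟩
  simp only [map_sub, sub_mul]
  rw [integral_sub (integrable_fderiv_apply_of_locallyIntegrable h.1 hφ hc)
    (integrable_fderiv_apply_of_locallyIntegrable h'.1 hφ hc), integral_sub
    (integrable_mul_of_locallyIntegrable h.2.1 hφ.continuous hc)
    (integrable_mul_of_locallyIntegrable h'.2.1 hφ.continuous hc), h.2.2 φ hφ hc,
    h'.2.2 φ hφ hc]
  ring

lemma HasWeakDivergence_congr {B B' : Euc d → Euc d} {w w' : Euc d → ℝ}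
    (h : HasWeakDivergence B w) (hB : B =ᵐ[volume] B') (hw : w =ᵐ[volume] w') :
    HasWeakDivergence B' w' := by
  refine ⟨h.1.congr hB, h.2.1.congr hw, fun φ hφ hc => ?_⟩
  have h1 := h.2.2 φ hφ hc
  rw [integral_congr_ae (g := fun x => fderiv ℝ φ x (B' x))] at h1
  · rw [h1, integral_congr_ae]
    filter_upwards [hw] with x hx
    rw [hx]
  · filter_upwards [hB] with x hx
    rw [hx]

lemma inner_gradient {a : Euc d → ℝ} (x v : Euc d) : inner ℝ (∇ a x) v = fderiv ℝ a x v := by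
  rw [gradient, InnerProductSpace.toDual_symm_apply]

lemma norm_gradient {a : Euc d → ℝ} (x : Euc d) : ‖∇ a x‖ = ‖fderiv ℝ a x‖ := by
  rw [gradient, LinearIsometryEquiv.norm_map]

lemma continuous_gradient {a : Euc d → ℝ} (ha : ContDiff ℝ ∞ a) : Continuous (∇ a) :=
  (InnerProductSpace.toDual ℝ (Euc d)).symm.continuous.comp (ha.continuous_fderiv (by simp))

/-- Product rule with a smooth function. -/
lemma HasWeakGradient_mul_smooth {f a : Euc d → ℝ} {G : Euc d → Euc d} (h : HasWeakGradient f G)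
    (ha : ContDiff ℝ ∞ a) :
    HasWeakGradient (fun x => a x * f x) (fun x => a x • G x + f x • ∇ a x) := by
  have haf : LocallyIntegrable (fun x => f x • ∇ a x) volume := by
    intro x
    have := (h.1.integrableOn_isCompact (isCompact_closedBall x 1)).smul_continuousOn
      (continuous_gradient ha).continuousOn (isCompact_closedBall x 1)
    exact ⟨_, closedBall_mem_nhds x one_pos, this⟩
  have haG : LocallyIntegrable (fun x => a x • G x) volume := by
    intro x
    have := (h.2.1.integrableOn_isCompact (isCompact_closedBall x 1)).continuousOn_smul
      ha.continuous.continuousOn (isCompact_closedBall x 1)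
    exact ⟨_, closedBall_mem_nhds x one_pos, this⟩
  refine ⟨?_, haG.add haf, fun φ hφ hc v => ?_⟩
  · intro x
    have := (h.1.integrableOn_isCompact (isCompact_closedBall x 1)).continuousOn_mul
      ha.continuous.continuousOn (isCompact_closedBall x 1)
    exact ⟨_, closedBall_mem_nhds x one_pos, this⟩
  have h1 := h.2.2 (fun x => a x * φ x) (ha.mul hφ) hc.mul_left v
  have hd : ∀ x, fderiv ℝ (fun x => a x * φ x) x v
      = a x * fderiv ℝ φ x v + φ x * inner ℝ (∇ a x) v := fun x => by
    have ha' := (ha.differentiable (by simp) x).hasFDerivAt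
    have hφ' := (hφ.differentiable (by simp) x).hasFDerivAt
    have h3 : fderiv ℝ (fun x => a x * φ x) x = _ := (ha'.mul hφ').fderiv
    rw [h3, inner_gradient]
    simp
  simp only [hd, inner_add_left, real_inner_smul_left, mul_add] at h1 ⊢
  have i1 : Integrable (fun x => f x * (a x * fderiv ℝ φ x v)) volume :=
    integrable_mul_of_locallyIntegrable h.1 (ha.continuous.mul (continuous_fderiv_apply hφ v))
      (hasCompactSupport_fderiv_apply hc v).mul_left
  have i2 : Integrable (fun x => f x * (φ x * inner ℝ (∇ a x) v)) volume :=
    integrable_mul_of_locallyIntegrable h.1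
      (hφ.continuous.mul ((continuous_gradient ha).inner continuous_const)) hc.mul_right
  have i3 : Integrable (fun x => a x * φ x * inner ℝ (G x) v) volume :=
    integrable_mul_inner_of_locallyIntegrable h.2.1 (ha.continuous.mul hφ.continuous)
      hc.mul_left v
  rw [integral_add i1 i2] at h1
  have e1 : ∫ x, a x * f x * fderiv ℝ φ x v = ∫ x, f x * (a x * fderiv ℝ φ x v) := by
    congr 1; ext x; ring
  have e2 : ∫ x, φ x * (a x * inner ℝ (G x) v) + φ x * (f x * inner ℝ (∇ a x) v)
      = ∫ x, a x * φ x * inner ℝ (G x) v + f x * (φ x * inner ℝ (∇ a x) v) := by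
    congr 1; ext x; ring
  rw [e1, e2, integral_add i3 i2]
  linarith

/-- Quantities controlled by the local `L^1` error of a mollification vanish in the limit. -/
lemma tendsto_integral_of_le_moll_sub [CompleteSpace F] {g : Euc d → F}
    (hg : LocallyIntegrable g volume) {C r : ℝ} {k : ℕ → Euc d → ℝ}
    (hk : ∀ n x, |k n x| ≤ C * ‖moll n g x - g x‖) (hk0 : ∀ n x, x ∉ ball (0 : Euc d) r → k n x = 0) :
    Tendsto (fun n => ∫ x, k n x) atTop (𝓝 0) := by
  have h := ENNReal.Tendsto.const_mul (a := ENNReal.ofReal C)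
    (tendsto_lintegral_moll_sub hg r) (Or.inr ENNReal.ofReal_ne_top)
  rw [mul_zero] at h
  rw [tendsto_iff_edist_tendsto_0]
  refine tendsto_of_tendsto_of_tendsto_of_le_of_le tendsto_const_nhds h (fun _ => bot_le) fun n => ?_
  rw [edist_zero_right]
  refine (enorm_integral_le_lintegral_enorm _).trans ?_
  rw [← lintegral_const_mul' _ _ ENNReal.ofReal_ne_top, ← lintegral_indicator measurableSet_ball]
  refine lintegral_mono fun x => ?_
  by_cases hx : x ∈ ball (0 : Euc d) r
  · rw [indicator_of_mem hx, Real.enorm_eq_ofReal_abs, ← ofReal_norm]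
    rw [← ENNReal.ofReal_mul' (norm_nonneg _)]
    exact ENNReal.ofReal_le_ofReal (hk n x)
  · simp [hk0 n x hx]

/-- Chain rule for weak gradients. -/
lemma HasWeakGradient_comp {f : Euc d → ℝ} {G : Euc d → Euc d} (h : HasWeakGradient f G)
    {β γ : ℝ → ℝ} (hβ : ∀ s, HasDerivAt β (γ s) s) (hγ : Continuous γ) {K : ℝ}
    (hK : ∀ s, |γ s| ≤ K) :
    HasWeakGradient (fun x => β (f x)) (fun x => γ (f x) • G x) := by
  have hβc : Continuous β := continuous_iff_continuousAt.2 fun s => (hβ s).continuousAt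
  have hlip : ∀ s t, |β s - β t| ≤ K * |s - t| := fun s t => by
    have := Convex.norm_image_sub_le_of_norm_hasDerivWithin_le (f := β) (f' := γ) (s := univ)
      (C := K) (x := t) (y := s) (fun x _ => (hβ x).hasDerivWithinAt)
      (fun x _ => hK x) convex_univ trivial trivial
    simpa using this
  have hK0 : 0 ≤ K := (abs_nonneg _).trans (hK 0)
  have hm : AEStronglyMeasurable f volume := h.1.aestronglyMeasurable
  have hGm : AEStronglyMeasurable G volume := h.2.1.aestronglyMeasurable
  have hβf : LocallyIntegrable (fun x => β (f x)) volume := by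
    have h1 : LocallyIntegrable (fun x => |β 0| + K * |f x|) volume :=
      (locallyIntegrable_const _).add (LocallyIntegrable.smul (locallyIntegrable_norm h.1) K)
    refine h1.mono (hβc.comp_aestronglyMeasurable hm) (Eventually.of_forall fun x => ?_)
    have h2 := hlip (f x) 0
    rw [sub_zero] at h2
    have h3 : |β (f x)| ≤ |β 0| + |β (f x) - β 0| := by
      have := abs_add_le (β 0) (β (f x) - β 0)
      simpa using this
    rw [Real.norm_eq_abs, Real.norm_eq_abs]
    refine le_trans ?_ (le_abs_self _)
    linarith
  have hγG : LocallyIntegrable (fun x => γ (f x) • G x) volume := by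
    have h1 : LocallyIntegrable (fun x => K • ‖G x‖) volume := LocallyIntegrable.smul (locallyIntegrable_norm h.2.1) K
    refine h1.mono ((hγ.comp_aestronglyMeasurable hm).smul hGm) (Eventually.of_forall fun x => ?_)
    rw [norm_smul, norm_smul, norm_norm, Real.norm_eq_abs, Real.norm_eq_abs, abs_of_nonneg hK0]
    gcongr
    exact hK _
  refine ⟨hβf, hγG, fun φ hφ hc v => ?_⟩
  obtain ⟨r, hr⟩ := hc.isBounded.subset_ball (0 : Euc d)
  have hφ0 : ∀ x, x ∉ ball (0 : Euc d) r → φ x = 0 := fun x hx => image_eq_zero_of_notMem_tsupport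
    fun hx' => hx (hr hx')
  have hdφ0 : ∀ x, x ∉ ball (0 : Euc d) r → fderiv ℝ φ x v = 0 := fun x hx => by
    have : fderiv ℝ φ x = 0 := by
      by_contra h0
      exact hx (hr (support_fderiv_subset ℝ (f := φ) h0))
    simp [this]
  obtain ⟨C1, hC1⟩ := hφ.continuous.bounded_above_of_compact_support hc
  obtain ⟨C2, hC2⟩ := (continuous_fderiv_apply hφ v).bounded_above_of_compact_support
    (hasCompactSupport_fderiv_apply hc v)
  have hfn : ∀ n, ContDiff ℝ ∞ (moll n f) := fun n => moll_contDiff h.1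
  have hGn : ∀ n, Continuous (moll n G) := fun n => (moll_contDiff h.2.1).continuous
  have hdφ := continuous_fderiv_apply hφ v
  have hdφc := hasCompactSupport_fderiv_apply hc v
  have hbn : ∀ n, Continuous fun x => β (moll n f x) := fun n => hβc.comp (hfn n).continuous
  -- For the mollified function the classical chain rule and integration by parts are available; the
  -- rest is passage to the limit on both sides.
  have hparts : ∀ n, ∫ x, β (moll n f x) * fderiv ℝ φ x v
      = - ∫ x, φ x * (γ (moll n f x) * inner ℝ (moll n G x) v) := fun n => by
    have hd : ∀ x, HasFDerivAt (fun x => β (moll n f x)) (γ (moll n f x) • fderiv ℝ (moll n f) x)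
        x := fun x => by
      have h1 := ((hfn n).differentiable (by simp) x).hasFDerivAt
      exact (hβ (moll n f x)).comp_hasFDerivAt x h1
    have e : ∀ x, fderiv ℝ (fun x => β (moll n f x)) x v
        = γ (moll n f x) * inner ℝ (moll n G x) v := fun x => by
      rw [(hd x).fderiv, ← fderiv_moll_apply h]; simp
    have hcont : Continuous fun x => γ (moll n f x) * inner ℝ (moll n G x) v :=
      (hγ.comp (hfn n).continuous).mul ((hGn n).inner continuous_const)
    have := integral_mul_fderiv_eq_neg_fderiv_mul_of_integrable (μ := (volume : Measure (Euc d)))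
      (f := fun x => β (moll n f x)) (g := φ) (v := v) ?_ ?_ ?_
      (fun x _ => (hd x).differentiableAt) (fun x _ => hφ.differentiable (by simp) x)
    · rw [this]
      simp only [e]
      congr 2; ext x; ring
    · simp only [e]
      exact (hcont.mul hφ.continuous).integrable_of_hasCompactSupport hc.mul_left
    · exact ((hbn n).mul hdφ).integrable_of_hasCompactSupport hdφc.mul_left
    · exact ((hbn n).mul hφ.continuous).integrable_of_hasCompactSupport hc.mul_left
  have l1 : Tendsto (fun n => ∫ x, β (moll n f x) * fderiv ℝ φ x v) atTop
      (𝓝 (∫ x, β (f x) * fderiv ℝ φ x v)) := by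
    have h0 := tendsto_integral_of_le_moll_sub h.1 (C := K * C2) (r := r)
      (k := fun n x => β (moll n f x) * fderiv ℝ φ x v - β (f x) * fderiv ℝ φ x v) ?_ ?_
    · have e : ∀ n, ∫ x, β (moll n f x) * fderiv ℝ φ x v - β (f x) * fderiv ℝ φ x v
          = (∫ x, β (moll n f x) * fderiv ℝ φ x v) - ∫ x, β (f x) * fderiv ℝ φ x v := fun n =>
        integral_sub (((hbn n).mul hdφ).integrable_of_hasCompactSupport hdφc.mul_left)
          (integrable_mul_of_locallyIntegrable hβf hdφ hdφc)
      simp only [e] at h0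
      simpa using h0.add_const (∫ x, β (f x) * fderiv ℝ φ x v)
    · intro n x
      rw [← sub_mul, abs_mul, Real.norm_eq_abs]
      calc |β (moll n f x) - β (f x)| * |fderiv ℝ φ x v|
          ≤ (K * |moll n f x - f x|) * C2 := by
            gcongr
            · exact hlip _ _
            · exact hC2 x
        _ = _ := by ring
    · intro n x hx
      simp [hdφ0 x hx]
  have l2 : Tendsto (fun n => ∫ x, φ x * (γ (moll n f x) * inner ℝ (moll n G x) v)) atTop
      (𝓝 (∫ x, φ x * (γ (f x) * inner ℝ (G x) v))) := by
    have iG := integrable_mul_inner_of_locallyIntegrable h.2.1 hφ.continuous hc v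
    -- Two limits are separated. With `G` fixed, `γ (moll n f)` converges boundedly and almost
    -- everywhere; replacing `moll n G` by `G` then costs only a local `L¹` error, because `γ` is
    -- bounded.
    have l3 : Tendsto (fun n => ∫ x, γ (moll n f x) * (φ x * inner ℝ (G x) v)) atTop
        (𝓝 (∫ x, γ (f x) * (φ x * inner ℝ (G x) v))) := by
      refine tendsto_integral_of_dominated_convergence (fun x => K * ‖φ x * inner ℝ (G x) v‖)
        (fun n => ?_) (iG.norm.const_mul K) (fun n => Eventually.of_forall fun x => ?_) ?_
      · exact (hγ.comp (hfn n).continuous).aestronglyMeasurable.mul iG.1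
      · rw [norm_mul]
        gcongr
        exact hK _
      · filter_upwards [ae_tendsto_moll h.1] with x hx
        exact ((hγ.tendsto _).comp hx).mul_const _
    have h0 := tendsto_integral_of_le_moll_sub h.2.1 (C := C1 * K * ‖v‖) (r := r)
      (k := fun n x => φ x * (γ (moll n f x) * inner ℝ (moll n G x) v)
        - γ (moll n f x) * (φ x * inner ℝ (G x) v)) ?_ ?_
    · have e : ∀ n, ∫ x, φ x * (γ (moll n f x) * inner ℝ (moll n G x) v)
            - γ (moll n f x) * (φ x * inner ℝ (G x) v)
          = (∫ x, φ x * (γ (moll n f x) * inner ℝ (moll n G x) v))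
            - ∫ x, γ (moll n f x) * (φ x * inner ℝ (G x) v) := fun n => by
        refine integral_sub ?_ ?_
        · exact (hφ.continuous.mul ((hγ.comp (hfn n).continuous).mul
            ((hGn n).inner continuous_const))).integrable_of_hasCompactSupport hc.mul_right
        · exact iG.bdd_mul (hγ.comp (hfn n).continuous).aestronglyMeasurable
            (Eventually.of_forall fun x => hK _)
      simp only [e] at h0
      have h2 := h0.add l3
      simp only [sub_add_cancel, zero_add] at h2
      refine h2.congr_dist ?_ |>.trans (le_of_eq ?_)
      · simp
      · congr 2; ext x; ring
    · intro n x
      have : φ x * (γ (moll n f x) * inner ℝ (moll n G x) v)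
          - γ (moll n f x) * (φ x * inner ℝ (G x) v)
          = φ x * γ (moll n f x) * inner ℝ (moll n G x - G x) v := by
        rw [inner_sub_left]; ring
      rw [this, abs_mul, abs_mul]
      calc |φ x| * |γ (moll n f x)| * |inner ℝ (moll n G x - G x) v|
          ≤ C1 * K * (‖moll n G x - G x‖ * ‖v‖) := by
            have := hC1 x
            have h5 : 0 ≤ C1 := (norm_nonneg _).trans this
            gcongr
            · exact this
            · exact hK _
            · exact abs_real_inner_le_norm _ _
        _ = _ := by ring
    · intro n x hx
      simp [hφ0 x hx]
  have l4 := l1.congr hparts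
  have := tendsto_nhds_unique l4 l2.neg
  simpa only [real_inner_smul_left] using this

/-- The weak gradient vanishes where the function vanishes on an open set. -/
lemma ae_eq_zero_of_hasWeakGradient {f : Euc d → ℝ} {G : Euc d → Euc d}
    (h : HasWeakGradient f G) {U : Set (Euc d)} (hU : IsOpen U)
    (hf : ∀ᵐ x, x ∈ U → f x = 0) : ∀ᵐ x, x ∈ U → G x = 0 := by
  refine hU.ae_eq_zero_of_integral_contDiff_smul_eq_zero (h.2.1.locallyIntegrableOn U)
    fun φ hφ hc hs => ?_
  refine ext_inner_right ℝ fun v => ?_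
  rw [inner_zero_left, real_inner_comm, ← integral_inner
    (h.2.1.integrable_smul_left_of_hasCompactSupport hφ.continuous hc)]
  have h1 := h.2.2 φ hφ hc v
  have h2 : ∫ x, f x * fderiv ℝ φ x v = 0 := by
    rw [integral_eq_zero_of_ae]
    filter_upwards [hf] with x hx
    by_cases hxU : x ∈ U
    · simp [hx hxU]
    · have : fderiv ℝ φ x = 0 := by
        by_contra h0
        exact hxU (hs (support_fderiv_subset ℝ (f := φ) h0))
      simp [this]
  rw [h2] at h1
  simp only [real_inner_smul_right, real_inner_comm] at h1 ⊢
  linarith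

end PLaplace

namespace PLaplace

open Filter Topology Metric ContinuousLinearMap
open scoped ENNReal NNReal Convolution Gradient

variable {d : ℕ} {F : Type*} [NormedAddCommGroup F] [NormedSpace ℝ F]

/-! ### Difference quotients and averages -/

lemma setLIntegral_comp_add_le {φ : Euc d → ℝ≥0∞} {S S' : Set (Euc d)} (hS : MeasurableSet S)
    (hS' : MeasurableSet S') {w : Euc d} (h : ∀ x ∈ S, x + w ∈ S') :
    ∫⁻ x in S, φ (x + w) ≤ ∫⁻ x in S', φ x := by
  rw [← lintegral_indicator hS, ← lintegral_indicator hS',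
    ← lintegral_add_right_eq_self (S'.indicator φ) w]
  refine lintegral_mono fun x => ?_
  by_cases hx : x ∈ S
  · rw [indicator_of_mem hx, indicator_of_mem (h x hx)]
  · rw [indicator_of_notMem hx]; exact bot_le

/-- The increment is the mean over `s ∈ (0, 1]` of the derivative along the segment, so Jensen's
inequality applies. -/
lemma setLIntegral_translate_rpow_le_of_contDiff {g : Euc d → ℝ} (hg : ContDiff ℝ ∞ g) {q : ℝ}
    (hq : 1 ≤ q) (z : Euc d) (S : Set (Euc d)) :
    ∫⁻ x in S, ‖g (x + z) - g x‖ₑ ^ q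
      ≤ ∫⁻ s in Ioc (0 : ℝ) 1, ∫⁻ x in S, ‖fderiv ℝ g (x + s • z) z‖ₑ ^ q := by
  have : IsProbabilityMeasure ((volume : Measure ℝ).restrict (Ioc 0 1)) := ⟨by simp⟩
  have hc : Continuous (Function.uncurry fun (x : Euc d) (s : ℝ) => fderiv ℝ g (x + s • z) z) := by
    have h1 := hg.continuous_fderiv (by simp)
    simp only [Function.uncurry_def]
    exact (h1.comp (by fun_prop)).clm_apply continuous_const
  have e : ∀ x, g (x + z) - g x = ∫ s in Ioc (0 : ℝ) 1, fderiv ℝ g (x + s • z) z := fun x => by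
    have h1 : ∀ s : ℝ, HasDerivAt (fun s : ℝ => g (x + s • z)) (fderiv ℝ g (x + s • z) z) s :=
      fun s => by
        have h2 := (hg.differentiable (by simp) (x + s • z)).hasFDerivAt
        have h3 : HasDerivAt (fun s : ℝ => x + s • z) z s := by
          simpa using ((hasDerivAt_id s).smul_const z).const_add x
        exact h2.comp_hasDerivAt s h3
    have h4 := intervalIntegral.integral_eq_sub_of_hasDerivAt (a := 0) (b := 1)
      (fun s _ => h1 s) ((hc.comp (by fun_prop : Continuous fun s : ℝ => (x, s))).intervalIntegrable _ _)
    rw [intervalIntegral.integral_of_le zero_le_one] at h4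
    simpa using h4.symm
  simp only [e]
  exact lintegral_enorm_integral_rpow_le hq hc.aestronglyMeasurable

/-- Local estimate of translations by the weak gradient in `L^q`. -/
lemma setLIntegral_translate_sub_rpow_le {f : Euc d → ℝ} {G : Euc d → Euc d}
    (h : HasWeakGradient f G) {q : ℝ} (hq : 1 ≤ q) {z : Euc d} {r : ℝ} (hz : ‖z‖ < r)
    {S S' : Set (Euc d)} (hS : MeasurableSet S) (hS' : MeasurableSet S')
    (hSS' : ∀ x ∈ S, ∀ y, ‖y‖ < r → x + y ∈ S') :
    ∫⁻ x in S, ‖f (x + z) - f x‖ₑ ^ q ≤ ‖z‖ₑ ^ q * ∫⁻ x in S', ‖G x‖ₑ ^ q := by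
  have hq0 : 0 ≤ q := by linarith
  -- Once `‖z‖ + 1/(n+1) < r`, the shift `s • z` along the segment and the shift `y` of the
  -- mollifier together stay below `r`, so no point of `S` is moved out of `S'`.
  have hbound : ∀ᶠ n in atTop, ∫⁻ x in S, ‖moll n f (x + z) - moll n f x‖ₑ ^ q
      ≤ ‖z‖ₑ ^ q * ∫⁻ x in S', ‖G x‖ₑ ^ q := by
    have ht : Tendsto (fun n : ℕ => ‖z‖ + 1 / ((n : ℝ) + 1)) atTop (𝓝 (‖z‖ + 0)) :=
      tendsto_one_div_add_atTop_nhds_zero_nat.const_add _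
    rw [add_zero] at ht
    filter_upwards [ht.eventually (gt_mem_nhds hz)] with n hn
    refine (setLIntegral_translate_rpow_le_of_contDiff (moll_contDiff h.1) hq z S).trans ?_
    calc ∫⁻ s in Ioc (0 : ℝ) 1, ∫⁻ x in S, ‖fderiv ℝ (moll n f) (x + s • z) z‖ₑ ^ q
        ≤ ∫⁻ s in Ioc (0 : ℝ) 1, ‖z‖ₑ ^ q * ∫⁻ x in S', ‖G x‖ₑ ^ q := by
          refine setLIntegral_mono' measurableSet_Ioc fun s hs => ?_
          calc ∫⁻ x in S, ‖fderiv ℝ (moll n f) (x + s • z) z‖ₑ ^ q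
              ≤ ∫⁻ x in S, ‖z‖ₑ ^ q * ‖moll n (fun y => G (y + s • z)) x‖ₑ ^ q := by
                refine lintegral_mono fun x => ?_
                rw [fderiv_moll_apply h, moll_comp_add, ← ENNReal.mul_rpow_of_nonneg _ _ hq0]
                refine ENNReal.rpow_le_rpow ?_ hq0
                rw [mul_comm, ← ofReal_norm, ← ofReal_norm, ← ofReal_norm,
                  ← ENNReal.ofReal_mul (norm_nonneg _)]
                exact ENNReal.ofReal_le_ofReal (norm_inner_le_norm _ _)
            _ = ‖z‖ₑ ^ q * ∫⁻ x in S, ‖moll n (fun y => G (y + s • z)) x‖ₑ ^ q :=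
                lintegral_const_mul' _ _ (ENNReal.rpow_ne_top_of_nonneg hq0 enorm_ne_top)
            _ ≤ ‖z‖ₑ ^ q * ∫⁻ x in S', ‖G x‖ₑ ^ q := by
                gcongr ‖z‖ₑ ^ q * ?_
                have hG := locallyIntegrable_comp_add h.2.1 (s • z)
                have := lintegral_enorm_integral_rpow_le hq (aestronglyMeasurable_uncurry_sub
                  (S := S) hG.aestronglyMeasurable (etaMeasure_absolutelyContinuous n))
                refine le_trans (le_of_eq ?_) (this.trans ?_)
                · simp only [moll_eq_integral]
                calc _ ≤ ∫⁻ y, ∫⁻ x in S', ‖G x‖ₑ ^ q ∂volume ∂(etaMeasure d n) := by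
                      refine lintegral_mono_ae ?_
                      filter_upwards [ae_etaMeasure_norm_lt n] with y hy
                      have hw : ‖s • z - y‖ < r := by
                        calc ‖s • z - y‖ ≤ ‖s • z‖ + ‖y‖ := norm_sub_le _ _
                          _ ≤ ‖z‖ + 1 / ((n : ℝ) + 1) := by
                            rw [norm_smul, Real.norm_eq_abs, abs_of_pos hs.1]
                            have := mul_le_of_le_one_left (norm_nonneg z) hs.2
                            linarith
                          _ < r := hn
                      have := setLIntegral_comp_add_le (φ := fun x => ‖G x‖ₑ ^ q) hS hS'
                        (w := s • z - y) (fun x hx => hSS' x hx _ hw)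
                      refine le_trans (le_of_eq (lintegral_congr fun x => ?_)) this
                      congr 3
                      abel
                  _ = _ := by simp
      _ = ‖z‖ₑ ^ q * ∫⁻ x in S', ‖G x‖ₑ ^ q := by simp
  have hlim : ∀ᵐ x, Tendsto (fun n => ‖moll n f (x + z) - moll n f x‖ₑ ^ q) atTop
      (𝓝 (‖f (x + z) - f x‖ₑ ^ q)) := by
    filter_upwards [ae_tendsto_moll h.1, ae_tendsto_moll (locallyIntegrable_comp_add h.1 z)]
      with x hx hx'
    simp only [moll_comp_add] at hx'
    exact (ENNReal.continuous_rpow_const.tendsto _).comp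
      ((continuous_enorm.tendsto _).comp (hx'.sub hx))
  -- Fatou's lemma transfers the bound from the mollifications to `f`.
  calc ∫⁻ x in S, ‖f (x + z) - f x‖ₑ ^ q
      = ∫⁻ x in S, liminf (fun n => ‖moll n f (x + z) - moll n f x‖ₑ ^ q) atTop := by
        refine lintegral_congr_ae (ae_restrict_of_ae ?_)
        filter_upwards [hlim] with x hx
        exact hx.liminf_eq.symm
    _ ≤ liminf (fun n => ∫⁻ x in S, ‖moll n f (x + z) - moll n f x‖ₑ ^ q) atTop := by
        refine lintegral_liminf_le' fun n => ?_
        have hc := (moll_contDiff (n := n) h.1).continuous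
        exact ((hc.comp (continuous_add_const z)).sub hc).aestronglyMeasurable.enorm.pow_const q
    _ ≤ ‖z‖ₑ ^ q * ∫⁻ x in S', ‖G x‖ₑ ^ q :=
        liminf_le_of_frequently_le' hbound.frequently

lemma lintegral_translate_sub_rpow_le {f : Euc d → ℝ} {G : Euc d → Euc d}
    (h : HasWeakGradient f G) {q : ℝ} (hq : 1 ≤ q) (z : Euc d) :
    ∫⁻ x, ‖f (x + z) - f x‖ₑ ^ q ≤ ‖z‖ₑ ^ q * ∫⁻ x, ‖G x‖ₑ ^ q := by
  have := setLIntegral_translate_sub_rpow_le h hq (lt_add_one ‖z‖) MeasurableSet.univ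
    MeasurableSet.univ (fun _ _ _ _ => trivial)
  simpa using this

/-- An essential bound on the weak gradient bounds the derivative of every mollification everywhere,
and the mean value inequality passes to the almost everywhere limit. Together with the converse
below, this turns gradient bounds into bounds on translates, which the flow propagates. -/
lemma translate_sub_le_of_gradient_le {f : Euc d → ℝ} {G : Euc d → Euc d}
    (h : HasWeakGradient f G) {L : ℝ} (hL : ∀ᵐ x, ‖G x‖ ≤ L) (z : Euc d) :
    ∀ᵐ x, |f (x + z) - f x| ≤ L * ‖z‖ := by
  have hn : ∀ n x, ‖fderiv ℝ (moll n f) x‖ ≤ L := fun n x => by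
    rw [← norm_gradient, gradient_moll h, moll_eq_integral]
    have h1 := norm_integral_le_of_norm_le_const (μ := etaMeasure d n) (C := L)
      (f := fun y => G (x - y)) ?_
    · simpa using h1
    · refine (etaMeasure_absolutelyContinuous n).ae_le ?_
      exact (Measure.measurePreserving_sub_left volume x).quasiMeasurePreserving.ae hL
  filter_upwards [ae_tendsto_moll h.1, ae_tendsto_moll (locallyIntegrable_comp_add h.1 z)]
    with x hx hx'
  simp only [moll_comp_add] at hx'
  refine le_of_tendsto (hx'.sub hx).abs (Eventually.of_forall fun n => ?_)
  have := Convex.norm_image_sub_le_of_norm_fderiv_le (𝕜 := ℝ) (f := moll n f) (s := univ)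
    (C := L) (x := x) (y := x + z)
    (fun y _ => (moll_contDiff h.1).differentiable (by simp) y) (fun y _ => hn n y)
    convex_univ trivial trivial
  simpa using this

/-- The exceptional null set may depend on `z`. Averaging removes it: each mollification is
genuinely `L`-Lipschitz, so its gradient is at most `L`, and these gradients converge to `G`. -/
lemma gradient_le_of_translate_sub_le {f : Euc d → ℝ} {G : Euc d → Euc d}
    (h : HasWeakGradient f G) {L : ℝ} (hL0 : 0 ≤ L)
    (hL : ∀ z, ∀ᵐ x, |f (x + z) - f x| ≤ L * ‖z‖) : ∀ᵐ x, ‖G x‖ ≤ L := by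
  have hlip : ∀ n x z, |moll n f (x + z) - moll n f x| ≤ L * ‖z‖ := fun n x z => by
    have hz := locallyIntegrable_comp_add h.1 z
    rw [← moll_comp_add, moll_eq_integral, moll_eq_integral, ← integral_sub
      (integrable_etaMeasure (locallyIntegrable_comp_sub_left hz x))
      (integrable_etaMeasure (locallyIntegrable_comp_sub_left h.1 x))]
    have h1 := norm_integral_le_of_norm_le_const (μ := etaMeasure d n) (C := L * ‖z‖)
      (f := fun y => f (x - y + z) - f (x - y)) ?_
    · simpa using h1
    · refine (etaMeasure_absolutelyContinuous n).ae_le ?_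
      exact (Measure.measurePreserving_sub_left volume x).quasiMeasurePreserving.ae (hL z)
  filter_upwards [ae_tendsto_moll h.2.1] with x hx
  refine le_of_tendsto hx.norm (Eventually.of_forall fun n => ?_)
  rw [← gradient_moll h, norm_gradient]
  have hl : LipschitzWith L.toNNReal (moll n f) := by
    refine LipschitzWith.of_dist_le_mul fun a b => ?_
    have := hlip n b (a - b)
    rw [add_sub_cancel] at this
    rw [Real.dist_eq, dist_eq_norm, Real.coe_toNNReal _ hL0]
    exact this
  simpa [hL0] using norm_fderiv_le_of_lipschitz ℝ hl (x₀ := x)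

/-- The uniform probability measure on a ball about the origin. -/
noncomputable def ballMeasure (d : ℕ) (ε : ℝ) : Measure (Euc d) :=
  (volume (ball (0 : Euc d) ε))⁻¹ • volume.restrict (ball 0 ε)

lemma isProbabilityMeasure_ballMeasure {ε : ℝ} (hε : 0 < ε) :
    IsProbabilityMeasure (ballMeasure d ε) := by
  constructor
  simp only [ballMeasure, Measure.smul_apply, Measure.restrict_apply_univ, smul_eq_mul]
  exact ENNReal.inv_mul_cancel (measure_ball_pos _ _ hε).ne' measure_ball_lt_top.ne

lemma ballMeasure_absolutelyContinuous (ε : ℝ) : ballMeasure d ε ≪ volume :=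
  Measure.restrict_le_self.absolutelyContinuous.smul_left _

lemma ae_ballMeasure (ε : ℝ) : ∀ᵐ y ∂(ballMeasure d ε), ‖y‖ < ε := by
  refine Measure.ae_smul_measure ?_ _
  filter_upwards [ae_restrict_mem measurableSet_ball] with y hy
  simpa using hy

lemma integrable_ballMeasure {ε : ℝ} (hε : 0 < ε) {g : Euc d → F}
    (hg : LocallyIntegrable g volume) : Integrable g (ballMeasure d ε) := by
  refine Integrable.smul_measure ?_ (ENNReal.inv_ne_top.2 (measure_ball_pos _ _ hε).ne')
  exact (hg.integrableOn_isCompact (isCompact_closedBall 0 ε)).mono_set ball_subset_closedBall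

/-- A local inequality of Gagliardo–Nirenberg type, at scale `ε`. -/
lemma setLIntegral_rpow_le_gradient_add {f : Euc d → ℝ} {G : Euc d → Euc d}
    (h : HasWeakGradient f G) {p q : ℝ} (hq : 1 ≤ q) (hqp : q ≤ p) {ε : ℝ} (hε : 0 < ε)
    {S S' : Set (Euc d)} (hS : MeasurableSet S) (hS' : MeasurableSet S')
    (hSS' : ∀ x ∈ S, ∀ y, ‖y‖ < ε → x + y ∈ S') :
    ∫⁻ x in S, ‖f x‖ₑ ^ p ≤ 2 ^ (p - 1) * (ENNReal.ofReal ε ^ p * (∫⁻ x in S', ‖G x‖ₑ ^ p)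
      + ((volume (ball (0 : Euc d) ε))⁻¹) ^ ((p - q) / q)
        * (∫⁻ x in S', ‖f x‖ₑ ^ q) ^ (p / q)) := by
  have hp : 1 ≤ p := hq.trans hqp
  have hp0 : 0 ≤ p := by linarith
  have hq0 : 0 < q := by linarith
  have hP := isProbabilityMeasure_ballMeasure (d := d) hε
  set ν := ballMeasure d ε with hν
  set m := ∫⁻ x in S', ‖f x‖ₑ ^ q with hm
  set V := volume (ball (0 : Euc d) ε) with hV
  -- The function is compared with its mean over the ball of radius `ε`: the gradient controls the
  -- oscillation `avg - f`, while the `L^q` norm controls `avg`.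
  set avg : Euc d → ℝ := fun x => ∫ y, f (x - y) ∂ν with havg
  have hmeas1 := aestronglyMeasurable_uncurry_sub (S := S) h.1.aestronglyMeasurable
    (ballMeasure_absolutelyContinuous (d := d) ε)
  have hmeas2 := hmeas1.sub (aestronglyMeasurable_uncurry_fst (ν := ν) (S := S)
    h.1.aestronglyMeasurable)
  have hsub : ∀ x, avg x - f x = ∫ y, (f (x - y) - f x) ∂ν := fun x => by
    rw [integral_sub (integrable_ballMeasure hε (locallyIntegrable_comp_sub_left h.1 x))
      (integrable_const _), integral_const]
    simp [havg, hν]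
  have h1 : ∫⁻ x in S, ‖avg x - f x‖ₑ ^ p ≤ ENNReal.ofReal ε ^ p * ∫⁻ x in S', ‖G x‖ₑ ^ p := by
    simp only [hsub]
    refine (lintegral_enorm_integral_rpow_le hp hmeas2).trans ?_
    calc _ ≤ ∫⁻ y, ENNReal.ofReal ε ^ p * (∫⁻ x in S', ‖G x‖ₑ ^ p) ∂ν := by
          refine lintegral_mono_ae ?_
          filter_upwards [ae_ballMeasure ε] with y hy
          have := setLIntegral_translate_sub_rpow_le h hp (z := -y) (by rwa [norm_neg]) hS hS' hSS'
          simp only [← sub_eq_add_neg] at this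
          refine this.trans ?_
          gcongr
          rw [← ofReal_norm, norm_neg]
          exact ENNReal.ofReal_le_ofReal hy.le
      _ = _ := by simp
  have h2 : ∫⁻ x in S, ‖avg x‖ₑ ^ q ≤ m := by
    refine (lintegral_enorm_integral_rpow_le hq hmeas1).trans ?_
    calc _ ≤ ∫⁻ y, m ∂ν := by
          refine lintegral_mono_ae ?_
          filter_upwards [ae_ballMeasure ε] with y hy
          have := setLIntegral_comp_add_le (φ := fun x => ‖f x‖ₑ ^ q) hS hS'
            (w := -y) (fun x hx => hSS' x hx _ (by rwa [norm_neg]))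
          simpa only [← sub_eq_add_neg] using this
      _ = m := by simp
  have h3 : ∀ x ∈ S, ‖avg x‖ₑ ^ q ≤ V⁻¹ * m := fun x hx => by
    calc ‖avg x‖ₑ ^ q ≤ (∫⁻ y, ‖f (x - y)‖ₑ ∂ν) ^ q :=
          ENNReal.rpow_le_rpow (enorm_integral_le_lintegral_enorm _) hq0.le
      _ ≤ ∫⁻ y, ‖f (x - y)‖ₑ ^ q ∂ν := by
          refine lintegral_rpow_le_of_isProbabilityMeasure hq ?_
          exact (integrable_ballMeasure hε (locallyIntegrable_comp_sub_left h.1 x)).1.enorm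
      _ = V⁻¹ * ∫⁻ y in ball 0 ε, ‖f (x - y)‖ₑ ^ q := by
          rw [hν, ballMeasure, lintegral_smul_measure, smul_eq_mul]
      _ ≤ V⁻¹ * m := by
          gcongr
          rw [hm, ← lintegral_indicator measurableSet_ball, ← lintegral_indicator hS',
            ← lintegral_sub_left_eq_self (S'.indicator fun x => ‖f x‖ₑ ^ q) x]
          refine lintegral_mono fun y => ?_
          by_cases hy : y ∈ ball (0 : Euc d) ε
          · rw [indicator_of_mem hy, indicator_of_mem]
            rw [sub_eq_add_neg]
            exact hSS' x hx _ (by rw [norm_neg]; simpa using hy)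
          · rw [indicator_of_notMem hy]; exact bot_le
  have hr : 0 ≤ (p - q) / q := div_nonneg (by linarith) hq0.le
  -- Interpolation between the `L^q` bound `h2` and the pointwise bound `h3`, whose power `(p -
  -- q)/q` accounts for the excess of `p` over `q`.
  have h4 : ∫⁻ x in S, ‖avg x‖ₑ ^ p ≤ (V⁻¹) ^ ((p - q) / q) * m ^ (p / q) := by
    have hfin : V⁻¹ ≠ ⊤ := ENNReal.inv_ne_top.2 (measure_ball_pos _ _ hε).ne'
    calc ∫⁻ x in S, ‖avg x‖ₑ ^ p
        = ∫⁻ x in S, (‖avg x‖ₑ ^ q) ^ ((p - q) / q) * ‖avg x‖ₑ ^ q := by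
          refine lintegral_congr fun x => ?_
          rw [← ENNReal.rpow_mul, ← ENNReal.rpow_add_of_nonneg _ _ (by positivity) hq0.le]
          congr 1
          field_simp
          ring
      _ ≤ ∫⁻ x in S, (V⁻¹ * m) ^ ((p - q) / q) * ‖avg x‖ₑ ^ q := by
          refine setLIntegral_mono' hS fun x hx => ?_
          gcongr
          exact h3 x hx
      _ = (V⁻¹ * m) ^ ((p - q) / q) * ∫⁻ x in S, ‖avg x‖ₑ ^ q := by
          rw [lintegral_const_mul'']
          exact (hmeas1.integral_prod_right').enorm.pow_const q
      _ ≤ (V⁻¹ * m) ^ ((p - q) / q) * m := by gcongr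
      _ = (V⁻¹) ^ ((p - q) / q) * m ^ (p / q) := by
          rw [ENNReal.mul_rpow_of_nonneg _ _ hr, mul_assoc]
          congr 1
          nth_rewrite 2 [← ENNReal.rpow_one m]
          rw [← ENNReal.rpow_add_of_nonneg _ _ hr zero_le_one]
          congr 1
          field_simp
          ring
  calc ∫⁻ x in S, ‖f x‖ₑ ^ p
      ≤ ∫⁻ x in S, 2 ^ (p - 1) * (‖avg x - f x‖ₑ ^ p + ‖avg x‖ₑ ^ p) := by
        refine lintegral_mono fun x => ?_
        refine le_trans (ENNReal.rpow_le_rpow ?_ hp0) (ENNReal.rpow_add_le_mul_rpow_add_rpow _ _ hp)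
        have : f x = -(avg x - f x) + avg x := by ring
        calc ‖f x‖ₑ = ‖-(avg x - f x) + avg x‖ₑ := by rw [← this]
          _ ≤ ‖-(avg x - f x)‖ₑ + ‖avg x‖ₑ := enorm_add_le _ _
          _ = _ := by rw [enorm_neg]
    _ = 2 ^ (p - 1) * ((∫⁻ x in S, ‖avg x - f x‖ₑ ^ p) + ∫⁻ x in S, ‖avg x‖ₑ ^ p) := by
        rw [lintegral_const_mul' _ _ (ENNReal.rpow_ne_top_of_nonneg (by linarith) (by simp)),
          lintegral_add_right' (g := fun x => ‖avg x‖ₑ ^ p) _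
            ((hmeas1.integral_prod_right').enorm.pow_const p)]
    _ ≤ _ := by gcongr

/-- The inequality above at scale `1` on the whole space, with `q = 2`. It places a solution in
`L^p`, where it pairs with the flux, which lies in the dual space. -/
lemma memLp_of_gradient {f : Euc d → ℝ} {G : Euc d → Euc d} (h : HasWeakGradient f G) {p : ℝ}
    (hp : 2 ≤ p) (hf : MemLp f 2 volume) (hG : MemLp G (ENNReal.ofReal p) volume) :
    MemLp f (ENNReal.ofReal p) volume := by
  refine ⟨hf.1, ?_⟩
  have hp0 : 0 < p := by linarith
  have h1 := setLIntegral_rpow_le_gradient_add h (p := p) (q := 2) (by norm_num) hp one_pos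
    MeasurableSet.univ MeasurableSet.univ (fun _ _ _ _ => trivial)
  simp only [Measure.restrict_univ] at h1
  have h2 : ∫⁻ x, ‖f x‖ₑ ^ (2 : ℝ) < ⊤ := by
    rw [← eLpNorm_ofReal_rpow two_pos]
    exact ENNReal.rpow_lt_top_of_nonneg (by norm_num) (by simpa using hf.2.ne)
  have h3 : ∫⁻ x, ‖G x‖ₑ ^ p < ⊤ := by
    rw [← eLpNorm_ofReal_rpow hp0]
    exact ENNReal.rpow_lt_top_of_nonneg hp0.le hG.2.ne
  have h4 : ∫⁻ x, ‖f x‖ₑ ^ p < ⊤ := by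
    refine h1.trans_lt ?_
    refine ENNReal.mul_lt_top (ENNReal.rpow_lt_top_of_nonneg (by linarith) (by simp)) ?_
    refine ENNReal.add_lt_top.2 ⟨ENNReal.mul_lt_top (by simp) h3, ENNReal.mul_lt_top ?_ ?_⟩
    · exact ENNReal.rpow_lt_top_of_nonneg (div_nonneg (by linarith) two_pos.le)
        (ENNReal.inv_ne_top.2 (measure_ball_pos _ _ one_pos).ne')
    · exact ENNReal.rpow_lt_top_of_nonneg (by positivity) h2.ne
  rw [← eLpNorm_ofReal_rpow hp0] at h4
  by_contra h5
  rw [top_le_iff.1 (not_lt.1 h5), ENNReal.top_rpow_of_pos hp0] at h4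
  exact lt_irrefl _ h4

end PLaplace

namespace PLaplace

open Filter Topology Metric ContinuousLinearMap
open scoped ENNReal NNReal Convolution Gradient

variable {d : ℕ} {F : Type*} [NormedAddCommGroup F] [NormedSpace ℝ F]

/-! ### Riesz representation and weak partial derivatives -/

/-- The map `ι` need not be injective: the bound forces `l` to vanish on the kernel of `ι`. So `l`
descends to the range, extends by Hahn–Banach with the same norm, and is represented by Riesz. -/
lemma exists_inner_eq_of_abs_le {V H : Type*} [AddCommGroup V] [Module ℝ V]
    [NormedAddCommGroup H] [InnerProductSpace ℝ H] [CompleteSpace H] (ι : V →ₗ[ℝ] H)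
    (l : V →ₗ[ℝ] ℝ) {c : ℝ} (hc : 0 ≤ c) (h : ∀ φ, |l φ| ≤ c * ‖ι φ‖) :
    ∃ k : H, ‖k‖ ≤ c ∧ ∀ φ, l φ = inner ℝ k (ι φ) := by
  obtain ⟨s, hs⟩ := LinearMap.exists_rightInverse_of_surjective ι.rangeRestrict
    (LinearMap.range_rangeRestrict ι)
  have hs' : ∀ y : LinearMap.range ι, ι (s y) = y := fun y => by
    have := LinearMap.congr_fun hs y
    simpa using congrArg Subtype.val this
  let l' : LinearMap.range ι →L[ℝ] ℝ := (l ∘ₗ s).mkContinuous c fun y => by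
    have := h (s y)
    rw [hs'] at this
    simpa using this
  obtain ⟨g, hg, hgn⟩ := exists_extension_norm_eq (𝕜 := ℝ) (LinearMap.range ι) l'
  refine ⟨(InnerProductSpace.toDual ℝ H).symm g, ?_, fun φ => ?_⟩
  · rw [LinearIsometryEquiv.norm_map, hgn]
    exact LinearMap.mkContinuous_norm_le _ hc _
  · rw [InnerProductSpace.toDual_symm_apply]
    have h1 := hg ⟨ι φ, LinearMap.mem_range_self ι φ⟩
    rw [h1]
    have h2 : l' ⟨ι φ, LinearMap.mem_range_self ι φ⟩ = l (s ⟨ι φ, LinearMap.mem_range_self ι φ⟩) :=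
      rfl
    rw [h2]
    have h3 := h (φ - s ⟨ι φ, LinearMap.mem_range_self ι φ⟩)
    rw [map_sub, map_sub, hs', sub_self, norm_zero, mul_zero] at h3
    exact sub_eq_zero.1 (abs_nonpos_iff.1 h3)

lemma enorm_integral_mul_rpow_two_le {X : Type*} [MeasurableSpace X] {μ : Measure X}
    {f g : X → ℝ} (hf : AEMeasurable f μ) (hg : AEMeasurable g μ) :
    ‖∫ x, f x * g x ∂μ‖ₑ ^ (2 : ℝ)
      ≤ (∫⁻ x, ‖f x‖ₑ ^ (2 : ℝ) ∂μ) * ∫⁻ x, ‖g x‖ₑ ^ (2 : ℝ) ∂μ := by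
  have h1 : ‖∫ x, f x * g x ∂μ‖ₑ ≤ ∫⁻ x, ‖f x‖ₑ * ‖g x‖ₑ ∂μ := by
    refine (enorm_integral_le_lintegral_enorm _).trans (le_of_eq (lintegral_congr fun x => ?_))
    rw [enorm_mul]
  have h2 := ENNReal.lintegral_mul_le_Lp_mul_Lq μ Real.HolderConjugate.two_two hf.enorm hg.enorm
  calc ‖∫ x, f x * g x ∂μ‖ₑ ^ (2 : ℝ)
      ≤ ((∫⁻ x, ‖f x‖ₑ ^ (2 : ℝ) ∂μ) ^ (1 / (2 : ℝ)) *
          (∫⁻ x, ‖g x‖ₑ ^ (2 : ℝ) ∂μ) ^ (1 / (2 : ℝ))) ^ (2 : ℝ) :=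
        ENNReal.rpow_le_rpow (h1.trans h2) (by norm_num)
    _ = _ := by
        rw [ENNReal.mul_rpow_of_nonneg _ _ (by norm_num), ← ENNReal.rpow_mul, ← ENNReal.rpow_mul]
        norm_num

/-- Test functions on `ℝ^d`. -/
def testFunctions (d : ℕ) : Submodule ℝ (Euc d → ℝ) where
  carrier := {φ | ContDiff ℝ ∞ φ ∧ HasCompactSupport φ}
  add_mem' h h' := ⟨h.1.add h'.1, h.2.add h'.2⟩
  zero_mem' := ⟨contDiff_const, HasCompactSupport.zero⟩
  smul_mem' c _ h := ⟨contDiff_const.smul h.1, h.2.mono (Function.support_const_smul_subset c _)⟩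

lemma memLp_test {φ : Euc d → ℝ} (h : φ ∈ testFunctions d) (q : ℝ≥0∞) : MemLp φ q volume :=
  h.1.continuous.memLp_of_hasCompactSupport h.2

/-- A change of variables moves the difference quotient from `f` onto the test function, where it
converges boundedly and with supports in a fixed ball. -/
lemma tendsto_integral_mul_differenceQuotient {f : Euc d → ℝ} (hf : LocallyIntegrable f volume)
    {φ : Euc d → ℝ} (hφ : ContDiff ℝ ∞ φ) (hc : HasCompactSupport φ) (v : Euc d)
    {t : ℕ → ℝ} (ht0 : ∀ n, t n ≠ 0) (ht : Tendsto t atTop (𝓝 0)) :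
    Tendsto (fun n => ∫ x, (f (x + t n • v) - f x) / t n * φ x) atTop
      (𝓝 (- ∫ x, f x * fderiv ℝ φ x v)) := by
  obtain ⟨r, hr⟩ := hc.isBounded.subset_ball (0 : Euc d)
  have hφ0 : ∀ x, r ≤ ‖x‖ → φ x = 0 := fun x hx => image_eq_zero_of_notMem_tsupport
    fun hx' => by have := hr hx'; rw [mem_ball_zero_iff] at this; linarith
  obtain ⟨C, hC⟩ := (hφ.continuous_fderiv (by simp)).bounded_above_of_compact_support
    (hc.fderiv (𝕜 := ℝ))
  have hlip : ∀ x y, |φ x - φ y| ≤ C * ‖x - y‖ := fun x y => by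
    have := Convex.norm_image_sub_le_of_norm_fderiv_le (𝕜 := ℝ) (f := φ) (s := univ)
      (C := C) (x := y) (y := x)
      (fun y _ => hφ.differentiable (by simp) y) (fun y _ => hC y) convex_univ trivial trivial
    simpa using this
  have htr : ∀ h : Euc d, HasCompactSupport fun x => φ (x - h) := fun h =>
    hc.comp_homeomorph (Homeomorph.subRight h)
  have e1 : ∀ n, ∫ x, (f (x + t n • v) - f x) / t n * φ x
      = ∫ x, f x * ((φ (x - t n • v) - φ x) / t n) := fun n => by
    have i1 : Integrable (fun x => f (x + t n • v) * φ x) volume :=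
      integrable_mul_of_locallyIntegrable (locallyIntegrable_comp_add hf _) hφ.continuous hc
    have i2 := integrable_mul_of_locallyIntegrable hf hφ.continuous hc
    have i3 : Integrable (fun x => f x * φ (x - t n • v)) volume :=
      integrable_mul_of_locallyIntegrable hf (hφ.continuous.comp (by fun_prop)) (htr _)
    have e2 : ∫ x, f x * φ (x - t n • v) = ∫ x, f (x + t n • v) * φ x := by
      rw [← integral_add_right_eq_self _ (t n • v)]
      simp only [add_sub_cancel_right]
    calc ∫ x, (f (x + t n • v) - f x) / t n * φ x
        = ∫ x, (t n)⁻¹ * (f (x + t n • v) * φ x - f x * φ x) := by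
          congr 1; ext x; field_simp
      _ = ∫ x, (t n)⁻¹ * (f x * φ (x - t n • v) - f x * φ x) := by
          rw [integral_const_mul, integral_const_mul, integral_sub i1 i2, integral_sub i3 i2, e2]
      _ = _ := by congr 1; ext x; field_simp
  simp only [e1]
  rw [← integral_neg]
  have hbt : ∀ᶠ n in atTop, ‖t n • v‖ < 1 := by
    have := (ht.smul_const v).norm
    rw [zero_smul, norm_zero] at this
    exact this.eventually (gt_mem_nhds one_pos)
  have hfi : IntegrableOn f (closedBall 0 (r + 1)) volume :=
    hf.integrableOn_isCompact (isCompact_closedBall _ _)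
  refine tendsto_integral_filter_of_dominated_convergence
    ((closedBall (0 : Euc d) (r + 1)).indicator fun x => ‖f x‖ * (C * ‖v‖))
    (Eventually.of_forall fun n => ?_) ?_ ?_ ?_
  · refine hf.aestronglyMeasurable.mul (Continuous.aestronglyMeasurable ?_)
    have := hφ.continuous
    fun_prop
  · filter_upwards [hbt] with n hn
    refine Eventually.of_forall fun x => ?_
    by_cases hx : x ∈ closedBall (0 : Euc d) (r + 1)
    · rw [indicator_of_mem hx, norm_mul, norm_div, Real.norm_eq_abs, Real.norm_eq_abs,
        Real.norm_eq_abs]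
      gcongr
      rw [div_le_iff₀ (abs_pos.2 (ht0 n))]
      refine (hlip _ _).trans (le_of_eq ?_)
      rw [sub_sub_cancel_left, norm_neg, norm_smul, Real.norm_eq_abs]
      ring
    · rw [indicator_of_notMem hx]
      rw [mem_closedBall_zero_iff, not_le] at hx
      have h1 : φ x = 0 := hφ0 x (by linarith)
      have h2 : φ (x - t n • v) = 0 := hφ0 _ (by
        have := norm_sub_norm_le x (t n • v)
        linarith)
      simp [h1, h2]
  · exact IntegrableOn.integrable_indicator (hfi.norm.mul_const _) measurableSet_closedBall
  · refine Eventually.of_forall fun x => ?_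
    rw [← mul_neg]
    refine Tendsto.const_mul _ ?_
    have h1 : HasDerivAt (fun s : ℝ => φ (x - s • v)) (- fderiv ℝ φ x v) 0 := by
      have h2 : HasFDerivAt φ (fderiv ℝ φ x) (x - (0 : ℝ) • v) := by
        rw [zero_smul, sub_zero]; exact (hφ.differentiable (by simp) x).hasFDerivAt
      have h3 : HasDerivAt (fun s : ℝ => x - s • v) (-v) 0 := by
        simpa using ((hasDerivAt_id (0 : ℝ)).smul_const v).const_sub x
      have h5 := h2.comp_hasDerivAt 0 h3
      rw [map_neg] at h5
      exact h5
    rw [hasDerivAt_iff_tendsto_slope_zero] at h1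
    have h4 : Tendsto t atTop (𝓝[≠] 0) :=
      tendsto_nhdsWithin_iff.2 ⟨ht, Eventually.of_forall ht0⟩
    refine (h1.comp h4).congr fun n => ?_
    simp [div_eq_inv_mul]

/-- A function whose difference quotients in one direction are bounded in `L²` has a weak partial
derivative in `L²` in that direction. -/
lemma exists_weak_partial {f : Euc d → ℝ} (hf : LocallyIntegrable f volume) (v : Euc d)
    {t : ℕ → ℝ} (ht0 : ∀ n, t n ≠ 0) (ht : Tendsto t atTop (𝓝 0)) {M : ℝ≥0∞} (hM : M ≠ ⊤)
    (h : liminf (fun n => ∫⁻ x, ‖(f (x + t n • v) - f x) / t n‖ₑ ^ (2 : ℝ)) atTop ≤ M) :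
    ∃ k : Euc d → ℝ, MemLp k 2 volume ∧ ∫⁻ x, ‖k x‖ₑ ^ (2 : ℝ) ≤ M ∧
      ∀ φ : Euc d → ℝ, ContDiff ℝ ∞ φ → HasCompactSupport φ →
        ∫ x, f x * fderiv ℝ φ x v = - ∫ x, φ x * k x := by
  have hbound : ∀ φ : Euc d → ℝ, ContDiff ℝ ∞ φ → HasCompactSupport φ →
      ‖∫ x, f x * fderiv ℝ φ x v‖ₑ ^ (2 : ℝ) ≤ M * ∫⁻ x, ‖φ x‖ₑ ^ (2 : ℝ) := by
    intro φ hφ hc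
    have hΦ : ∫⁻ x, ‖φ x‖ₑ ^ (2 : ℝ) ≠ ⊤ := by
      rw [← eLpNorm_ofReal_rpow two_pos]
      exact ENNReal.rpow_ne_top_of_nonneg (by norm_num) (memLp_test ⟨hφ, hc⟩ _).2.ne
    -- A bound on the lower limit holds only for infinitely many `n`, and only with a slightly
    -- larger constant. This is enough, because the tested integrals converge along the whole
    -- sequence.
    have hM' : ∀ M', M < M' →
        ‖∫ x, f x * fderiv ℝ φ x v‖ₑ ^ (2 : ℝ) ≤ M' * ∫⁻ x, ‖φ x‖ₑ ^ (2 : ℝ) := by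
      intro M' hMM
      have hfr := frequently_lt_of_liminf_lt (by isBoundedDefault) (h.trans_lt hMM)
      have hl := tendsto_integral_mul_differenceQuotient hf hφ hc v ht0 ht
      have hl2 := (ENNReal.continuous_rpow_const (y := (2 : ℝ))).tendsto _ |>.comp
        ((continuous_enorm.tendsto _).comp hl)
      rw [enorm_neg] at hl2
      refine le_of_tendsto_of_frequently hl2 (hfr.mono fun n hn => ?_)
      have hm1 : AEMeasurable (fun x => (f (x + t n • v) - f x) / t n) volume :=
        (((locallyIntegrable_comp_add hf _).aestronglyMeasurable.sub
          hf.aestronglyMeasurable).aemeasurable.div_const _)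
      refine (enorm_integral_mul_rpow_two_le hm1 hφ.continuous.aemeasurable).trans ?_
      gcongr
    by_cases hΦ0 : ∫⁻ x, ‖φ x‖ₑ ^ (2 : ℝ) = 0
    · have := hM' ⊤ hM.lt_top
      rw [hΦ0, mul_zero] at this ⊢
      exact this
    · rw [← ENNReal.div_le_iff hΦ0 hΦ]
      refine le_of_forall_gt_imp_ge_of_dense fun M' hMM => ?_
      rw [ENNReal.div_le_iff hΦ0 hΦ]
      exact hM' M' hMM
  let ι : testFunctions d →ₗ[ℝ] Lp ℝ 2 (volume : Measure (Euc d)) :=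
    { toFun := fun φ => (memLp_test φ.2 2).toLp _
      map_add' := fun φ ψ => MemLp.toLp_add (memLp_test φ.2 2) (memLp_test ψ.2 2)
      map_smul' := fun c φ => MemLp.toLp_const_smul c (memLp_test φ.2 2) }
  let l : testFunctions d →ₗ[ℝ] ℝ :=
    { toFun := fun φ => - ∫ x, f x * fderiv ℝ (φ : Euc d → ℝ) x v
      map_add' := fun φ ψ => by
        have e : ∀ x, fderiv ℝ ((φ + ψ : testFunctions d) : Euc d → ℝ) x v
            = fderiv ℝ (φ : Euc d → ℝ) x v + fderiv ℝ (ψ : Euc d → ℝ) x v := fun x => by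
          rw [Submodule.coe_add, fderiv_add (φ.2.1.differentiable (by simp) x)
            (ψ.2.1.differentiable (by simp) x)]
          rfl
        simp only [e, mul_add]
        rw [integral_add (integrable_mul_of_locallyIntegrable hf (continuous_fderiv_apply φ.2.1 v)
          (hasCompactSupport_fderiv_apply φ.2.2 v)) (integrable_mul_of_locallyIntegrable hf
          (continuous_fderiv_apply ψ.2.1 v) (hasCompactSupport_fderiv_apply ψ.2.2 v))]
        ring
      map_smul' := fun c φ => by
        have e : ∀ x, fderiv ℝ ((c • φ : testFunctions d) : Euc d → ℝ) x v
            = c * fderiv ℝ (φ : Euc d → ℝ) x v := fun x => by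
          rw [Submodule.coe_smul, fderiv_const_smul (φ.2.1.differentiable (by simp) x)]
          rfl
        simp only [e, RingHom.id_apply, smul_eq_mul, mul_neg]
        rw [← integral_const_mul]
        congr 2; ext x; ring }
  obtain ⟨k, hk, hkl⟩ := exists_inner_eq_of_abs_le ι l (c := √M.toReal) (Real.sqrt_nonneg _) (by
    intro φ
    have h1 := hbound φ φ.2.1 φ.2.2
    have h2 : ‖ι φ‖ₑ ^ (2 : ℝ) = ∫⁻ x, ‖(φ : Euc d → ℝ) x‖ₑ ^ (2 : ℝ) := by
      have : ‖ι φ‖ₑ = eLpNorm (φ : Euc d → ℝ) 2 volume := Lp.enorm_toLp (hf := memLp_test φ.2 2)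
      rw [this, ← eLpNorm_ofReal_rpow two_pos]
      simp
    rw [← h2] at h1
    have h3 := ENNReal.toReal_mono (ENNReal.mul_ne_top hM
      (ENNReal.rpow_ne_top_of_nonneg (by norm_num) enorm_ne_top)) h1
    simp only [ENNReal.toReal_mul, ← ENNReal.toReal_rpow, toReal_enorm, Real.rpow_two] at h3
    have h4 : |l φ| = ‖∫ x, f x * fderiv ℝ (φ : Euc d → ℝ) x v‖ := by
      simp [l, Real.norm_eq_abs]
    rw [h4]
    refine abs_le_of_sq_le_sq' ?_ (by positivity) |>.2
    rw [mul_pow, Real.sq_sqrt ENNReal.toReal_nonneg]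
    exact h3)
  refine ⟨k, Lp.memLp k, ?_, fun φ hφ hc => ?_⟩
  · rw [← eLpNorm_ofReal_rpow two_pos]
    have h1 : eLpNorm k (ENNReal.ofReal 2) volume = ENNReal.ofReal ‖k‖ := by
      rw [ofReal_norm, Lp.enorm_def]; simp
    rw [h1, ENNReal.rpow_two, ← ENNReal.ofReal_pow (norm_nonneg _)]
    refine ENNReal.ofReal_le_of_le_toReal ?_
    calc ‖k‖ ^ 2 ≤ √M.toReal ^ 2 := by gcongr
      _ = M.toReal := Real.sq_sqrt ENNReal.toReal_nonneg
  · have h1 := hkl ⟨φ, hφ, hc⟩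
    have h2 : l ⟨φ, hφ, hc⟩ = - ∫ x, f x * fderiv ℝ φ x v := rfl
    rw [h2, L2.inner_def] at h1
    rw [← neg_eq_iff_eq_neg, h1]
    refine integral_congr_ae ?_
    filter_upwards [MemLp.coeFn_toLp (memLp_test (φ := φ) ⟨hφ, hc⟩ 2)] with x hx
    have : (ι ⟨φ, hφ, hc⟩ : Euc d → ℝ) x = φ x := hx
    rw [this]
    simp

lemma hasWeakGradient_of_partials {f : Euc d → ℝ} (hf : LocallyIntegrable f volume)
    {k : Fin d → Euc d → ℝ} (hk : ∀ i, MemLp (k i) 2 volume)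
    (h : ∀ i, ∀ φ : Euc d → ℝ, ContDiff ℝ ∞ φ → HasCompactSupport φ →
        ∫ x, f x * fderiv ℝ φ x (EuclideanSpace.basisFun (Fin d) ℝ i) = - ∫ x, φ x * k i x) :
    HasWeakGradient f (fun x => WithLp.toLp 2 fun i => k i x) ∧
      MemLp (fun x => (WithLp.toLp 2 fun i => k i x : Euc d)) 2 volume := by
  have e : (fun x => (WithLp.toLp 2 fun i => k i x : Euc d))
      = fun x => ∑ i, k i x • EuclideanSpace.basisFun (Fin d) ℝ i := by
    ext x j
    simp [EuclideanSpace.basisFun_apply, Pi.single_apply]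
  have hm : MemLp (fun x => (WithLp.toLp 2 fun i => k i x : Euc d)) 2 volume := by
    rw [e]
    refine memLp_finsetSum _ fun i _ => ?_
    exact (ContinuousLinearMap.toSpanSingleton ℝ
      (EuclideanSpace.basisFun (Fin d) ℝ i)).comp_memLp' (hk i)
  refine ⟨⟨hf, hm.locallyIntegrable (by norm_num), fun φ hφ hc v => ?_⟩, hm⟩
  have hv : v = ∑ i, v i • EuclideanSpace.basisFun (Fin d) ℝ i := by
    ext j; simp [EuclideanSpace.basisFun_apply, Pi.single_apply]
  have e1 : ∀ x, f x * fderiv ℝ φ x v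
      = ∑ i, v i * (f x * fderiv ℝ φ x (EuclideanSpace.basisFun (Fin d) ℝ i)) := fun x => by
    nth_rewrite 1 [hv]
    rw [map_sum, Finset.mul_sum]
    refine Finset.sum_congr rfl fun i _ => ?_
    rw [map_smul, smul_eq_mul]; ring
  have e2 : ∀ x, φ x * inner ℝ (WithLp.toLp 2 fun i => k i x : Euc d) v
      = ∑ i, v i * (φ x * k i x) := fun x => by
    rw [PiLp.inner_apply, Finset.mul_sum]
    refine Finset.sum_congr rfl fun i _ => ?_
    simp; ring
  simp only [e1, e2]
  rw [integral_finsetSum, integral_finsetSum, ← Finset.sum_neg_distrib]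
  · refine Finset.sum_congr rfl fun i _ => ?_
    rw [integral_const_mul, integral_const_mul, h i φ hφ hc]
    ring
  · intro i _
    refine Integrable.const_mul ?_ _
    have := integrable_mul_of_locallyIntegrable ((hk i).locallyIntegrable (by norm_num))
      hφ.continuous hc
    simpa only [mul_comm] using this
  · intro i _
    exact (integrable_mul_of_locallyIntegrable hf (continuous_fderiv_apply hφ _)
      (hasCompactSupport_fderiv_apply hc _)).const_mul _

end PLaplace

namespace PLaplace

open Filter Topology Metric ContinuousLinearMap
open scoped ENNReal NNReal Convolution Gradient

variable {d : ℕ}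

/-! ### Integration by parts against weak divergences -/

section Holder

variable {X : Type*} [MeasurableSpace X] {μ : Measure X} {H : Type*} [NormedAddCommGroup H]
  [InnerProductSpace ℝ H]

lemma lintegral_enorm_mul_enorm_le {a b : ℝ} (hab : a.HolderConjugate b) {f g : X → H}
    (hf : AEStronglyMeasurable f μ) (hg : AEStronglyMeasurable g μ) :
    ∫⁻ x, ‖g x‖ₑ * ‖f x‖ₑ ∂μ
      ≤ eLpNorm g (ENNReal.ofReal b) μ * eLpNorm f (ENNReal.ofReal a) μ := by
  have h := ENNReal.lintegral_mul_le_Lp_mul_Lq μ hab.symm hg.enorm hf.enorm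
  rw [eLpNorm_eq_lintegral_rpow_enorm_toReal (by simpa using hab.symm.pos) ENNReal.ofReal_ne_top,
    eLpNorm_eq_lintegral_rpow_enorm_toReal (by simpa using hab.pos) ENNReal.ofReal_ne_top,
    ENNReal.toReal_ofReal hab.nonneg, ENNReal.toReal_ofReal hab.symm.nonneg]
  exact h

lemma enorm_inner_le (x y : H) : ‖inner ℝ x y‖ₑ ≤ ‖x‖ₑ * ‖y‖ₑ := by
  rw [← ofReal_norm, ← ofReal_norm, ← ofReal_norm, ← ENNReal.ofReal_mul (norm_nonneg _)]
  exact ENNReal.ofReal_le_ofReal (norm_inner_le_norm _ _)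

lemma integrable_norm_mul_norm {a b : ℝ} (hab : a.HolderConjugate b) {H' : Type*}
    [NormedAddCommGroup H'] {f : X → H} {g : X → H'} (hf : MemLp f (ENNReal.ofReal a) μ)
    (hg : MemLp g (ENNReal.ofReal b) μ) : Integrable (fun x => ‖g x‖ * ‖f x‖) μ := by
  have := hab.symm.ennrealOfReal
  exact MemLp.integrable_mul hg.norm hf.norm

lemma integrable_inner_of_memLp {a b : ℝ} (hab : a.HolderConjugate b) {f g : X → H}
    (hf : MemLp f (ENNReal.ofReal a) μ) (hg : MemLp g (ENNReal.ofReal b) μ) :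
    Integrable (fun x => inner ℝ (g x) (f x)) μ :=
  (integrable_norm_mul_norm hab hf hg).mono' (hg.1.inner hf.1)
    (Eventually.of_forall fun _ => norm_inner_le_norm _ _)

lemma tendsto_integral_inner {a b : ℝ} (hab : a.HolderConjugate b) {f : X → H} {fn : ℕ → X → H}
    {g : X → H} (hf : MemLp f (ENNReal.ofReal a) μ) (hfn : ∀ n, MemLp (fn n) (ENNReal.ofReal a) μ)
    (hg : MemLp g (ENNReal.ofReal b) μ)
    (h : Tendsto (fun n => eLpNorm (fun x => fn n x - f x) (ENNReal.ofReal a) μ) atTop (𝓝 0)) :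
    Tendsto (fun n => ∫ x, inner ℝ (g x) (fn n x) ∂μ) atTop
      (𝓝 (∫ x, inner ℝ (g x) (f x) ∂μ)) := by
  rw [tendsto_iff_edist_tendsto_0]
  have h1 := ENNReal.Tendsto.const_mul (a := eLpNorm g (ENNReal.ofReal b) μ) h
    (Or.inr hg.2.ne)
  rw [mul_zero] at h1
  refine tendsto_of_tendsto_of_tendsto_of_le_of_le tendsto_const_nhds h1 (fun _ => bot_le)
    fun n => ?_
  rw [edist_eq_enorm_sub, ← integral_sub (integrable_inner_of_memLp hab (hfn n) hg)
    (integrable_inner_of_memLp hab hf hg)]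
  simp only [← inner_sub_right]
  refine (enorm_integral_le_lintegral_enorm _).trans ?_
  refine (lintegral_mono fun x => enorm_inner_le _ _).trans ?_
  exact lintegral_enorm_mul_enorm_le hab ((hfn n).1.sub hf.1) hg.1

end Holder

/-- The mollifications of `ψ` are admissible test functions. They converge in `L²`, and their
gradients in `L^p`, so both pairings pass to the limit. -/
lemma integral_mul_eq_of_hasCompactSupport {B Gψ : Euc d → Euc d} {w ψ : Euc d → ℝ} {p p' : ℝ}
    (hpp : p.HolderConjugate p') (hdiv : HasWeakDivergence B w)
    (hB : MemLp B (ENNReal.ofReal p') volume) (hw : MemLp w 2 volume)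
    (hψ : HasWeakGradient ψ Gψ) (hψ2 : MemLp ψ 2 volume)
    (hG : MemLp Gψ (ENNReal.ofReal p) volume) (hc : HasCompactSupport ψ) :
    ∫ x, w x * ψ x = - ∫ x, inner ℝ (B x) (Gψ x) := by
  have h2 : ENNReal.ofReal 2 = 2 := by simp
  replace hw : MemLp w (ENNReal.ofReal 2) volume := by rw [h2]; exact hw
  replace hψ2 : MemLp ψ (ENNReal.ofReal 2) volume := by rw [h2]; exact hψ2
  have l1 := tendsto_integral_inner Real.HolderConjugate.two_two hψ2
    (fun n => memLp_moll (by norm_num) n hψ2) hw (tendsto_eLpNorm_moll_sub (by norm_num) hψ2)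
  have l2 := tendsto_integral_inner hpp hG
    (fun n => memLp_moll hpp.lt.le n hG) hB (tendsto_eLpNorm_moll_sub hpp.lt.le hG)
  have e : ∀ n, ∫ x, inner ℝ (w x) (moll n ψ x) = - ∫ x, inner ℝ (B x) (moll n Gψ x) := fun n => by
    have h3 := hdiv.2.2 (moll n ψ) (moll_contDiff hψ.1) (moll_hasCompactSupport hc)
    simp only [fderiv_moll_apply hψ] at h3
    simp only [real_inner_comm _ (B _), h3, neg_neg]
    congr 1; ext x
    simp [mul_comm]
  have := tendsto_nhds_unique (l1.congr e) l2.neg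
  rw [← this]
  congr 1; ext x
  simp [mul_comm]

/-- Smooth cutoff functions, equal to `1` on large balls. -/
noncomputable def cutoff (n : ℕ) (x : Euc d) : ℝ :=
  (⟨1, 2, one_pos, one_lt_two⟩ : ContDiffBump (0 : Euc d)) ((1 / ((n : ℝ) + 1)) • x)

lemma cutoff_contDiff (n : ℕ) : ContDiff ℝ ∞ (cutoff n : Euc d → ℝ) :=
  ContDiff.comp (ContDiffBump.contDiff _) (contDiff_const_smul _)

lemma cutoff_hasCompactSupport (n : ℕ) : HasCompactSupport (cutoff n : Euc d → ℝ) :=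
  (ContDiffBump.hasCompactSupport _).comp_smul (by positivity)

lemma cutoff_nonneg (n : ℕ) (x : Euc d) : 0 ≤ cutoff n x := ContDiffBump.nonneg _

lemma cutoff_le_one (n : ℕ) (x : Euc d) : cutoff n x ≤ 1 := ContDiffBump.le_one _

lemma tendsto_cutoff (x : Euc d) : Tendsto (fun n => cutoff n x) atTop (𝓝 1) := by
  have h1 : Tendsto (fun n : ℕ => (1 / ((n : ℝ) + 1)) • x) atTop (𝓝 ((0 : ℝ) • x)) :=
    tendsto_one_div_add_atTop_nhds_zero_nat.smul_const x
  rw [zero_smul] at h1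
  have h2 := ((⟨1, 2, one_pos, one_lt_two⟩ : ContDiffBump (0 : Euc d)).continuous.tendsto 0).comp h1
  rwa [ContDiffBump.one_of_mem_closedBall _ (by simp)] at h2

lemma exists_norm_gradient_cutoff_le (d : ℕ) :
    ∃ C : ℝ, 0 ≤ C ∧ ∀ n (x : Euc d), ‖∇ (cutoff n) x‖ ≤ C * (1 / ((n : ℝ) + 1)) := by
  set χ : ContDiffBump (0 : Euc d) := ⟨1, 2, one_pos, one_lt_two⟩ with hχ
  obtain ⟨C, hC⟩ := ((χ.contDiff (n := 1)).continuous_fderiv (by simp)).bounded_above_of_compact_support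
    (χ.hasCompactSupport.fderiv (𝕜 := ℝ))
  refine ⟨C, (norm_nonneg _).trans (hC 0), fun n x => ?_⟩
  rw [norm_gradient]
  have h1 : fderiv ℝ (cutoff n : Euc d → ℝ) x
      = (1 / ((n : ℝ) + 1)) • fderiv ℝ χ ((1 / ((n : ℝ) + 1)) • x) :=
    fderiv_comp_smul (f := χ) (c := 1 / ((n : ℝ) + 1)) (x := x)
  rw [h1, norm_smul, Real.norm_eq_abs, abs_of_nonneg (by positivity), mul_comm]
  gcongr
  exact hC _

/-- Integration by parts: `∫ (div B) ψ = - ∫ B · ∇ψ` for `ψ ∈ L² ∩ L^p` with `∇ψ ∈ L^p`,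
`B ∈ L^{p'}` and `div B ∈ L²`. -/
lemma integral_mul_eq_neg_integral_inner {B Gψ : Euc d → Euc d} {w ψ : Euc d → ℝ} {p p' : ℝ}
    (hpp : p.HolderConjugate p') (hdiv : HasWeakDivergence B w)
    (hB : MemLp B (ENNReal.ofReal p') volume) (hw : MemLp w 2 volume)
    (hψ : HasWeakGradient ψ Gψ) (hψ2 : MemLp ψ 2 volume)
    (hψp : MemLp ψ (ENNReal.ofReal p) volume) (hG : MemLp Gψ (ENNReal.ofReal p) volume) :
    ∫ x, w x * ψ x = - ∫ x, inner ℝ (B x) (Gψ x) := by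
  obtain ⟨C, hC0, hC⟩ := exists_norm_gradient_cutoff_le d
  have hcu : ∀ n, Continuous (cutoff n : Euc d → ℝ) := fun n => (cutoff_contDiff n).continuous
  have hgc : ∀ n, Continuous (∇ (cutoff n : Euc d → ℝ)) := fun n =>
    continuous_gradient (cutoff_contDiff n)
  have hC1 : ∀ n (x : Euc d), ‖∇ (cutoff n) x‖ ≤ C := fun n x => by
    refine (hC n x).trans (mul_le_of_le_one_right hC0 ?_)
    rw [div_le_one (by positivity)]
    linarith [(n.cast_nonneg : (0 : ℝ) ≤ n)]
  have habs : ∀ n (x : Euc d), ‖cutoff n x‖ ≤ 1 := fun n x => by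
    rw [Real.norm_eq_abs, abs_of_nonneg (cutoff_nonneg n x)]
    exact cutoff_le_one n x
  have e : ∀ n, ∫ x, w x * (cutoff n x * ψ x)
      = - ∫ x, inner ℝ (B x) (cutoff n x • Gψ x + ψ x • ∇ (cutoff n) x) := fun n => by
    refine integral_mul_eq_of_hasCompactSupport hpp hdiv hB hw
      (HasWeakGradient_mul_smooth hψ (cutoff_contDiff n)) ?_ ?_
      (cutoff_hasCompactSupport n).mul_right
    · refine MemLp.of_le_mul (c := 1) hψ2 ((hcu n).aestronglyMeasurable.mul hψ2.1)
        (Eventually.of_forall fun x => ?_)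
      rw [norm_mul]
      gcongr
      exact habs n x
    · refine MemLp.add ?_ ?_
      · refine MemLp.of_le_mul (c := 1) hG ((hcu n).aestronglyMeasurable.smul hG.1)
          (Eventually.of_forall fun x => ?_)
        rw [norm_smul]
        gcongr
        exact habs n x
      · refine MemLp.of_le_mul (c := C) hψp (hψp.1.smul (hgc n).aestronglyMeasurable)
          (Eventually.of_forall fun x => ?_)
        rw [norm_smul, mul_comm]
        gcongr
        exact hC1 n x
  have h2 : ENNReal.ofReal 2 = 2 := by simp
  have iwψ : Integrable (fun x => ‖w x‖ * ‖ψ x‖) volume :=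
    integrable_norm_mul_norm Real.HolderConjugate.two_two (by rw [h2]; exact hψ2) (by rw [h2]; exact hw)
  have iBG := integrable_norm_mul_norm hpp hG hB
  have iBψ := integrable_norm_mul_norm hpp hψp hB
  have l1 : Tendsto (fun n => ∫ x, w x * (cutoff n x * ψ x)) atTop (𝓝 (∫ x, w x * ψ x)) := by
    refine tendsto_integral_of_dominated_convergence _
      (fun n => hw.1.mul ((hcu n).aestronglyMeasurable.mul hψ2.1)) iwψ
      (fun n => Eventually.of_forall fun x => ?_) (Eventually.of_forall fun x => ?_)
    · rw [norm_mul, norm_mul]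
      gcongr
      exact mul_le_of_le_one_left (norm_nonneg _) (habs n x)
    · have := ((tendsto_cutoff x).mul_const (ψ x)).const_mul (w x)
      rwa [one_mul] at this
  have l2 : Tendsto (fun n => ∫ x, inner ℝ (B x) (cutoff n x • Gψ x + ψ x • ∇ (cutoff n) x)) atTop
      (𝓝 (∫ x, inner ℝ (B x) (Gψ x))) := by
    -- The second dominating term comes from `ψ ∇(cutoff n)` and uses `ψ ∈ L^p`; the term itself
    -- tends to `0` because the gradient of the cutoff is of order `1/(n+1)`.
    refine tendsto_integral_of_dominated_convergence
      (fun x => ‖B x‖ * ‖Gψ x‖ + C * (‖B x‖ * ‖ψ x‖))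
      (fun n => hB.1.inner (((hcu n).aestronglyMeasurable.smul hG.1).add
        (hψp.1.smul (hgc n).aestronglyMeasurable))) (iBG.add (iBψ.const_mul C))
      (fun n => Eventually.of_forall fun x => ?_) (Eventually.of_forall fun x => ?_)
    · refine (norm_inner_le_norm _ _).trans ?_
      calc ‖B x‖ * ‖cutoff n x • Gψ x + ψ x • ∇ (cutoff n) x‖
          ≤ ‖B x‖ * (1 * ‖Gψ x‖ + ‖ψ x‖ * C) := by
            gcongr
            refine (norm_add_le _ _).trans ?_
            rw [norm_smul, norm_smul]
            gcongr
            · exact habs n x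
            · exact hC1 n x
        _ = _ := by ring
    · have h3 : Tendsto (fun n => ∇ (cutoff n) x) atTop (𝓝 0) := by
        refine squeeze_zero_norm (fun n => hC n x) ?_
        have := (tendsto_one_div_add_atTop_nhds_zero_nat (𝕜 := ℝ)).const_mul C
        rwa [mul_zero] at this
      have h4 := ((tendsto_cutoff x).smul_const (Gψ x)).add (h3.const_smul (ψ x))
      rw [one_smul, smul_zero, add_zero] at h4
      exact ((continuous_const.inner continuous_id).tendsto (Gψ x)).comp h4
  exact tendsto_nhds_unique (l1.congr e) l2.neg

end PLaplace

namespace PLaplace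

open Filter Topology Metric ContinuousLinearMap
open scoped ENNReal NNReal Convolution Gradient

variable {d : ℕ}

/-! ### Testing an evolution equation with convex functionals -/

/-- If `J` is convex along the path `v` with subgradients `δ`, then `J` grows at most by the
integral of `⟪δ, v'⟫`. -/
lemma sub_le_integral_inner_of_subgradient {H : Type*} [NormedAddCommGroup H]
    [InnerProductSpace ℝ H] [CompleteSpace H] {v v' δ : ℝ → H} {J : ℝ → ℝ} {a b : ℝ} (hab : a ≤ b)
    (hv' : IntervalIntegrable v' volume a b)
    (hv : ∀ s ∈ Icc a b, ∀ t ∈ Icc a b, s ≤ t → v t - v s = ∫ τ in s..t, v' τ)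
    (hδ : ContinuousOn δ (Icc a b))
    (hJ : ∀ s ∈ Icc a b, ∀ t ∈ Icc a b, s ≤ t → J t - J s ≤ inner ℝ (δ t) (v t - v s)) :
    IntervalIntegrable (fun τ => inner ℝ (δ τ) (v' τ)) volume a b ∧
      J b - J a ≤ ∫ τ in a..b, inner ℝ (δ τ) (v' τ) := by
  have hsub : ∀ {s t}, s ∈ Icc a b → t ∈ Icc a b → s ≤ t →
      IntervalIntegrable v' volume s t := fun {s t} hs ht hst => by
    refine hv'.mono_set ?_
    rw [uIcc_of_le hst, uIcc_of_le hab]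
    exact Icc_subset_Icc hs.1 ht.2
  obtain ⟨C, hC⟩ := isCompact_Icc.exists_bound_of_continuousOn hδ
  have hint : IntervalIntegrable (fun τ => inner ℝ (δ τ) (v' τ)) volume a b := by
    have h1 : IntervalIntegrable (fun τ => C * ‖v' τ‖) volume a b := hv'.norm.const_mul C
    rw [intervalIntegrable_iff_integrableOn_Ioc_of_le hab] at hv' h1 ⊢
    refine h1.mono' ?_ ?_
    · exact ((hδ.mono Ioc_subset_Icc_self).aestronglyMeasurable measurableSet_Ioc).inner hv'.1
    · filter_upwards [ae_restrict_mem measurableSet_Ioc] with τ hτ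
      refine (norm_inner_le_norm _ _).trans ?_
      gcongr
      exact hC τ (Ioc_subset_Icc_self hτ)
  refine ⟨hint, ?_⟩
  have hisub : ∀ {s t}, s ∈ Icc a b → t ∈ Icc a b → s ≤ t →
      IntervalIntegrable (fun τ => inner ℝ (δ τ) (v' τ)) volume s t := fun {s t} hs ht hst => by
    refine hint.mono_set ?_
    rw [uIcc_of_le hst, uIcc_of_le hab]
    exact Icc_subset_Icc hs.1 ht.2
  -- The subgradient inequality on `[s, t]` involves `δ t` only. By uniform continuity `δ t` may be
  -- replaced by `δ τ` on short intervals at the price `ε ‖v' τ‖`, and the increments telescope over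
  -- a partition of `[a, b]`.
  suffices h : ∀ ε > 0, J b - J a ≤ (∫ τ in a..b, inner ℝ (δ τ) (v' τ))
      + ε * ∫ τ in a..b, ‖v' τ‖ by
    have ht : Tendsto (fun ε : ℝ => (∫ τ in a..b, inner ℝ (δ τ) (v' τ))
        + ε * ∫ τ in a..b, ‖v' τ‖) (𝓝[>] 0) (𝓝 ((∫ τ in a..b, inner ℝ (δ τ) (v' τ))
        + 0 * ∫ τ in a..b, ‖v' τ‖)) := by
      exact (Continuous.tendsto (by fun_prop) 0).mono_left nhdsWithin_le_nhds
    rw [zero_mul, add_zero] at ht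
    exact ge_of_tendsto ht (eventually_nhdsWithin_of_forall h)
  intro ε hε
  have huc := isCompact_Icc.uniformContinuousOn_of_continuous hδ
  rw [Metric.uniformContinuousOn_iff_le] at huc
  obtain ⟨η, hη, hη'⟩ := huc ε hε
  have hloc : ∀ s ∈ Icc a b, ∀ t ∈ Icc a b, s ≤ t → t - s ≤ η →
      J t - J s ≤ (∫ τ in s..t, inner ℝ (δ τ) (v' τ)) + ε * ∫ τ in s..t, ‖v' τ‖ := by
    intro s hs t ht hst hts
    have hi := hsub hs ht hst
    refine (hJ s hs t ht hst).trans ?_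
    rw [hv s hs t ht hst, ← intervalIntegral.integral_const_mul,
      ← intervalIntegral.integral_add (hisub hs ht hst) (hi.norm.const_mul ε)]
    have e1 : inner ℝ (δ t) (∫ τ in s..t, v' τ) = ∫ τ in s..t, inner ℝ (δ t) (v' τ) :=
      ((innerSL ℝ (δ t)).intervalIntegral_comp_comm hi).symm
    rw [e1]
    refine intervalIntegral.integral_mono_on hst ?_
      ((hisub hs ht hst).add (hi.norm.const_mul ε)) fun τ hτ => ?_
    · rw [intervalIntegrable_iff_integrableOn_Ioc_of_le hst] at hi ⊢
      exact hi.const_inner (δ t)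
    · have hτ' : τ ∈ Icc a b := ⟨hs.1.trans hτ.1, hτ.2.trans ht.2⟩
      have h1 : dist (δ t) (δ τ) ≤ ε := hη' t ht τ hτ' (by
        rw [Real.dist_eq, abs_of_nonneg (by linarith [hτ.2])]
        linarith [hτ.1])
      have h2 : inner ℝ (δ t - δ τ) (v' τ) ≤ ε * ‖v' τ‖ := by
        refine (real_inner_le_norm _ _).trans ?_
        rw [← dist_eq_norm]
        gcongr
      rw [inner_sub_left] at h2
      linarith
  -- With `N > (b - a)/η` equal steps, each step is shorter than the modulus `η`.
  obtain ⟨N, hN⟩ := exists_nat_gt ((b - a) / η)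
  have hN0 : (0 : ℝ) < N := lt_of_le_of_lt (div_nonneg (by linarith) hη.le) hN
  set t : ℕ → ℝ := fun i => a + i * ((b - a) / N) with ht
  have hmem : ∀ i ≤ N, t i ∈ Icc a b := fun i hi => by
    have h1 : (i : ℝ) ≤ N := by exact_mod_cast hi
    refine ⟨le_add_of_nonneg_right (mul_nonneg (Nat.cast_nonneg i) (div_nonneg (by linarith) hN0.le)), ?_⟩
    have : (i : ℝ) * ((b - a) / N) ≤ N * ((b - a) / N) := by
      gcongr
    rw [mul_div_cancel₀ _ hN0.ne'] at this
    simp only [ht]; linarith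
  have hstep : ∀ i, t (i + 1) - t i = (b - a) / N := fun i => by
    simp only [ht]; push_cast; ring
  have hind : ∀ i ≤ N, J (t i) - J a ≤ (∫ τ in a..(t i), inner ℝ (δ τ) (v' τ))
      + ε * ∫ τ in a..(t i), ‖v' τ‖ := by
    intro i
    induction i with
    | zero => intro _; simp [ht]
    | succ i ih =>
      intro hi
      have h1 := hmem i (by omega)
      have h2 := hmem (i + 1) hi
      have h3 : t i ≤ t (i + 1) := by
        have := hstep i
        have : 0 ≤ (b - a) / N := div_nonneg (by linarith) hN0.le
        linarith [hstep i]
      have h4 := hloc _ h1 _ h2 h3 (by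
        rw [hstep, div_le_iff₀ hN0]
        rw [div_lt_iff₀ hη] at hN
        linarith)
      have h5 := ih (by omega)
      have ha : a ∈ Icc a b := left_mem_Icc.2 hab
      have e1 := intervalIntegral.integral_add_adjacent_intervals (hisub ha h1 h1.1)
        (hisub h1 h2 h3)
      have e2 := intervalIntegral.integral_add_adjacent_intervals (hsub ha h1 h1.1).norm
        (hsub h1 h2 h3).norm
      rw [← e1, ← e2]
      linarith
  have hlast := hind N le_rfl
  have : t N = b := by
    simp only [ht]
    rw [mul_div_cancel₀ _ hN0.ne']; ring
  rwa [this] at hlast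

/-- A function `j` with `j(0) = j'(0) = 0` and `0 ≤ j'' ≤ K`, where `β = j'`, `γ = j''`. -/
structure ConvexTriple (j β γ : ℝ → ℝ) (K : ℝ) : Prop where
  hj : ∀ s, HasDerivAt j (β s) s
  hβ : ∀ s, HasDerivAt β (γ s) s
  hγ : Continuous γ
  nonneg : ∀ s, 0 ≤ γ s
  le : ∀ s, γ s ≤ K
  j0 : j 0 = 0
  β0 : β 0 = 0

namespace ConvexTriple

variable {j β γ : ℝ → ℝ} {K : ℝ} (h : ConvexTriple j β γ K)
include h

lemma K_nonneg : 0 ≤ K := (h.nonneg 0).trans (h.le 0)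

lemma abs_γ_le (s : ℝ) : |γ s| ≤ K := by rw [abs_of_nonneg (h.nonneg s)]; exact h.le s

lemma continuous_β : Continuous β := continuous_iff_continuousAt.2 fun s => (h.hβ s).continuousAt

lemma continuous_j : Continuous j := continuous_iff_continuousAt.2 fun s => (h.hj s).continuousAt

lemma monotone_β : Monotone β :=
  monotone_of_hasDerivAt_nonneg h.hβ h.nonneg

lemma abs_β_sub_le (a b : ℝ) : |β a - β b| ≤ K * |a - b| := by
  have := Convex.norm_image_sub_le_of_norm_hasDerivWithin_le (f := β) (f' := γ) (s := univ)
    (C := K) (x := b) (y := a) (fun x _ => (h.hβ x).hasDerivWithinAt)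
    (fun x _ => h.abs_γ_le x) convex_univ trivial trivial
  simpa using this

lemma abs_β_le (a : ℝ) : |β a| ≤ K * |a| := by
  have := h.abs_β_sub_le a 0
  simpa [h.β0] using this

lemma sub_le (a b : ℝ) : j a - j b ≤ β a * (a - b) := by
  rcases lt_trichotomy a b with hab | rfl | hab
  · obtain ⟨c, hc, hc'⟩ := exists_hasDerivAt_eq_slope j β hab h.continuous_j.continuousOn
      fun x _ => h.hj x
    rw [eq_div_iff (by linarith)] at hc'
    have := mul_le_mul_of_nonneg_right (h.monotone_β hc.1.le) (by linarith : 0 ≤ b - a)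
    linarith
  · simp
  · obtain ⟨c, hc, hc'⟩ := exists_hasDerivAt_eq_slope j β hab h.continuous_j.continuousOn
      fun x _ => h.hj x
    rw [eq_div_iff (by linarith)] at hc'
    have := mul_le_mul_of_nonneg_right (h.monotone_β hc.2.le) (by linarith : 0 ≤ a - b)
    linarith

lemma j_nonneg (a : ℝ) : 0 ≤ j a := by
  have := h.sub_le 0 a
  rw [h.j0, h.β0] at this
  linarith

lemma j_le (a : ℝ) : j a ≤ K * a ^ 2 := by
  have h1 := h.sub_le a 0
  rw [h.j0, sub_zero, sub_zero] at h1
  refine h1.trans ((le_abs_self _).trans ?_)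
  rw [abs_mul, ← sq_abs, sq, ← mul_assoc]
  gcongr
  exact h.abs_β_le a

end ConvexTriple

/-- A path `v` in `L²` with `v' = div B` for almost every time, where `G` is the spatial gradient
of `v`. -/
structure IsFlow (p T : ℝ) (v v' : ℝ → Lp ℝ 2 (volume : Measure (Euc d)))
    (G B : ℝ → Euc d → Euc d) : Prop where
  cont : ContinuousOn v (Icc 0 T)
  int : ∀ s t, 0 < s → s ≤ t → t ≤ T → IntervalIntegrable v' volume s t
  ftc : ∀ s t, 0 < s → s ≤ t → t ≤ T → v t - v s = ∫ τ in s..t, v' τ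
  grad : ∀ᵐ t ∂(volume.restrict (Ioo 0 T)), HasWeakGradient (v t) (G t)
  memG : ∀ᵐ t ∂(volume.restrict (Ioo 0 T)), MemLp (G t) (ENNReal.ofReal p) volume
  memB : ∀ᵐ t ∂(volume.restrict (Ioo 0 T)), MemLp (B t) (ENNReal.ofReal (p / (p - 1))) volume
  div : ∀ᵐ t ∂(volume.restrict (Ioo 0 T)), HasWeakDivergence (B t) (v' t)

lemma memLp_of_abs_le_mul {f g : Euc d → ℝ} {q : ℝ≥0∞} {c : ℝ} (hg : MemLp g q volume)
    (hf : AEStronglyMeasurable f volume) (h : ∀ x, |f x| ≤ c * |g x|) : MemLp f q volume :=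
  MemLp.of_le_mul hg hf (Eventually.of_forall h)

/-! ### Testing with `ζ β(v)` -/

section Test

variable {p T : ℝ} {v v' : ℝ → Lp ℝ 2 (volume : Measure (Euc d))} {G B : ℝ → Euc d → Euc d}
  {j β γ : ℝ → ℝ} {K Z C : ℝ} {ζ : Euc d → ℝ}

lemma abs_mul_β_le (h : ConvexTriple j β γ K) (hζ0 : ∀ x, 0 ≤ ζ x) (hζ1 : ∀ x, ζ x ≤ Z)
    (x : Euc d) (a : ℝ) : |ζ x * β a| ≤ Z * K * |a| := by
  rw [abs_mul, abs_of_nonneg (hζ0 x), mul_assoc]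
  have := h.K_nonneg
  have := (hζ0 x).trans (hζ1 x)
  gcongr
  · exact hζ1 x
  · exact h.abs_β_le a

lemma memLp_mul_β (h : ConvexTriple j β γ K) (hζ : Continuous ζ) (hζ0 : ∀ x, 0 ≤ ζ x)
    (hζ1 : ∀ x, ζ x ≤ Z) {q : ℝ≥0∞} {f : Euc d → ℝ} (hf : MemLp f q volume) :
    MemLp (fun x => ζ x * β (f x)) q volume :=
  memLp_of_abs_le_mul (c := Z * K) hf
    (hζ.aestronglyMeasurable.mul (h.continuous_β.comp_aestronglyMeasurable hf.1))
    fun x => abs_mul_β_le h hζ0 hζ1 x (f x)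

lemma integrable_mul_j (h : ConvexTriple j β γ K) (hζ : Continuous ζ) (hζ0 : ∀ x, 0 ≤ ζ x)
    (hζ1 : ∀ x, ζ x ≤ Z) {f : Euc d → ℝ} (hf : MemLp f 2 volume) :
    Integrable (fun x => ζ x * j (f x)) volume := by
  refine (hf.integrable_sq.const_mul (Z * K)).mono'
    (hζ.aestronglyMeasurable.mul (h.continuous_j.comp_aestronglyMeasurable hf.1))
    (Eventually.of_forall fun x => ?_)
  rw [Real.norm_eq_abs, abs_of_nonneg (mul_nonneg (hζ0 x) (h.j_nonneg _)), mul_assoc]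
  have := (hζ0 x).trans (hζ1 x)
  gcongr
  · exact h.j_nonneg _
  · exact hζ1 x
  · exact h.j_le _

/-- Convexity of `j` integrated against the weight: `ζ β(f)` is a subgradient at `f` of the
functional `f ↦ ∫ ζ j(f)` on `L²`. -/
lemma integral_mul_j_sub_le (h : ConvexTriple j β γ K) (hζ : Continuous ζ) (hζ0 : ∀ x, 0 ≤ ζ x)
    (hζ1 : ∀ x, ζ x ≤ Z) (f g : Lp ℝ 2 (volume : Measure (Euc d))) :
    (∫ x, ζ x * j (f x)) - ∫ x, ζ x * j (g x)
      ≤ inner ℝ ((memLp_mul_β h hζ hζ0 hζ1 (Lp.memLp f)).toLp _) (f - g) := by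
  rw [← integral_sub (integrable_mul_j h hζ hζ0 hζ1 (Lp.memLp f))
    (integrable_mul_j h hζ hζ0 hζ1 (Lp.memLp g))]
  have e := L2.inner_def (𝕜 := ℝ) ((memLp_mul_β h hζ hζ0 hζ1 (Lp.memLp f)).toLp _) (f - g)
  have hi := L2.integrable_inner (𝕜 := ℝ) ((memLp_mul_β h hζ hζ0 hζ1 (Lp.memLp f)).toLp _) (f - g)
  rw [e]
  refine integral_mono_ae ((integrable_mul_j h hζ hζ0 hζ1 (Lp.memLp f)).sub
    (integrable_mul_j h hζ hζ0 hζ1 (Lp.memLp g))) hi ?_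
  filter_upwards [(memLp_mul_β h hζ hζ0 hζ1 (Lp.memLp f)).coeFn_toLp, Lp.coeFn_sub f g]
    with x hx hx'
  rw [hx, hx', Pi.sub_apply, ← mul_sub]
  have h1 := mul_le_mul_of_nonneg_left (h.sub_le (f x) (g x)) (hζ0 x)
  refine h1.trans (le_of_eq ?_)
  simp
  ring

lemma continuousOn_toLp_mul_β (h : ConvexTriple j β γ K) (hζ : Continuous ζ)
    (hζ0 : ∀ x, 0 ≤ ζ x) (hζ1 : ∀ x, ζ x ≤ Z) {s : Set ℝ} (hv : ContinuousOn v s) :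
    ContinuousOn (fun t => (memLp_mul_β h hζ hζ0 hζ1 (Lp.memLp (v t))).toLp _) s := by
  have hK := h.K_nonneg
  have hZ := (hζ0 0).trans (hζ1 0)
  have hl : LipschitzWith (Z * K).toNNReal fun f : Lp ℝ 2 (volume : Measure (Euc d)) =>
      (memLp_mul_β h hζ hζ0 hζ1 (Lp.memLp f)).toLp _ := by
    refine LipschitzWith.of_dist_le_mul fun f g => ?_
    rw [dist_eq_norm, dist_eq_norm, Real.coe_toNNReal _ (by positivity)]
    refine Lp.norm_le_mul_norm_of_ae_le_mul ?_
    filter_upwards [(memLp_mul_β h hζ hζ0 hζ1 (Lp.memLp f)).coeFn_toLp,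
      (memLp_mul_β h hζ hζ0 hζ1 (Lp.memLp g)).coeFn_toLp, Lp.coeFn_sub f g,
      Lp.coeFn_sub ((memLp_mul_β h hζ hζ0 hζ1 (Lp.memLp f)).toLp _)
        ((memLp_mul_β h hζ hζ0 hζ1 (Lp.memLp g)).toLp _)] with x h1 h2 h3 h4
    rw [h4, h3, Pi.sub_apply, Pi.sub_apply, h1, h2, ← mul_sub, Real.norm_eq_abs, Real.norm_eq_abs,
      abs_mul, abs_of_nonneg (hζ0 x), mul_assoc]
    gcongr
    · exact hζ1 x
    · exact h.abs_β_sub_le _ _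
  exact hl.continuous.comp_continuousOn hv

/-- The subgradient inequality, used in both directions, squeezes the increment of the functional
between two inner products that tend to `0`. -/
lemma IsFlow.continuousOn_integral_mul_j (hF : IsFlow p T v v' G B) (h : ConvexTriple j β γ K)
    (hζ : Continuous ζ) (hζ0 : ∀ x, 0 ≤ ζ x) (hζ1 : ∀ x, ζ x ≤ Z) :
    ContinuousOn (fun t => ∫ x, ζ x * j (v t x)) (Icc 0 T) := by
  intro t ht
  have hδ := continuousOn_toLp_mul_β h hζ hζ0 hζ1 hF.cont t ht
  have hv := hF.cont t ht
  set δ := fun t => (memLp_mul_β h hζ hζ0 hζ1 (Lp.memLp (v t))).toLp _ with hδd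
  have h1 : Tendsto (fun s => inner ℝ (δ s) (v s - v t)) (𝓝[Icc 0 T] t)
      (𝓝 (inner ℝ (δ t) (v t - v t))) := Tendsto.inner hδ (hv.sub_const _)
  have h2 : Tendsto (fun s => - inner ℝ (δ t) (v t - v s)) (𝓝[Icc 0 T] t)
      (𝓝 (- inner ℝ (δ t) (v t - v t))) :=
    (Tendsto.inner tendsto_const_nhds (hv.const_sub _)).neg
  rw [sub_self, inner_zero_right] at h1 h2
  rw [neg_zero] at h2
  have h3 := tendsto_of_tendsto_of_tendsto_of_le_of_le h2 h1
    (f := fun s => (∫ x, ζ x * j (v s x)) - ∫ x, ζ x * j (v t x))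
    (fun s => by
      have := integral_mul_j_sub_le h hζ hζ0 hζ1 (v t) (v s)
      simp only [hδd]; linarith)
    (fun s => integral_mul_j_sub_le h hζ hζ0 hζ1 (v s) (v t))
  have := h3.add_const (∫ x, ζ x * j (v t x))
  simp only [sub_add_cancel, zero_add] at this
  exact this

/-- The integrand obtained from testing with `ζ β(v)`. -/
noncomputable def testIntegrand (v : ℝ → Lp ℝ 2 (volume : Measure (Euc d))) (G B : ℝ → Euc d → Euc d)
    (β γ : ℝ → ℝ) (ζ : Euc d → ℝ) (t : ℝ) : ℝ :=
  ∫ x, inner ℝ (B t x) (ζ x • γ (v t x) • G t x + β (v t x) • ∇ ζ x)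

/-- The functional `∫ ζ j(v)` grows at most by the integral of `⟪ζ β(v), v'⟫`. Since `v' = div B`,
integration by parts turns this pairing into minus the integral of `B · ∇(ζ β(v))`. -/
lemma IsFlow.test (hp : 2 ≤ p) (hF : IsFlow p T v v' G B) (h : ConvexTriple j β γ K)
    (hζ : ContDiff ℝ ∞ ζ) (hζ0 : ∀ x, 0 ≤ ζ x) (hζ1 : ∀ x, ζ x ≤ Z) (hζ2 : ∀ x, ‖∇ ζ x‖ ≤ C)
    {s t : ℝ} (hs : 0 < s) (hst : s ≤ t) (ht : t ≤ T) :
    IntervalIntegrable (testIntegrand v G B β γ ζ) volume s t ∧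
      (∫ x, ζ x * j (v t x)) + ∫ τ in s..t, testIntegrand v G B β γ ζ τ
        ≤ ∫ x, ζ x * j (v s x) := by
  have hsubset : Icc s t ⊆ Icc 0 T := Icc_subset_Icc hs.le ht
  have hK := h.K_nonneg
  have hZ := (hζ0 0).trans (hζ1 0)
  have hC := (norm_nonneg _).trans (hζ2 0)
  have hδ := continuousOn_toLp_mul_β h hζ.continuous hζ0 hζ1 (hF.cont.mono hsubset)
  set δ := fun t => (memLp_mul_β h hζ.continuous hζ0 hζ1 (Lp.memLp (v t))).toLp _ with hδd
  obtain ⟨h1, h2⟩ := sub_le_integral_inner_of_subgradient (v := v) (v' := v') (δ := δ)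
    (J := fun t => ∫ x, ζ x * j (v t x)) hst (hF.int s t hs hst ht)
    (fun a ha b hb hab => hF.ftc a b (hs.trans_le ha.1) hab (hb.2.trans ht)) hδ
    (fun a _ b _ _ => integral_mul_j_sub_le h hζ.continuous hζ0 hζ1 (v b) (v a))
  have hae : ∀ᵐ τ ∂(volume.restrict (Ioo 0 T)),
      inner ℝ (δ τ) (v' τ) = - testIntegrand v G B β γ ζ τ := by
    filter_upwards [hF.grad, hF.memG, hF.memB, hF.div] with τ g1 g2 g3 g4
    have hvp : MemLp (v τ) (ENNReal.ofReal p) volume :=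
      memLp_of_gradient g1 hp (Lp.memLp _) g2
    have hgr := HasWeakGradient_mul_smooth (HasWeakGradient_comp g1 h.hβ h.hγ h.abs_γ_le) hζ
    have hγm : AEStronglyMeasurable (fun x => γ (v τ x)) volume :=
      h.hγ.comp_aestronglyMeasurable (Lp.memLp (v τ)).1
    have hβm : AEStronglyMeasurable (fun x => β (v τ x)) volume :=
      h.continuous_β.comp_aestronglyMeasurable (Lp.memLp (v τ)).1
    have hmem : MemLp (fun x => ζ x • γ (v τ x) • G τ x + β (v τ x) • ∇ ζ x)
        (ENNReal.ofReal p) volume := by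
      refine MemLp.add ?_ ?_
      · refine MemLp.of_le_mul (c := Z * K) g2
          (hζ.continuous.aestronglyMeasurable.smul (hγm.smul g2.1))
          (Eventually.of_forall fun x => ?_)
        rw [norm_smul, norm_smul, mul_assoc, Real.norm_eq_abs, Real.norm_eq_abs,
          abs_of_nonneg (hζ0 x)]
        gcongr
        · exact hζ1 x
        · exact h.abs_γ_le _
      · refine MemLp.of_le_mul (c := K * C) hvp
          (hβm.smul (continuous_gradient hζ).aestronglyMeasurable)
          (Eventually.of_forall fun x => ?_)
        rw [norm_smul, Real.norm_eq_abs, Real.norm_eq_abs]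
        calc |β (v τ x)| * ‖∇ ζ x‖ ≤ (K * |v τ x|) * C := by
              gcongr
              · exact h.abs_β_le _
              · exact hζ2 x
          _ = _ := by ring
    have hibp := integral_mul_eq_neg_integral_inner
      (Real.HolderConjugate.conjExponent (by linarith : 1 < p)) g4 g3 (Lp.memLp (v' τ)) hgr
      (memLp_mul_β h hζ.continuous hζ0 hζ1 (Lp.memLp (v τ)))
      (memLp_mul_β h hζ.continuous hζ0 hζ1 hvp) hmem
    rw [testIntegrand, ← hibp, L2.inner_def]
    refine integral_congr_ae ?_
    filter_upwards [(memLp_mul_β h hζ.continuous hζ0 hζ1 (Lp.memLp (v τ))).coeFn_toLp] with x hx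
    simp only [hδd, hx]
    simp
  have hae' : ∀ᵐ τ ∂volume, τ ∈ uIoc s t →
      inner ℝ (δ τ) (v' τ) = - testIntegrand v G B β γ ζ τ := by
    rw [ae_restrict_iff' measurableSet_Ioo] at hae
    -- The interval integral runs over `(s, t]`, which may contain `T`, whereas the equation is
    -- known on the open interval; the point `T` is discarded as a null set.
    filter_upwards [hae, (measure_singleton T : volume {T} = 0) |> compl_mem_ae_iff.2]
      with τ h3 h4 h5
    rw [uIoc_of_le hst] at h5
    exact h3 ⟨hs.trans h5.1, lt_of_le_of_ne (h5.2.trans ht) h4⟩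
  have e := intervalIntegral.integral_congr_ae hae'
  have hint : IntervalIntegrable (fun τ => - testIntegrand v G B β γ ζ τ) volume s t := by
    refine h1.congr_ae ?_
    exact (ae_restrict_iff' measurableSet_uIoc).2 hae'
  refine ⟨by simpa only [Pi.neg_def, neg_neg] using hint.neg, ?_⟩
  rw [e, intervalIntegral.integral_neg] at h2
  linarith

end Test

end PLaplace

namespace PLaplace

open Filter Topology Metric ContinuousLinearMap
open scoped ENNReal NNReal Convolution Gradient

variable {d : ℕ}

section Test

variable {p T : ℝ} {v v' : ℝ → Lp ℝ 2 (volume : Measure (Euc d))} {G B : ℝ → Euc d → Euc d}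
  {j β γ : ℝ → ℝ} {K Z C : ℝ} {ζ : Euc d → ℝ}

/-- The integrated form of the test inequality, from the initial time on. -/
lemma IsFlow.test_lintegral (hp : 2 ≤ p) (hF : IsFlow p T v v' G B) (h : ConvexTriple j β γ K)
    (hζ : ContDiff ℝ ∞ ζ) (hζ0 : ∀ x, 0 ≤ ζ x) (hζ1 : ∀ x, ζ x ≤ Z) (hζ2 : ∀ x, ‖∇ ζ x‖ ≤ C)
    {t : ℝ} (ht0 : 0 < t) (ht : t ≤ T) {D : ℝ → ℝ} (hD : IntegrableOn D (Ioo 0 t))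
    (hD0 : ∀ τ, 0 ≤ D τ)
    (hI : ∀ᵐ τ ∂(volume.restrict (Ioo 0 T)), 0 ≤ testIntegrand v G B β γ ζ τ + D τ) :
    ENNReal.ofReal (∫ x, ζ x * j (v t x))
        + ∫⁻ τ in Ioo 0 t, ENNReal.ofReal (testIntegrand v G B β γ ζ τ + D τ)
      ≤ ENNReal.ofReal ((∫ x, ζ x * j (v 0 x)) + ∫ τ in Ioo 0 t, D τ) := by
  set I := testIntegrand v G B β γ ζ with hIdef
  set J : ℝ → ℝ := fun t => ∫ x, ζ x * j (v t x) with hJdef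
  have hJ0 : ∀ t, 0 ≤ J t := fun t =>
    integral_nonneg fun x => mul_nonneg (hζ0 x) (h.j_nonneg _)
  have hDt : ∀ s, 0 < s → s ≤ t → IntervalIntegrable D volume s t := fun s hs hst => by
    rw [intervalIntegrable_iff_integrableOn_Ioo_of_le hst]
    exact hD.mono_set (Ioo_subset_Ioo_left hs.le)
  have hkey : ∀ s, 0 < s → s ≤ t → J t + ∫ τ in s..t, (I τ + D τ) ≤ J s + ∫ τ in Ioo 0 t, D τ := by
    intro s hs hst
    obtain ⟨i1, i2⟩ := hF.test hp h hζ hζ0 hζ1 hζ2 hs hst ht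
    rw [intervalIntegral.integral_add i1 (hDt s hs hst)]
    have : ∫ τ in s..t, D τ ≤ ∫ τ in Ioo 0 t, D τ := by
      rw [intervalIntegral.integral_of_le hst, integral_Ioc_eq_integral_Ioo]
      exact setIntegral_mono_set hD (Eventually.of_forall hD0)
        (Ioo_subset_Ioo_left hs.le).eventuallyLE
    linarith
  -- The derivative `v'` need not be integrable up to time `0`. The estimate is started at `r > 0`,
  -- the integral over `(r, s)` is dropped because the integrand is nonnegative after adding `D`,
  -- and `r → 0` uses only continuity of `J`.
  have hkey2 : ∀ s, 0 < s → s ≤ t → J t + ∫ τ in s..t, (I τ + D τ) ≤ J 0 + ∫ τ in Ioo 0 t, D τ := by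
    intro s hs hst
    have hc : Tendsto J (𝓝[Icc 0 T] 0) (𝓝 (J 0)) :=
      hF.continuousOn_integral_mul_j h hζ.continuous hζ0 hζ1 0 ⟨le_rfl, ht0.le.trans ht⟩
    have hc' : Tendsto J (𝓝[Ioo 0 s] 0) (𝓝 (J 0)) :=
      hc.mono_left (nhdsWithin_mono _ (Ioo_subset_Icc_self.trans (Icc_subset_Icc_right
        (hst.trans ht))))
    have : (𝓝[Ioo 0 s] (0 : ℝ)).NeBot := by
      rw [nhdsWithin_Ioo_eq_nhdsGT hs]; infer_instance
    refine ge_of_tendsto (hc'.add_const _) (eventually_nhdsWithin_of_forall fun r hr => ?_)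
    refine le_trans ?_ (hkey r hr.1 (hr.2.le.trans hst))
    have i1 := (hF.test hp h hζ hζ0 hζ1 hζ2 hr.1 hr.2.le (hst.trans ht)).1
    have i2 := (hF.test hp h hζ hζ0 hζ1 hζ2 hs hst ht).1
    have i3 : IntervalIntegrable D volume r s := by
      rw [intervalIntegrable_iff_integrableOn_Ioo_of_le hr.2.le]
      exact hD.mono_set (Ioo_subset_Ioo hr.1.le hst)
    have e := intervalIntegral.integral_add_adjacent_intervals (i1.add i3) (i2.add (hDt s hs hst))
    have hpos : 0 ≤ ∫ τ in r..s, (I τ + D τ) := by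
      rw [intervalIntegral.integral_of_le hr.2.le, integral_Ioc_eq_integral_Ioo]
      refine integral_nonneg_of_ae (ae_mono ?_ hI)
      exact Measure.restrict_mono_set _ (Ioo_subset_Ioo hr.1.le (hst.trans ht))
    linarith
  -- Monotone convergence over intervals exhausting `(0, t)` then also gives integrability near time
  -- `0`.
  have hcover : Ioo 0 t = ⋃ n : ℕ, Ioo (t * (1 / ((n : ℝ) + 1))) t := by
    ext τ
    simp only [mem_Ioo, mem_iUnion]
    constructor
    · rintro ⟨h1, h2⟩
      have hl : Tendsto (fun n : ℕ => t * (1 / ((n : ℝ) + 1))) atTop (𝓝 (t * 0)) :=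
        tendsto_one_div_add_atTop_nhds_zero_nat.const_mul t
      rw [mul_zero] at hl
      obtain ⟨n, hn⟩ := (hl.eventually (gt_mem_nhds h1)).exists
      exact ⟨n, hn, h2⟩
    · rintro ⟨n, h1, h2⟩
      exact ⟨lt_of_le_of_lt (by positivity) h1, h2⟩
  have hdir : Directed (· ⊆ ·) fun n : ℕ => Ioo (t * (1 / ((n : ℝ) + 1))) t := by
    refine Monotone.directed_le fun n m hnm => ?_
    refine Ioo_subset_Ioo_left ?_
    gcongr
  rw [hcover, setLIntegral_iUnion_of_directed _ hdir, ← hcover, ENNReal.add_iSup]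
  refine iSup_le fun n => ?_
  set s := t * (1 / ((n : ℝ) + 1)) with hs
  have hs0 : 0 < s := by positivity
  have hst : s ≤ t := by
    refine mul_le_of_le_one_right ht0.le ?_
    rw [div_le_one (by positivity)]
    linarith [(n.cast_nonneg : (0 : ℝ) ≤ n)]
  have i2 := (hF.test hp h hζ hζ0 hζ1 hζ2 hs0 hst ht).1.add (hDt s hs0 hst)
  have hnn : 0 ≤ᵐ[volume.restrict (Ioo s t)] fun τ => I τ + D τ :=
    ae_mono (Measure.restrict_mono_set _ (Ioo_subset_Ioo hs0.le ht)) hI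
  have := hkey2 s hs0 hst
  rw [intervalIntegral.integral_of_le hst, integral_Ioc_eq_integral_Ioo] at this
  rw [intervalIntegrable_iff_integrableOn_Ioo_of_le hst] at i2
  rw [← ofReal_integral_eq_lintegral_ofReal i2 hnn,
    ← ENNReal.ofReal_add (hJ0 t) (integral_nonneg_of_ae hnn)]
  exact ENNReal.ofReal_le_ofReal this

end Test

/-! ### The `p`-Laplace flow and its translates -/

/-- The flux `|g|^{p-2} g`. -/
noncomputable def flux (p : ℝ) (g : Euc d) : Euc d := ‖g‖ ^ (p - 2) • g

lemma continuous_flux {p : ℝ} (hp : 2 ≤ p) : Continuous (flux p : Euc d → Euc d) :=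
  (continuous_norm.rpow_const fun _ => Or.inr (by linarith)).smul continuous_id

lemma norm_flux {p : ℝ} (hp : 2 ≤ p) (g : Euc d) : ‖flux p g‖ = ‖g‖ ^ (p - 1) := by
  rw [flux, norm_smul, Real.norm_eq_abs, abs_of_nonneg (by positivity)]
  nth_rewrite 2 [← Real.rpow_one ‖g‖]
  rw [← Real.rpow_add_of_nonneg (norm_nonneg _) (by linarith) zero_le_one]
  congr 1; ring

lemma inner_flux_self {p : ℝ} (hp : 2 ≤ p) (g : Euc d) : inner ℝ (flux p g) g = ‖g‖ ^ p := by
  rw [flux, real_inner_smul_left, real_inner_self_eq_norm_sq, ← Real.rpow_natCast,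
    ← Real.rpow_add_of_nonneg (norm_nonneg _) (by linarith) (by norm_num)]
  congr 1; push_cast; ring

lemma memLp_flux {p : ℝ} (hp : 2 ≤ p) {G : Euc d → Euc d}
    (hG : MemLp G (ENNReal.ofReal p) volume) :
    MemLp (fun x => flux p (G x)) (ENNReal.ofReal (p / (p - 1))) volume := by
  refine ⟨(continuous_flux hp).comp_aestronglyMeasurable hG.1, ?_⟩
  have hp1 : 0 < p - 1 := by linarith
  have hq : 0 < p / (p - 1) := div_pos (by linarith) hp1
  have h1 : ∫⁻ x, ‖flux p (G x)‖ₑ ^ (p / (p - 1)) = ∫⁻ x, ‖G x‖ₑ ^ p := by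
    refine lintegral_congr fun x => ?_
    rw [← ofReal_norm, norm_flux hp, ← ENNReal.ofReal_rpow_of_nonneg (norm_nonneg _) hp1.le,
      ofReal_norm, ← ENNReal.rpow_mul]
    congr 1
    field_simp
  have h2 : ∫⁻ x, ‖G x‖ₑ ^ p < ⊤ := by
    rw [← eLpNorm_ofReal_rpow (by linarith : (0 : ℝ) < p)]
    exact ENNReal.rpow_lt_top_of_nonneg (by linarith) hG.2.ne
  rw [← h1, ← eLpNorm_ofReal_rpow hq] at h2
  by_contra h5
  rw [top_le_iff.1 (not_lt.1 h5), ENNReal.top_rpow_of_pos hq] at h2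
  exact lt_irrefl _ h2

/-- The mean value theorem gives `s^{p/2} - r^{p/2} ≤ (p/2) s^{p/2-1} (s - r)`. After squaring,
`4/p²` cancels the constant and leaves `s^{p-2} (s - r)²`, and `s^{p-2} (s - r) ≤ s^{p-1} -
r^{p-1}`. -/
lemma rpow_half_sub_sq_le {p : ℝ} (hp : 2 ≤ p) {s r : ℝ} (hr : 0 ≤ r) (hrs : r ≤ s) :
    4 / p ^ 2 * (s ^ (p / 2) - r ^ (p / 2)) ^ 2 ≤ (s ^ (p - 1) - r ^ (p - 1)) * (s - r) := by
  have hs : 0 ≤ s := hr.trans hrs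
  have h1 : s ^ (p / 2) - r ^ (p / 2) ≤ p / 2 * s ^ (p / 2 - 1) * (s - r) := by
    rcases hrs.eq_or_lt with rfl | hlt
    · simp
    obtain ⟨c, hc, hc'⟩ := exists_hasDerivAt_eq_slope (fun x : ℝ => x ^ (p / 2))
      (fun x => p / 2 * x ^ (p / 2 - 1)) hlt
      (Continuous.continuousOn (Real.continuous_rpow_const (by linarith)))
      (fun x _ => Real.hasDerivAt_rpow_const (Or.inr (by linarith)))
    rw [eq_div_iff (by linarith)] at hc'
    rw [← hc']
    have hc0 : 0 ≤ c := hr.trans hc.1.le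
    have h2 : c ^ (p / 2 - 1) ≤ s ^ (p / 2 - 1) :=
      Real.rpow_le_rpow hc0 hc.2.le (by linarith)
    have h3 : 0 ≤ s - r := by linarith
    gcongr
  have h0 : 0 ≤ s ^ (p / 2) - r ^ (p / 2) :=
    sub_nonneg.2 (Real.rpow_le_rpow hr hrs (by linarith))
  have h2 : s ^ (p - 2) * (s - r) ≤ s ^ (p - 1) - r ^ (p - 1) := by
    have e : ∀ x : ℝ, 0 ≤ x → x ^ (p - 1) = x ^ (p - 2) * x := fun x hx => by
      nth_rewrite 3 [← Real.rpow_one x]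
      rw [← Real.rpow_add_of_nonneg hx (by linarith) zero_le_one]
      congr 1; ring
    rw [e s hs, e r hr]
    have h3 := mul_le_mul_of_nonneg_right (Real.rpow_le_rpow hr hrs (by linarith : 0 ≤ p - 2)) hr
    linarith
  have h3 : (s ^ (p / 2 - 1)) ^ 2 = s ^ (p - 2) := by
    rw [← Real.rpow_natCast, ← Real.rpow_mul hs]
    congr 1; push_cast; ring
  calc 4 / p ^ 2 * (s ^ (p / 2) - r ^ (p / 2)) ^ 2
      ≤ 4 / p ^ 2 * (p / 2 * s ^ (p / 2 - 1) * (s - r)) ^ 2 := by gcongr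
    _ = s ^ (p - 2) * (s - r) * (s - r) := by
        rw [mul_pow, mul_pow, h3]; field_simp; ring
    _ ≤ _ := mul_le_mul_of_nonneg_right h2 (by linarith)

/-- Monotonicity of the flux. -/
lemma le_inner_flux_sub {p : ℝ} (hp : 2 ≤ p) (a b : Euc d) :
    4 / p ^ 2 * (‖a‖ ^ (p / 2) - ‖b‖ ^ (p / 2)) ^ 2
      ≤ inner ℝ (flux p a - flux p b) (a - b) := by
  have e : ∀ g : Euc d, ‖g‖ ^ (p - 1) = ‖g‖ ^ (p - 2) * ‖g‖ := fun g => by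
    rw [← norm_flux hp, flux, norm_smul, Real.norm_eq_abs, abs_of_nonneg (by positivity)]
  -- Reduction to moduli: `⟪a, b⟫` enters the right-hand side with a nonpositive coefficient, so
  -- replacing it by `‖a‖ ‖b‖` only lowers that side.
  have h1 : (‖a‖ ^ (p - 1) - ‖b‖ ^ (p - 1)) * (‖a‖ - ‖b‖)
      ≤ inner ℝ (flux p a - flux p b) (a - b) := by
    have hab := real_inner_le_norm a b
    have ha : 0 ≤ ‖a‖ ^ (p - 2) := by positivity
    have hb : 0 ≤ ‖b‖ ^ (p - 2) := by positivity
    rw [inner_sub_left, inner_sub_right, inner_sub_right, flux, flux, real_inner_smul_left,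
      real_inner_smul_left, real_inner_smul_left, real_inner_smul_left, real_inner_self_eq_norm_sq,
      real_inner_self_eq_norm_sq, real_inner_comm a b, e a, e b]
    nlinarith [mul_le_mul_of_nonneg_left hab ha, mul_le_mul_of_nonneg_left hab hb]
  refine le_trans ?_ h1
  rcases le_total ‖b‖ ‖a‖ with h | h
  · exact rpow_half_sub_sq_le hp (norm_nonneg _) h
  · have := rpow_half_sub_sq_le hp (norm_nonneg a) h
    calc _ = 4 / p ^ 2 * (‖b‖ ^ (p / 2) - ‖a‖ ^ (p / 2)) ^ 2 := by ring
      _ ≤ _ := this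
      _ = _ := by ring

lemma inner_flux_sub_nonneg {p : ℝ} (hp : 2 ≤ p) (a b : Euc d) :
    0 ≤ inner ℝ (flux p a - flux p b) (a - b) :=
  le_trans (by positivity) (le_inner_flux_sub hp a b)

/-- A weak solution is a flow, with the canonical version of its spatial gradient. -/
lemma IsWeakSolution_isFlow {p T : ℝ} (hp : 2 ≤ p)
    {u₀ : Lp ℝ 2 (volume : Measure (Euc d))} {u : ℝ → Lp ℝ 2 (volume : Measure (Euc d))}
    (h : IsWeakSolution p T u₀ u) :
    ∃ u' : ℝ → Lp ℝ 2 (volume : Measure (Euc d)),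
      IsFlow p T u u' (fun t => wgrad (u t)) (fun t x => flux p (wgrad (u t) x)) := by
  obtain ⟨h1, -, u', h3, h4, h5⟩ := h
  have key : ∀ᵐ t ∂(volume.restrict (Ioo 0 T)), HasWeakGradient (u t) (wgrad (u t)) ∧
      MemLp (wgrad (u t)) (ENNReal.ofReal p) volume ∧
      HasWeakDivergence (fun x => flux p (wgrad (u t) x)) (u' t) := by
    filter_upwards [h5] with t ⟨G, g1, g2, g3⟩
    have e := wgrad_ae_eq g1
    refine ⟨hasWeakGradient_wgrad g1, g2.ae_eq e.symm, ?_⟩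
    refine HasWeakDivergence_congr g3 ?_ EventuallyEq.rfl
    filter_upwards [e] with x hx
    rw [hx, flux]
  refine ⟨u', h1, fun s t hs hst ht => ?_, h4, ?_, ?_, ?_, ?_⟩
  · rcases hst.eq_or_lt with rfl | hst'
    · exact IntervalIntegrable.refl
    have hm := h3 (s / 2) ⟨by linarith, by linarith⟩
    have hi : IntegrableOn u' (Ioo (s / 2) T) := hm.integrable (by norm_num)
    rw [intervalIntegrable_iff_integrableOn_Ioo_of_le hst]
    exact hi.mono_set (Ioo_subset_Ioo (by linarith) ht)
  · filter_upwards [key] with t ht using ht.1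
  · filter_upwards [key] with t ht using ht.2.1
  · filter_upwards [key] with t ht using memLp_flux hp ht.2.1
  · filter_upwards [key] with t ht using ht.2.2

/-- Translation by `h` on `L²`. -/
noncomputable def translateLp (h : Euc d) :
    Lp ℝ 2 (volume : Measure (Euc d)) →ₗᵢ[ℝ] Lp ℝ 2 (volume : Measure (Euc d)) :=
  Lp.compMeasurePreservingₗᵢ ℝ (fun x => x + h) (measurePreserving_add_right volume h)

lemma coeFn_translateLp (h : Euc d) (f : Lp ℝ 2 (volume : Measure (Euc d))) :
    translateLp h f =ᵐ[volume] fun x => f (x + h) :=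
  Lp.coeFn_compMeasurePreserving f (measurePreserving_add_right volume h)

lemma coeFn_translateLp_sub (h : Euc d) (f : Lp ℝ 2 (volume : Measure (Euc d))) :
    (translateLp h f - f : Lp ℝ 2 (volume : Measure (Euc d)))
      =ᵐ[volume] fun x => f (x + h) - f x := by
  filter_upwards [Lp.coeFn_sub (translateLp h f) f, coeFn_translateLp h f] with x h1 h2
  rw [h1, Pi.sub_apply, h2]

lemma memLp_comp_add {F : Type*} [NormedAddCommGroup F] {f : Euc d → F} {q : ℝ≥0∞}
    (hf : MemLp f q volume) (h : Euc d) : MemLp (fun x => f (x + h)) q volume :=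
  hf.comp_measurePreserving (measurePreserving_add_right volume h)

/-- The equation is nonlinear, but a difference of two translates is still a flow, with the
difference of the fluxes as its flux. This is why `IsFlow` does not tie `B` to `G`. -/
lemma IsFlow_translate_sub {p T : ℝ} {u u' : ℝ → Lp ℝ 2 (volume : Measure (Euc d))}
    {G B : ℝ → Euc d → Euc d} (hF : IsFlow p T u u' G B) (h : Euc d) :
    IsFlow p T (fun t => translateLp h (u t) - u t) (fun t => translateLp h (u' t) - u' t)
      (fun t x => G t (x + h) - G t x) (fun t x => B t (x + h) - B t x) := by
  have hi : ∀ s t, 0 < s → s ≤ t → t ≤ T →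
      IntervalIntegrable (fun τ => translateLp h (u' τ)) volume s t := fun s t hs hst ht => by
    have h1 := hF.int s t hs hst ht
    rw [intervalIntegrable_iff] at h1 ⊢
    exact (translateLp h).toContinuousLinearMap.integrable_comp h1
  refine ⟨?_, ?_, ?_, ?_, ?_, ?_, ?_⟩
  · exact ((translateLp h).continuous.comp_continuousOn hF.cont).sub hF.cont
  · exact fun s t hs hst ht => (hi s t hs hst ht).sub (hF.int s t hs hst ht)
  · intro s t hs hst ht
    rw [intervalIntegral.integral_sub (hi s t hs hst ht) (hF.int s t hs hst ht)]
    have e : ∫ τ in s..t, translateLp h (u' τ) = translateLp h (∫ τ in s..t, u' τ) :=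
      (translateLp h).toContinuousLinearMap.intervalIntegral_comp_comm (hF.int s t hs hst ht)
    rw [e, ← hF.ftc s t hs hst ht, map_sub]
    abel
  · filter_upwards [hF.grad] with t ht
    exact HasWeakGradient_congr (HasWeakGradient_sub (HasWeakGradient_translate ht h) ht)
      (coeFn_translateLp_sub h (u t)).symm EventuallyEq.rfl
  · filter_upwards [hF.memG] with t ht
    exact (memLp_comp_add ht h).sub ht
  · filter_upwards [hF.memB] with t ht
    exact (memLp_comp_add ht h).sub ht
  · filter_upwards [hF.div] with t ht
    exact HasWeakDivergence_congr (HasWeakDivergence_sub (HasWeakDivergence_translate ht h) ht)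
      EventuallyEq.rfl (coeFn_translateLp_sub h (u' t)).symm

end PLaplace

namespace PLaplace

open Filter Topology Metric ContinuousLinearMap
open scoped ENNReal NNReal Convolution Gradient

variable {d : ℕ}

/-! ### A priori estimates -/

lemma convexTriple_sq : ConvexTriple (fun s => s ^ 2 / 2) (fun s => s) (fun _ => 1) 1 where
  hj s := by simpa using ((hasDerivAt_id s).pow 2).div_const 2
  hβ s := hasDerivAt_id s
  hγ := continuous_const
  nonneg _ := zero_le_one
  le _ := le_rfl
  j0 := by simp
  β0 := rfl

/-- A smooth approximation of `|s|` for the `L¹` estimate. The bound `1/ε` on the second derivative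
does not enter that estimate, so `ε → 0` is harmless. -/
lemma convexTriple_sqrt {ε : ℝ} (hε : 0 < ε) :
    ConvexTriple (fun s => √(ε ^ 2 + s ^ 2) - ε) (fun s => s / √(ε ^ 2 + s ^ 2))
      (fun s => ε ^ 2 / √(ε ^ 2 + s ^ 2) ^ 3) (1 / ε) := by
  have hpos : ∀ s : ℝ, 0 < ε ^ 2 + s ^ 2 := fun s => by positivity
  have hr : ∀ s : ℝ, 0 < √(ε ^ 2 + s ^ 2) := fun s => Real.sqrt_pos.2 (hpos s)
  have hd : ∀ s, HasDerivAt (fun s => √(ε ^ 2 + s ^ 2)) (s / √(ε ^ 2 + s ^ 2)) s := fun s => by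
    have h1 : HasDerivAt (fun s : ℝ => ε ^ 2 + s ^ 2) (2 * s) s := by
      simpa using ((hasDerivAt_id s).pow 2).const_add (ε ^ 2)
    have h2 := h1.sqrt (hpos s).ne'
    convert h2 using 1
    field_simp
  refine ⟨fun s => (hd s).sub_const ε, fun s => ?_, ?_, fun s => by positivity, fun s => ?_, ?_,
    by simp⟩
  · have h1 := (hasDerivAt_id s).div (hd s) (hr s).ne'
    have h2 := Real.sq_sqrt (hpos s).le
    have h3 := (hr s).ne'
    have e : (1 * √(ε ^ 2 + s ^ 2) - id s * (s / √(ε ^ 2 + s ^ 2))) / √(ε ^ 2 + s ^ 2) ^ 2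
        = ε ^ 2 / √(ε ^ 2 + s ^ 2) ^ 3 := by
      rw [id]
      field_simp
      rw [h2]; ring
    rw [e] at h1
    exact h1
  · refine continuous_const.div (by fun_prop) fun s => ?_
    have := hr s
    positivity
  · have h1 : ε ≤ √(ε ^ 2 + s ^ 2) := Real.le_sqrt_of_sq_le (by nlinarith [sq_nonneg s])
    rw [div_le_div_iff₀ (by have := hr s; positivity) hε]
    calc ε ^ 2 * ε = ε ^ 3 := by ring
      _ ≤ √(ε ^ 2 + s ^ 2) ^ 3 := by gcongr
      _ = _ := by ring
  · simp [Real.sqrt_sq hε.le]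

lemma convexTriple_integral {γ : ℝ → ℝ} (hγ : Continuous γ) (h0 : ∀ s, 0 ≤ γ s) {K : ℝ}
    (hK : ∀ s, γ s ≤ K) :
    ConvexTriple (fun s => ∫ r in (0 : ℝ)..s, ∫ q in (0 : ℝ)..r, γ q)
      (fun s => ∫ q in (0 : ℝ)..s, γ q) γ K := by
  have hb : ∀ s, HasDerivAt (fun s => ∫ q in (0 : ℝ)..s, γ q) (γ s) s := fun s =>
    (hγ.integral_hasStrictDerivAt 0 s).hasDerivAt
  have hc : Continuous fun s => ∫ q in (0 : ℝ)..s, γ q :=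
    continuous_iff_continuousAt.2 fun s => (hb s).continuousAt
  exact ⟨fun s => (hc.integral_hasStrictDerivAt 0 s).hasDerivAt, hb, hγ, h0, hK, by simp, by simp⟩

/-- A convex function vanishing exactly on `(-∞, k]`. -/
lemma exists_convexTriple_threshold {k : ℝ} (hk : 0 ≤ k) :
    ∃ j β γ : ℝ → ℝ, ConvexTriple j β γ 1 ∧ (∀ s ≤ k, j s = 0) ∧ ∀ s, k < s → 0 < j s := by
  -- The second derivative is a continuous ramp starting at `k` and capped at `1`; integrating twice
  -- from `0` keeps the zero set because `k ≥ 0`.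
  set γ : ℝ → ℝ := fun s => min (max (s - k) 0) 1 with hγd
  have hγ : Continuous γ := by fun_prop
  have h0 : ∀ s, 0 ≤ γ s := fun s => le_min (le_max_right _ _) zero_le_one
  have hz : ∀ s ≤ k, γ s = 0 := fun s hs => by
    simp only [hγd]
    rw [max_eq_right (by linarith), min_eq_left zero_le_one]
  have hpos : ∀ s, k < s → 0 < γ s := fun s hs =>
    lt_min (lt_max_of_lt_left (by linarith)) one_pos
  have hT := convexTriple_integral hγ h0 (K := 1) (fun s => min_le_right _ _)
  set β : ℝ → ℝ := fun s => ∫ q in (0 : ℝ)..s, γ q with hβd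
  have hβz : ∀ s ≤ k, β s = 0 := fun s hs => by
    refine intervalIntegral.integral_zero_ae (Eventually.of_forall fun q hq => hz q ?_)
    have := hq.2
    exact this.trans (max_le hk hs)
  have hβpos : ∀ s, k < s → 0 < β s := fun s hs => by
    have e := intervalIntegral.integral_add_adjacent_intervals (μ := volume)
      (hγ.intervalIntegrable 0 k) (hγ.intervalIntegrable k s)
    have h1 : 0 < ∫ q in k..s, γ q :=
      intervalIntegral.intervalIntegral_pos_of_pos_on (hγ.intervalIntegrable k s)
        (fun q hq => hpos q hq.1) hs
    have h2 := hβz k le_rfl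
    simp only [hβd] at h2 ⊢
    rw [← e, h2, zero_add]
    exact h1
  have hjz : ∀ s ≤ k, (∫ r in (0 : ℝ)..s, β r) = 0 := fun s hs => by
    refine intervalIntegral.integral_zero_ae (Eventually.of_forall fun q hq => hβz q ?_)
    exact hq.2.trans (max_le hk hs)
  refine ⟨_, β, γ, hT, hjz, fun s hs => ?_⟩
  have e := intervalIntegral.integral_add_adjacent_intervals (μ := volume)
    (hT.continuous_β.intervalIntegrable 0 k) (hT.continuous_β.intervalIntegrable k s)
  have h1 : 0 < ∫ q in k..s, β q :=
    intervalIntegral.intervalIntegral_pos_of_pos_on (hT.continuous_β.intervalIntegrable k s)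
      (fun q hq => hβpos q hq.1) hs
  have h2 := hjz k le_rfl
  rw [← e, h2, zero_add]
  exact h1

/-! ### Energy, mass, Lipschitz and difference estimates -/

section Estimates

variable {p T : ℝ} {v v' u u' : ℝ → Lp ℝ 2 (volume : Measure (Euc d))} {G B : ℝ → Euc d → Euc d}
  {j β γ : ℝ → ℝ} {K : ℝ}

/-- The weight `1` has no gradient, so only `γ(v) B · G` remains. It is nonnegative, and no
correction `D` is needed. -/
lemma IsFlow.test_lintegral_one (hp : 2 ≤ p) (hF : IsFlow p T v v' G B) (h : ConvexTriple j β γ K)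
    {t : ℝ} (ht0 : 0 < t) (ht : t ≤ T)
    (hI : ∀ᵐ τ ∂(volume.restrict (Ioo 0 T)), ∀ x, 0 ≤ inner ℝ (B τ x) (G τ x)) :
    ENNReal.ofReal (∫ x, j (v t x))
        + ∫⁻ τ in Ioo 0 t, ENNReal.ofReal (∫ x, γ (v τ x) * inner ℝ (B τ x) (G τ x))
      ≤ ENNReal.ofReal (∫ x, j (v 0 x)) := by
  have hg : ∀ x : Euc d, ∇ (fun _ : Euc d => (1 : ℝ)) x = 0 := fun x => by
    simp [gradient]
  have e : ∀ τ, testIntegrand v G B β γ (fun _ => 1) τ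
      = ∫ x, γ (v τ x) * inner ℝ (B τ x) (G τ x) := fun τ => by
    simp only [testIntegrand, hg, one_smul, smul_zero, add_zero, real_inner_smul_right]
  have := hF.test_lintegral hp h (ζ := fun _ => 1) (Z := 1) (C := 0) contDiff_const
    (fun _ => zero_le_one) (fun _ => le_rfl) (fun x => by rw [hg, norm_zero]) ht0 ht
    (D := fun _ => 0) integrableOn_zero (fun _ => le_rfl) (by
      filter_upwards [hI] with τ hτ
      rw [e, add_zero]
      exact integral_nonneg fun x => mul_nonneg (h.nonneg _) (hτ x))
  simpa only [e, one_mul, add_zero, integral_zero] using this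

lemma IsFlow.integral_le (hp : 2 ≤ p) (hF : IsFlow p T v v' G B) (h : ConvexTriple j β γ K)
    {t : ℝ} (ht : t ∈ Icc 0 T)
    (hI : ∀ᵐ τ ∂(volume.restrict (Ioo 0 T)), ∀ x, 0 ≤ inner ℝ (B τ x) (G τ x)) :
    ∫ x, j (v t x) ≤ ∫ x, j (v 0 x) := by
  rcases ht.1.eq_or_lt with rfl | ht0
  · exact le_rfl
  have := le_self_add.trans (hF.test_lintegral_one hp h ht0 ht.2 hI)
  rwa [ENNReal.ofReal_le_ofReal_iff (integral_nonneg fun x => h.j_nonneg _)] at this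

lemma ae_inner_flux_nonneg (hp : 2 ≤ p) :
    ∀ᵐ τ ∂(volume.restrict (Ioo 0 T)), ∀ x, 0 ≤ inner ℝ (flux p (G τ x)) (G τ x) :=
  Eventually.of_forall fun τ x => by rw [inner_flux_self hp]; positivity

lemma norm_sq_eq_integral (f : Lp ℝ 2 (volume : Measure (Euc d))) : ‖f‖ ^ 2 = ∫ x, f x ^ 2 := by
  rw [← real_inner_self_eq_norm_sq, L2.inner_def]
  congr 1; ext x
  simp [sq]

lemma ofReal_integral_norm_rpow {H : Type*} [NormedAddCommGroup H] {f : Euc d → H} {q : ℝ}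
    (hq : 0 < q) (hf : MemLp f (ENNReal.ofReal q) volume) :
    ENNReal.ofReal (∫ x, ‖f x‖ ^ q) = ∫⁻ x, ‖f x‖ₑ ^ q := by
  have hi : Integrable (fun x => ‖f x‖ ^ q) volume := by
    have := hf.integrable_norm_rpow (by simpa using hq) ENNReal.ofReal_ne_top
    rwa [ENNReal.toReal_ofReal hq.le] at this
  rw [ofReal_integral_eq_lintegral_ofReal hi (Eventually.of_forall fun x => by positivity)]
  refine lintegral_congr fun x => ?_
  rw [← ENNReal.ofReal_rpow_of_nonneg (norm_nonneg _) hq.le, ofReal_norm]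

/-- The energy inequality. -/
lemma IsFlow.energy (hp : 2 ≤ p) (hF : IsFlow p T u u' G fun t x => flux p (G t x)) (hT : 0 < T) :
    ∫⁻ t in Ioo 0 T, ∫⁻ x, ‖G t x‖ₑ ^ p ≤ ENNReal.ofReal (‖u 0‖ ^ 2 / 2) := by
  have h := le_add_self.trans
    (hF.test_lintegral_one hp convexTriple_sq hT le_rfl (ae_inner_flux_nonneg hp))
  have e : ∫ x, (u 0 x) ^ 2 / 2 = ‖u 0‖ ^ 2 / 2 := by
    rw [integral_div, norm_sq_eq_integral]
  rw [e] at h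
  refine le_trans (le_of_eq (lintegral_congr_ae ?_)) h
  filter_upwards [hF.memG] with t ht
  rw [← ofReal_integral_norm_rpow (by linarith) ht]
  simp only [one_mul, inner_flux_self hp]

lemma IsFlow.norm_le (hp : 2 ≤ p) (hF : IsFlow p T u u' G fun t x => flux p (G t x)) {t : ℝ}
    (ht : t ∈ Icc 0 T) : ‖u t‖ ≤ ‖u 0‖ := by
  have h := hF.integral_le hp convexTriple_sq ht (ae_inner_flux_nonneg hp)
  rw [integral_div, integral_div, ← norm_sq_eq_integral, ← norm_sq_eq_integral] at h
  exact abs_le_of_sq_le_sq' (by linarith) (norm_nonneg _) |>.2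

/-- The `L^1` norm does not increase. -/
lemma IsFlow.lintegral_enorm_le (hp : 2 ≤ p) (hF : IsFlow p T u u' G fun t x => flux p (G t x))
    {t : ℝ} (ht : t ∈ Icc 0 T) : ∫⁻ x, ‖u t x‖ₑ ≤ ∫⁻ x, ‖u 0 x‖ₑ := by
  by_cases hfin : ∫⁻ x, ‖u 0 x‖ₑ = ⊤
  · rw [hfin]; exact le_top
  have hi : Integrable (u 0) volume := ⟨(Lp.memLp (u 0)).1, lt_top_iff_ne_top.2 hfin⟩
  have hball : ∀ n : ℕ, ∫⁻ x in ball (0 : Euc d) n, ‖u t x‖ₑ ≤ ∫⁻ x, ‖u 0 x‖ₑ := by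
    intro n
    -- The regularised modulus differs from `|s|` by at most `ε`, an error integrable only on
    -- bounded sets. So `ε → 0` is taken on a fixed ball before the balls exhaust the space.
    have hε : ∀ ε : ℝ, 0 < ε → ∫⁻ x in ball (0 : Euc d) n, ‖u t x‖ₑ
        ≤ (∫⁻ x, ‖u 0 x‖ₑ) + ENNReal.ofReal ε * volume (ball (0 : Euc d) n) := by
      intro ε hε
      have hc := convexTriple_sqrt hε
      have h1 := hF.integral_le hp hc ht (ae_inner_flux_nonneg hp)
      have h2 : ∀ s : ℝ, √(ε ^ 2 + s ^ 2) - ε ≤ |s| := fun s => by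
        have : √(ε ^ 2 + s ^ 2) ≤ ε + |s| := by
          rw [Real.sqrt_le_left (by positivity)]
          nlinarith [sq_abs s, mul_nonneg hε.le (abs_nonneg s)]
        linarith
      have h3 : ∀ s : ℝ, |s| ≤ (√(ε ^ 2 + s ^ 2) - ε) + ε := fun s => by
        rw [sub_add_cancel]
        refine Real.le_sqrt_of_sq_le ?_
        nlinarith [sq_abs s, sq_nonneg ε]
      have i0 : ∀ t, Integrable (fun x => √(ε ^ 2 + (u t x) ^ 2) - ε) volume := fun t => by
        have := integrable_mul_j hc (ζ := fun _ => 1) (Z := 1) continuous_const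
          (fun _ => zero_le_one) (fun _ => le_rfl) (Lp.memLp (u t))
        simpa using this
      have h4 : ∫ x, (√(ε ^ 2 + (u 0 x) ^ 2) - ε) ≤ ∫ x, ‖u 0 x‖ :=
        integral_mono (i0 0) hi.norm fun x => h2 _
      have h5 : ∫⁻ x, ENNReal.ofReal (√(ε ^ 2 + (u t x) ^ 2) - ε) ≤ ∫⁻ x, ‖u 0 x‖ₑ := by
        rw [← ofReal_integral_eq_lintegral_ofReal (i0 t)
          (Eventually.of_forall fun x => hc.j_nonneg _), ← ofReal_integral_norm_eq_lintegral_enorm hi]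
        exact ENNReal.ofReal_le_ofReal (h1.trans h4)
      calc ∫⁻ x in ball (0 : Euc d) n, ‖u t x‖ₑ
          ≤ ∫⁻ x in ball (0 : Euc d) n, (ENNReal.ofReal (√(ε ^ 2 + (u t x) ^ 2) - ε)
              + ENNReal.ofReal ε) := by
            refine lintegral_mono fun x => ?_
            rw [Real.enorm_eq_ofReal_abs, ← ENNReal.ofReal_add (hc.j_nonneg _) hε.le]
            exact ENNReal.ofReal_le_ofReal (h3 _)
        _ = (∫⁻ x in ball (0 : Euc d) n, ENNReal.ofReal (√(ε ^ 2 + (u t x) ^ 2) - ε))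
              + ENNReal.ofReal ε * volume (ball (0 : Euc d) n) := by
            rw [lintegral_add_right _ measurable_const, setLIntegral_const]
        _ ≤ _ := by
            gcongr ?_ + _
            exact (setLIntegral_le_lintegral _ _).trans h5
    have hl : Tendsto (fun ε : ℝ => (∫⁻ x, ‖u 0 x‖ₑ)
        + ENNReal.ofReal ε * volume (ball (0 : Euc d) n)) (𝓝[>] 0)
        (𝓝 ((∫⁻ x, ‖u 0 x‖ₑ) + 0 * volume (ball (0 : Euc d) n))) := by
      refine Tendsto.const_add _ (ENNReal.Tendsto.mul_const ?_ (Or.inr measure_ball_lt_top.ne))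
      have := (ENNReal.continuous_ofReal.tendsto 0).mono_left
        (nhdsWithin_le_nhds (s := Ioi (0 : ℝ)))
      rwa [ENNReal.ofReal_zero] at this
    rw [zero_mul, add_zero] at hl
    exact ge_of_tendsto hl (eventually_nhdsWithin_of_forall fun ε h => hε ε h)
  have hcover : (univ : Set (Euc d)) = ⋃ n : ℕ, ball 0 n := by
    simp [iUnion_ball_nat]
  rw [← setLIntegral_univ, hcover, setLIntegral_iUnion_of_directed]
  · exact iSup_le hball
  · exact Monotone.directed_le fun n m hnm => ball_subset_ball (by exact_mod_cast hnm)

lemma ae_inner_flux_sub_nonneg (hp : 2 ≤ p) (h : Euc d) :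
    ∀ᵐ τ ∂(volume.restrict (Ioo 0 T)), ∀ x,
      0 ≤ inner ℝ (flux p (G τ (x + h)) - flux p (G τ x)) (G τ (x + h) - G τ x) :=
  Eventually.of_forall fun _ _ => inner_flux_sub_nonneg hp _ _

/-- A maximum principle for the difference of two solutions: with `j` vanishing exactly on `(-∞,
k]`, the nonnegative integral of `j` over the difference starts at `0` and cannot increase. -/
lemma IsFlow.translate_sub_le_aux (hp : 2 ≤ p)
    (hF : IsFlow p T u u' G fun t x => flux p (G t x)) {k : ℝ} (hk : 0 ≤ k) (h : Euc d)
    (h0 : ∀ᵐ x, u 0 (x + h) - u 0 x ≤ k) {t : ℝ} (ht : t ∈ Icc 0 T) :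
    ∀ᵐ x, u t (x + h) - u t x ≤ k := by
  obtain ⟨j, β, γ, hT, hz, hpos⟩ := exists_convexTriple_threshold hk
  have hF' := IsFlow_translate_sub hF h
  have h1 := hF'.integral_le hp hT ht (ae_inner_flux_sub_nonneg hp h)
  have h2 : ∫ x, j ((translateLp h (u 0) - u 0 : Lp ℝ 2 (volume : Measure (Euc d))) x) = 0 := by
    refine integral_eq_zero_of_ae ?_
    filter_upwards [h0, coeFn_translateLp_sub h (u 0)] with x hx hx'
    rw [hx']
    exact hz _ hx
  rw [h2] at h1
  have hi := integrable_mul_j hT (ζ := fun _ => 1) (Z := 1) continuous_const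
    (fun _ => zero_le_one) (fun _ => le_rfl) (Lp.memLp (translateLp h (u t) - u t))
  simp only [one_mul] at hi
  have h3 := le_antisymm h1 (integral_nonneg fun x => hT.j_nonneg _)
  rw [integral_eq_zero_iff_of_nonneg (fun x => hT.j_nonneg _) hi] at h3
  filter_upwards [h3, coeFn_translateLp_sub h (u t)] with x hx hx'
  rw [← hx']
  by_contra hlt
  have := hpos _ (not_le.1 hlt)
  simp only [Pi.zero_apply] at hx
  linarith

/-- Spatial Lipschitz bounds are preserved by the flow. -/
lemma IsFlow.translate_sub_le (hp : 2 ≤ p)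
    (hF : IsFlow p T u u' G fun t x => flux p (G t x)) {L : ℝ} (hL : 0 ≤ L)
    (h0 : ∀ h, ∀ᵐ x, |u 0 (x + h) - u 0 x| ≤ L * ‖h‖) {t : ℝ} (ht : t ∈ Icc 0 T) (h : Euc d) :
    ∀ᵐ x, |u t (x + h) - u t x| ≤ L * ‖h‖ := by
  have h1 := hF.translate_sub_le_aux hp (mul_nonneg hL (norm_nonneg h)) h
    ((h0 h).mono fun x hx => (le_abs_self _).trans hx) ht
  have h2 := hF.translate_sub_le_aux hp (mul_nonneg hL (norm_nonneg (-h))) (-h)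
    ((h0 (-h)).mono fun x hx => (le_abs_self _).trans hx) ht
  -- The lower bound for the shift `h` is the upper bound for the shift `-h`, read at `x + h`.
  have h3 := (measurePreserving_add_right (volume : Measure (Euc d)) h).quasiMeasurePreserving.ae h2
  filter_upwards [h1, h3] with x hx hx'
  rw [add_neg_cancel_right, norm_neg] at hx'
  exact abs_le.2 ⟨by linarith, hx⟩

lemma IsFlow.gradient_le (hp : 2 ≤ p)
    (hF : IsFlow p T u u' G fun t x => flux p (G t x)) {L : ℝ} (hL : 0 ≤ L)
    (h0 : ∀ h, ∀ᵐ x, |u 0 (x + h) - u 0 x| ≤ L * ‖h‖) :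
    ∀ᵐ t ∂(volume.restrict (Ioo 0 T)), ∀ᵐ x, ‖G t x‖ ≤ L := by
  filter_upwards [hF.grad, ae_restrict_mem measurableSet_Ioo] with t ht htm
  exact gradient_le_of_translate_sub_le ht hL
    fun h => hF.translate_sub_le hp hL h0 (Ioo_subset_Icc_self htm) h

/-- Differences of the nonlinear gradient are controlled by differences of the initial value. -/
lemma IsFlow.lintegral_rpow_half_sub_le (hp : 2 ≤ p)
    (hF : IsFlow p T u u' G fun t x => flux p (G t x)) (hT : 0 < T) (h : Euc d) :
    ∫⁻ t in Ioo 0 T, ∫⁻ x, ‖‖G t (x + h)‖ ^ (p / 2) - ‖G t x‖ ^ (p / 2)‖ₑ ^ (2 : ℝ)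
      ≤ ENNReal.ofReal (p ^ 2 / 8) * ∫⁻ x, ‖u 0 (x + h) - u 0 x‖ₑ ^ (2 : ℝ) := by
  have hF' := IsFlow_translate_sub hF h
  have h1 := le_add_self.trans
    (hF'.test_lintegral_one hp convexTriple_sq hT le_rfl (ae_inner_flux_sub_nonneg hp h))
  have e : ENNReal.ofReal (∫ x, ((translateLp h (u 0) - u 0 :
      Lp ℝ 2 (volume : Measure (Euc d))) x) ^ 2 / 2)
      = ENNReal.ofReal (1 / 2) * ∫⁻ x, ‖u 0 (x + h) - u 0 x‖ₑ ^ (2 : ℝ) := by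
    have hm : MemLp (fun x => u 0 (x + h) - u 0 x) (ENNReal.ofReal 2) volume := by
      have h2 : ENNReal.ofReal 2 = 2 := by simp
      rw [h2]
      exact (memLp_comp_add (Lp.memLp (u 0)) h).sub (Lp.memLp (u 0))
    rw [← ofReal_integral_norm_rpow two_pos hm, ← ENNReal.ofReal_mul (by norm_num),
      ← integral_const_mul]
    congr 1
    refine integral_congr_ae ?_
    filter_upwards [coeFn_translateLp_sub h (u 0)] with x hx
    rw [hx, Real.norm_eq_abs, Real.rpow_two, sq_abs]
    ring
  rw [e] at h1
  have hp2 : 0 < p ^ 2 := by positivity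
  -- The constant `p²/8` is `p²/4` from the monotonicity of the flux times `1/2` from testing with
  -- `s²/2`.
  calc ∫⁻ t in Ioo 0 T, ∫⁻ x, ‖‖G t (x + h)‖ ^ (p / 2) - ‖G t x‖ ^ (p / 2)‖ₑ ^ (2 : ℝ)
      ≤ ∫⁻ t in Ioo 0 T, ENNReal.ofReal (p ^ 2 / 4) * ENNReal.ofReal (∫ x, 1 *
          inner ℝ (flux p (G t (x + h)) - flux p (G t x)) (G t (x + h) - G t x)) := by
        refine lintegral_mono_ae ?_
        filter_upwards [hF'.memG, hF'.memB] with t g1 g2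
        -- Integrability is essential here: otherwise the Bochner integral would take its default
        -- value `0` and the test inequality would say nothing.
        have hi := integrable_inner_of_memLp
          (Real.HolderConjugate.conjExponent (by linarith : 1 < p)) g1 g2
        simp only [one_mul]
        rw [ofReal_integral_eq_lintegral_ofReal hi
          (Eventually.of_forall fun x => inner_flux_sub_nonneg hp _ _),
          ← lintegral_const_mul' _ _ ENNReal.ofReal_ne_top]
        refine lintegral_mono fun x => ?_
        rw [← ENNReal.ofReal_mul (by positivity), Real.enorm_eq_ofReal_abs,
          ENNReal.ofReal_rpow_of_nonneg (abs_nonneg _) (by norm_num), Real.rpow_two, sq_abs]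
        refine ENNReal.ofReal_le_ofReal ?_
        have := mul_le_mul_of_nonneg_left (le_inner_flux_sub hp (G t (x + h)) (G t x))
          (by positivity : 0 ≤ p ^ 2 / 4)
        refine le_trans (le_of_eq ?_) this
        field_simp
    _ ≤ ENNReal.ofReal (p ^ 2 / 4) * (ENNReal.ofReal (1 / 2)
          * ∫⁻ x, ‖u 0 (x + h) - u 0 x‖ₑ ^ (2 : ℝ)) := by
        rw [lintegral_const_mul' _ _ ENNReal.ofReal_ne_top]
        gcongr
    _ = _ := by
        rw [← mul_assoc, ← ENNReal.ofReal_mul (by positivity)]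
        congr 2
        ring

end Estimates

end PLaplace

namespace PLaplace

open Filter Topology Metric ContinuousLinearMap
open scoped ENNReal NNReal Convolution Gradient

variable {d : ℕ}

/-! ### Joint measurability of weak gradients -/

/-- A continuous path in `L²` has a jointly measurable representative. -/
lemma exists_stronglyMeasurable_of_continuousOn {T : ℝ} (hT : 0 ≤ T)
    {u : ℝ → Lp ℝ 2 (volume : Measure (Euc d))} (hu : ContinuousOn u (Icc 0 T)) :
    ∃ U : ℝ → Euc d → ℝ, StronglyMeasurable (Function.uncurry U) ∧
      ∀ t ∈ Icc 0 T, U t =ᵐ[volume] u t := by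
  set w : ℝ → Lp ℝ 2 (volume : Measure (Euc d)) := IccExtend hT ((Icc 0 T).domRestrict u) with hw
  have hwc : Continuous w := (continuousOn_iff_continuous_domRestrict.1 hu).Icc_extend'
  have hwu : ∀ t ∈ Icc 0 T, w t = u t := fun t ht => IccExtend_of_mem _ _ ht
  -- The mollification is the `L²` pairing of `w t` with a translated mollifier, both continuous in
  -- their parameters. The limit of these jointly continuous functions is the representative sought.
  have hmoll : ∀ n, Continuous fun z : ℝ × Euc d => moll n (w z.1) z.2 := by
    intro n
    have hη : MemLp (eta n : Euc d → ℝ) 2 volume :=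
      (eta_continuous n).memLp_of_hasCompactSupport (eta_hasCompactSupport n)
    let g : C(Euc d, C(Euc d, Euc d)) :=
      (ContinuousMap.mk (fun a : Euc d × Euc d => a.1 - a.2) (by fun_prop)).curry
    have hg : ∀ y, MeasurePreserving (g y) (volume : Measure (Euc d)) volume := fun y =>
      Measure.measurePreserving_sub_left volume y
    have hc : Continuous fun y => Lp.compMeasurePreserving (g y) (hg y) (hη.toLp _) :=
      Continuous.compMeasurePreservingLp continuous_const g.continuous hg (by simp)
    have hc2 : Continuous fun z : ℝ × Euc d => inner ℝ
        (Lp.compMeasurePreserving (g z.2) (hg z.2) (hη.toLp _)) (w z.1) :=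
      (hc.comp continuous_snd).inner (hwc.comp continuous_fst)
    refine hc2.congr fun z => ?_
    rw [L2.inner_def, moll_apply']
    refine integral_congr_ae ?_
    have e1 : (Lp.compMeasurePreserving (g z.2) (hg z.2) (hη.toLp _) : Euc d → ℝ)
        =ᵐ[volume] fun y => eta n (z.2 - y) := by
      rw [Lp.toLp_compMeasurePreserving hη (hg z.2)]
      exact MemLp.coeFn_toLp _
    filter_upwards [e1] with y hy
    rw [hy]
    simp [mul_comm]
  refine ⟨fun t x => limUnder atTop fun n => moll n (w t) x, ?_, fun t ht => ?_⟩
  · exact StronglyMeasurable.limUnder fun n => (hmoll n).stronglyMeasurable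
  · rw [← hwu t ht]
    filter_upwards [ae_tendsto_moll ((Lp.memLp (w t)).locallyIntegrable (by norm_num))] with x hx
    exact hx.limUnder_eq

lemma moll_congr {f f' : Euc d → ℝ} (h : f =ᵐ[volume] f') (n : ℕ) : moll n f = moll n f' := by
  ext x
  rw [moll_apply', moll_apply']
  refine integral_congr_ae ?_
  filter_upwards [h] with y hy
  rw [hy]

lemma wgrad_congr {f f' : Euc d → ℝ} (h : f =ᵐ[volume] f') : wgrad f = wgrad f' := by
  ext1 x
  simp only [wgrad, moll_congr h]

/-- The mollified gradient as an integral against the derivative of the mollifier. -/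
lemma gradient_moll_eq {f : Euc d → ℝ} (hf : LocallyIntegrable f volume) (n : ℕ) (x : Euc d) :
    ∇ (moll n f) x = WithLp.toLp 2 fun i => ∫ y, f y *
      fderiv ℝ (eta n) (x - y) (EuclideanSpace.basisFun (Fin d) ℝ i) := by
  ext i
  have h := inner_gradient (a := moll n f) x (EuclideanSpace.basisFun (Fin d) ℝ i)
  rw [fderiv_moll_eq_integral hf] at h
  refine Eq.trans ?_ h
  rw [EuclideanSpace.basisFun_apply, EuclideanSpace.inner_single_right]
  simp

/-- The mollified gradients are parameter integrals, hence jointly measurable in time and space, and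
`wgrad` is their limit. -/
lemma aestronglyMeasurable_wgrad_of_stronglyMeasurable {T : ℝ} {f f' : ℝ → Euc d → ℝ}
    (hf' : StronglyMeasurable (Function.uncurry f'))
    (h : ∀ᵐ t ∂(volume.restrict (Ioo 0 T)), f t =ᵐ[volume] f' t)
    (hl : ∀ᵐ t ∂(volume.restrict (Ioo 0 T)), LocallyIntegrable (f t) volume) :
    AEStronglyMeasurable (fun z : ℝ × Euc d => wgrad (f z.1) z.2) (cylinderMeasure d T) := by
  have hm : ∀ n, StronglyMeasurable fun z : ℝ × Euc d => (WithLp.toLp 2 fun i => ∫ y, f' z.1 y *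
      fderiv ℝ (eta n) (z.2 - y) (EuclideanSpace.basisFun (Fin d) ℝ i) : Euc d) := by
    intro n
    refine (PiLp.continuous_toLp 2 _).comp_stronglyMeasurable (Measurable.stronglyMeasurable ?_)
    refine measurable_pi_iff.2 fun i => StronglyMeasurable.measurable ?_
    refine StronglyMeasurable.integral_prod_right (f := fun (z : ℝ × Euc d) y => f' z.1 y *
      fderiv ℝ (eta n) (z.2 - y) (EuclideanSpace.basisFun (Fin d) ℝ i)) ?_
    refine StronglyMeasurable.mul ?_ ?_
    · exact hf'.comp_measurable (g := fun z : (ℝ × Euc d) × Euc d => (z.1.1, z.2)) (by fun_prop)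
    · refine Continuous.stronglyMeasurable ?_
      exact (continuous_fderiv_apply (eta_contDiff n) _).comp
        (by fun_prop : Continuous fun z : (ℝ × Euc d) × Euc d => z.1.2 - z.2)
  refine ⟨_, StronglyMeasurable.limUnder (l := atTop) hm, ?_⟩
  have hq := (Measure.quasiMeasurePreserving_fst (μ := volume.restrict (Ioo 0 T))
    (ν := (volume : Measure (Euc d)))).ae (h.and hl)
  filter_upwards [hq] with z hz
  rw [wgrad_congr hz.1, wgrad]
  simp only [gradient_moll_eq (hz.2.congr hz.1)]

lemma aestronglyMeasurable_wgrad {T : ℝ} {f : ℝ → Euc d → ℝ}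
    (hf : AEStronglyMeasurable (fun z : ℝ × Euc d => f z.1 z.2) (cylinderMeasure d T))
    (hl : ∀ᵐ t ∂(volume.restrict (Ioo 0 T)), LocallyIntegrable (f t) volume) :
    AEStronglyMeasurable (fun z : ℝ × Euc d => wgrad (f z.1) z.2) (cylinderMeasure d T) := by
  refine aestronglyMeasurable_wgrad_of_stronglyMeasurable (f' := fun t x => hf.mk _ (t, x))
    hf.stronglyMeasurable_mk ?_ hl
  exact Measure.ae_ae_of_ae_prod hf.ae_eq_mk

/-- Functions on the cylinder whose spatial difference quotients are bounded in `L²` have a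
spatial gradient in `L²`. -/
lemma hasWeakGradient_of_lintegral_sub_le {T : ℝ} {f : ℝ → Euc d → ℝ}
    (hf : AEStronglyMeasurable (fun z : ℝ × Euc d => f z.1 z.2) (cylinderMeasure d T))
    (hl : ∀ᵐ t ∂(volume.restrict (Ioo 0 T)), LocallyIntegrable (f t) volume) {C : ℝ≥0∞}
    (hC : C ≠ ⊤) (h : ∀ z : Euc d, ∫⁻ t in Ioo 0 T, ∫⁻ x, ‖f t (x + z) - f t x‖ₑ ^ (2 : ℝ)
      ≤ C * ‖z‖ₑ ^ (2 : ℝ)) :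
    (∀ᵐ t ∂(volume.restrict (Ioo 0 T)), HasWeakGradient (f t) (wgrad (f t))) ∧
      ∫⁻ t in Ioo 0 T, ∫⁻ x, ‖wgrad (f t) x‖ₑ ^ (2 : ℝ) ≤ d * C := by
  set e : Fin d → Euc d := fun i => EuclideanSpace.basisFun (Fin d) ℝ i with he
  have hen : ∀ i, ‖e i‖ = 1 := fun i => (EuclideanSpace.basisFun (Fin d) ℝ).orthonormal.1 i
  set s : ℕ → ℝ := fun n => 1 / ((n : ℝ) + 1) with hs
  have hs0 : ∀ n, 0 < s n := fun n => by positivity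
  have hst : Tendsto s atTop (𝓝 0) := tendsto_one_div_add_atTop_nhds_zero_nat
  set M : Fin d → ℝ → ℝ≥0∞ := fun i t => liminf (fun n =>
    ∫⁻ x, ‖(f t (x + s n • e i) - f t x) / s n‖ₑ ^ (2 : ℝ)) atTop with hM
  have hmeas : ∀ i n, AEMeasurable (fun t =>
      ∫⁻ x, ‖(f t (x + s n • e i) - f t x) / s n‖ₑ ^ (2 : ℝ)) (volume.restrict (Ioo 0 T)) := by
    intro i n
    have hmp : MeasurePreserving (fun z : ℝ × Euc d => (z.1, z.2 + s n • e i))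
        (cylinderMeasure d T) (cylinderMeasure d T) :=
      (MeasurePreserving.id _).prod (measurePreserving_add_right volume (s n • e i))
    have h1 : AEStronglyMeasurable (fun z : ℝ × Euc d =>
        (f z.1 (z.2 + s n • e i) - f z.1 z.2) / s n) (cylinderMeasure d T) := by
      have := ((hf.comp_measurePreserving hmp).sub hf).const_mul (s n)⁻¹
      simp only [div_eq_inv_mul]
      exact this
    exact (h1.enorm.pow_const (2 : ℝ)).lintegral_prod_right'
  -- The hypothesis is integrated in time, but the weak derivative must exist slice by slice.
  -- Fatou's lemma bounds the time integral of the lower limit `M i`, so `M i t` is finite for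
  -- almost every `t`.
  have hMC : ∀ i, ∫⁻ t in Ioo 0 T, M i t ≤ C := by
    intro i
    refine (lintegral_liminf_le' (hmeas i)).trans ?_
    refine liminf_le_of_le (by isBoundedDefault) fun b hb => ?_
    obtain ⟨n, hn⟩ := hb.exists
    refine hn.trans ?_
    have hc : ‖(s n)⁻¹‖ₑ ^ (2 : ℝ) ≠ ⊤ := ENNReal.rpow_ne_top_of_nonneg (by norm_num) enorm_ne_top
    calc ∫⁻ t in Ioo 0 T, ∫⁻ x, ‖(f t (x + s n • e i) - f t x) / s n‖ₑ ^ (2 : ℝ)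
        = ‖(s n)⁻¹‖ₑ ^ (2 : ℝ) * ∫⁻ t in Ioo 0 T, ∫⁻ x,
            ‖f t (x + s n • e i) - f t x‖ₑ ^ (2 : ℝ) := by
          rw [← lintegral_const_mul' _ _ hc]
          refine lintegral_congr fun t => ?_
          rw [← lintegral_const_mul' _ _ hc]
          refine lintegral_congr fun x => ?_
          rw [div_eq_inv_mul, enorm_mul, ENNReal.mul_rpow_of_nonneg _ _ (by norm_num)]
      _ ≤ ‖(s n)⁻¹‖ₑ ^ (2 : ℝ) * (C * ‖s n • e i‖ₑ ^ (2 : ℝ)) := by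
          gcongr
          exact h _
      _ = C * (‖(s n)⁻¹‖ₑ * ‖s n • e i‖ₑ) ^ (2 : ℝ) := by
          rw [ENNReal.mul_rpow_of_nonneg _ _ (by norm_num)]; ring
      _ = C := by
          have : ‖(s n)⁻¹‖ₑ * ‖s n • e i‖ₑ = 1 := by
            rw [← ofReal_norm, ← ofReal_norm, norm_smul, hen, mul_one,
              ← ENNReal.ofReal_mul (norm_nonneg _), ← norm_mul, inv_mul_cancel₀ (hs0 n).ne']
            simp
          rw [this, ENNReal.one_rpow, mul_one]
  have hMm : ∀ i, AEMeasurable (M i) (volume.restrict (Ioo 0 T)) := fun i =>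
    ⟨_, Measurable.liminf fun n => (hmeas i n).measurable_mk, by
      filter_upwards [ae_all_iff.2 fun n => (hmeas i n).ae_eq_mk] with t ht
      simp only [hM, ht]⟩
  have hfin : ∀ i, ∀ᵐ t ∂(volume.restrict (Ioo 0 T)), M i t < ⊤ := fun i =>
    ae_lt_top' (hMm i) ((hMC i).trans_lt (lt_top_iff_ne_top.2 hC)).ne
  have key : ∀ᵐ t ∂(volume.restrict (Ioo 0 T)), HasWeakGradient (f t) (wgrad (f t)) ∧
      ∫⁻ x, ‖wgrad (f t) x‖ₑ ^ (2 : ℝ) ≤ ∑ i, M i t := by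
    filter_upwards [ae_all_iff.2 hfin, hl] with t ht htl
    have hk := fun i => exists_weak_partial htl (e i) (fun n => (hs0 n).ne') hst (ht i).ne
      (le_refl (M i t))
    choose k hk1 hk2 hk3 using hk
    have h1 := (hasWeakGradient_of_partials htl hk1 hk3).1
    refine ⟨hasWeakGradient_wgrad h1, ?_⟩
    calc ∫⁻ x, ‖wgrad (f t) x‖ₑ ^ (2 : ℝ)
        = ∫⁻ x, ∑ i, ‖k i x‖ₑ ^ (2 : ℝ) := by
          refine lintegral_congr_ae ?_
          filter_upwards [wgrad_ae_eq h1] with x hx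
          rw [hx, ← ofReal_norm, ENNReal.ofReal_rpow_of_nonneg (norm_nonneg _) (by norm_num),
            Real.rpow_two, EuclideanSpace.norm_sq_eq, ENNReal.ofReal_sum_of_nonneg
            fun i _ => by positivity]
          refine Finset.sum_congr rfl fun i _ => ?_
          rw [← ofReal_norm, ENNReal.ofReal_rpow_of_nonneg (norm_nonneg _) (by norm_num),
            Real.rpow_two]
      _ = ∑ i, ∫⁻ x, ‖k i x‖ₑ ^ (2 : ℝ) :=
          lintegral_finsetSum' _ fun i _ => (hk1 i).1.enorm.pow_const _
      _ ≤ _ := Finset.sum_le_sum fun i _ => hk2 i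
  refine ⟨key.mono fun t ht => ht.1, ?_⟩
  calc ∫⁻ t in Ioo 0 T, ∫⁻ x, ‖wgrad (f t) x‖ₑ ^ (2 : ℝ)
      ≤ ∫⁻ t in Ioo 0 T, ∑ i, M i t := lintegral_mono_ae (key.mono fun t ht => ht.2)
    _ = ∑ i, ∫⁻ t in Ioo 0 T, M i t := lintegral_finsetSum' _ fun i _ => hMm i
    -- Each coordinate direction contributes `C`; this is the origin of the factor `d` in the
    -- theorem.
    _ ≤ ∑ _i : Fin d, C := Finset.sum_le_sum fun i _ => hMC i
    _ = d * C := by simp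

/-- Chain rule for powers of a bounded nonnegative function. -/
lemma HasWeakGradient_rpow {f : Euc d → ℝ} {K : Euc d → Euc d} (h : HasWeakGradient f K) {α m : ℝ}
    (hα : 1 ≤ α) (hf0 : ∀ x, 0 ≤ f x) (hm : 0 ≤ m) (hfm : ∀ᵐ x, f x ≤ m) :
    HasWeakGradient (fun x => f x ^ α) (fun x => (α * f x ^ (α - 1)) • K x) := by
  -- The derivative of the power is frozen outside `[0, m]`, so that it is bounded; `α ≥ 1` makes it
  -- continuous at `0`.
  set γ : ℝ → ℝ := fun s => α * (min (max s 0) m) ^ (α - 1) with hγd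
  have hr : ∀ s, 0 ≤ min (max s 0) m := fun s => le_min (le_max_right _ _) hm
  have hγ : Continuous γ := continuous_const.mul
    ((by fun_prop : Continuous fun s : ℝ => min (max s 0) m).rpow_const
      fun s => Or.inr (by linarith))
  have h0 : ∀ s, 0 ≤ γ s := fun s => mul_nonneg (by linarith) (Real.rpow_nonneg (hr s) _)
  have hK : ∀ s, γ s ≤ α * m ^ (α - 1) := fun s => by
    have := Real.rpow_le_rpow (hr s) (min_le_right (max s 0) m) (by linarith : 0 ≤ α - 1)
    simp only [hγd]
    gcongr
  have hT := convexTriple_integral hγ h0 hK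
  have hγe : ∀ s, 0 ≤ s → s ≤ m → γ s = α * s ^ (α - 1) := fun s hs hsm => by
    simp only [hγd]
    rw [max_eq_left hs, min_eq_left hsm]
  have hβ : ∀ s, 0 ≤ s → s ≤ m → ∫ q in (0 : ℝ)..s, γ q = s ^ α := fun s hs hsm => by
    have e : ∫ q in (0 : ℝ)..s, γ q = ∫ q in (0 : ℝ)..s, α * q ^ (α - 1) := by
      refine intervalIntegral.integral_congr fun q hq => ?_
      rw [uIcc_of_le hs] at hq
      exact hγe q hq.1 (hq.2.trans hsm)
    rw [e, intervalIntegral.integral_const_mul, integral_rpow (Or.inl (by linarith)),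
      sub_add_cancel, Real.zero_rpow (by linarith), sub_zero]
    field_simp
  refine HasWeakGradient_congr (HasWeakGradient_comp h hT.hβ hγ hT.abs_γ_le) ?_ ?_
  · filter_upwards [hfm] with x hx
    exact hβ _ (hf0 x) hx
  · filter_upwards [hfm] with x hx
    rw [hγe _ (hf0 x) hx]

end PLaplace

namespace PLaplace

open Filter Topology Metric ContinuousLinearMap
open scoped ENNReal NNReal Convolution Gradient

variable {d : ℕ}

/-! ### Local energy estimate outside a ball -/

lemma two_mul_ofReal (a : ℝ) : 2 * ENNReal.ofReal a = ENNReal.ofReal (2 * a) := by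
  rw [ENNReal.ofReal_mul two_pos.le]; simp

lemma exists_abs_deriv_smoothTransition_le :
    ∃ c : ℝ, 0 < c ∧ ∀ s, |deriv Real.smoothTransition s| ≤ c := by
  have hc : Continuous (deriv Real.smoothTransition) :=
    (Real.smoothTransition.contDiff (n := 1)).continuous_deriv le_rfl
  obtain ⟨c, hc'⟩ := isCompact_Icc.exists_bound_of_continuousOn (s := Icc (0 : ℝ) 1) hc.continuousOn
  refine ⟨|c| + 1, by positivity, fun s => ?_⟩
  by_cases hs : s ∈ Icc (0 : ℝ) 1
  · have := hc' s hs
    rw [Real.norm_eq_abs] at this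
    linarith [le_abs_self c]
  · have h0 : deriv Real.smoothTransition s = 0 := by
      rcases not_and_or.1 hs with h | h
      · have : Real.smoothTransition =ᶠ[𝓝 s] fun _ => 0 := by
          filter_upwards [gt_mem_nhds (not_le.1 h)] with r hr
          exact Real.smoothTransition.zero_of_nonpos hr.le
        rw [this.deriv_eq, deriv_const]
      · have : Real.smoothTransition =ᶠ[𝓝 s] fun _ => 1 := by
          filter_upwards [lt_mem_nhds (not_le.1 h)] with r hr
          exact Real.smoothTransition.one_of_one_le hr.le
        rw [this.deriv_eq, deriv_const]
    rw [h0, abs_zero]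
    positivity

/-- The complement of the closed ball of radius `ρ`. -/
def tail (d : ℕ) (ρ : ℝ) : Set (Euc d) := {x | ρ < ‖x‖}

lemma isOpen_tail (ρ : ℝ) : IsOpen (tail d ρ) := isOpen_lt continuous_const continuous_norm

lemma measurableSet_tail (ρ : ℝ) : MeasurableSet (tail d ρ) := (isOpen_tail ρ).measurableSet

lemma tail_subset {ρ ρ' : ℝ} (h : ρ ≤ ρ') : tail d ρ' ⊆ tail d ρ := fun _ hx =>
  lt_of_le_of_lt h hx

/-- A smooth function vanishing on the ball of radius `ρ` and equal to `1` outside the ball of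
radius `ρ + δ`. -/
noncomputable def annularCutoff (ρ δ : ℝ) (x : Euc d) : ℝ :=
  Real.smoothTransition ((‖x‖ ^ 2 - ρ ^ 2) / ((ρ + δ) ^ 2 - ρ ^ 2))

lemma annularCutoff_contDiff (ρ δ : ℝ) : ContDiff ℝ ∞ (annularCutoff ρ δ : Euc d → ℝ) :=
  Real.smoothTransition.contDiff.comp (((contDiff_norm_sq ℝ).sub contDiff_const).div_const _)

lemma annularCutoff_nonneg (ρ δ : ℝ) (x : Euc d) : 0 ≤ annularCutoff ρ δ x :=
  Real.smoothTransition.nonneg _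

lemma annularCutoff_le_one (ρ δ : ℝ) (x : Euc d) : annularCutoff ρ δ x ≤ 1 :=
  Real.smoothTransition.le_one _

lemma annularCutoff_eq_zero {ρ δ : ℝ} (hρ : 0 ≤ ρ) (hδ : 0 < δ) {x : Euc d} (hx : x ∉ tail d ρ) :
    annularCutoff ρ δ x = 0 := by
  have hx' : ‖x‖ ≤ ρ := not_lt.1 hx
  refine Real.smoothTransition.zero_of_nonpos (div_nonpos_of_nonpos_of_nonneg ?_ ?_)
  · nlinarith [norm_nonneg x]
  · nlinarith

lemma annularCutoff_eq_one {ρ δ : ℝ} (hρ : 0 ≤ ρ) (hδ : 0 < δ) {x : Euc d}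
    (hx : x ∈ tail d (ρ + δ)) : annularCutoff ρ δ x = 1 := by
  have hx' : ρ + δ < ‖x‖ := hx
  refine Real.smoothTransition.one_of_one_le ?_
  rw [le_div_iff₀ (by nlinarith)]
  nlinarith

/-- The cutoff attains its minimum at every point of the closed ball, so its gradient vanishes
there, the boundary sphere included. -/
lemma gradient_annularCutoff_eq_zero {ρ δ : ℝ} (hρ : 0 ≤ ρ) (hδ : 0 < δ) {x : Euc d}
    (hx : x ∉ tail d ρ) : ∇ (annularCutoff ρ δ) x = 0 := by
  have h : IsLocalMin (annularCutoff ρ δ : Euc d → ℝ) x := by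
    refine Eventually.of_forall fun y => ?_
    rw [annularCutoff_eq_zero hρ hδ hx]
    exact annularCutoff_nonneg ρ δ y
  rw [gradient, h.fderiv_eq_zero, map_zero]

/-- Beyond radius `ρ + δ` the cutoff is at its maximum. Inside, the chain rule gives `2 c ‖x‖ / D`
with `‖x‖ ≤ ρ + δ` and `D = δ (2ρ + δ) ≥ δ (ρ + δ)`. -/
lemma norm_gradient_annularCutoff_le {c : ℝ} (hc : ∀ s, |deriv Real.smoothTransition s| ≤ c)
    {ρ δ : ℝ} (hρ : 0 ≤ ρ) (hδ : 0 < δ) (x : Euc d) :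
    ‖∇ (annularCutoff ρ δ) x‖ ≤ 2 * c / δ := by
  have hc0 : 0 ≤ c := (abs_nonneg _).trans (hc 0)
  rw [norm_gradient]
  by_cases hx : x ∈ tail d (ρ + δ)
  · have h : IsLocalMax (annularCutoff ρ δ : Euc d → ℝ) x := by
      refine Eventually.of_forall fun y => ?_
      rw [annularCutoff_eq_one hρ hδ hx]
      exact annularCutoff_le_one ρ δ y
    rw [h.fderiv_eq_zero, norm_zero]
    positivity
  · have hx' : ‖x‖ ≤ ρ + δ := not_lt.1 hx
    set D := (ρ + δ) ^ 2 - ρ ^ 2 with hD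
    have hD0 : 0 < D := by nlinarith
    have h1 : HasFDerivAt (fun x : Euc d => (‖x‖ ^ 2 - ρ ^ 2) / D)
        (D⁻¹ • (2 • innerSL ℝ x)) x := by
      have := ((hasStrictFDerivAt_norm_sq x).hasFDerivAt.sub_const (ρ ^ 2)).const_mul D⁻¹
      simpa only [div_eq_inv_mul] using this
    have h2 : HasDerivAt Real.smoothTransition
        (deriv Real.smoothTransition ((‖x‖ ^ 2 - ρ ^ 2) / D)) ((‖x‖ ^ 2 - ρ ^ 2) / D) :=
      ((Real.smoothTransition.contDiff (n := 1)).differentiable (by simp) _).hasDerivAt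
    have h3 := h2.comp_hasFDerivAt x h1
    have h4 : fderiv ℝ (annularCutoff ρ δ) x = _ := h3.fderiv
    rw [h4, norm_smul, norm_smul, Real.norm_eq_abs, norm_inv, Real.norm_eq_abs, abs_of_pos hD0]
    have h5 : ‖(2 : ℕ) • innerSL ℝ x‖ ≤ 2 * (ρ + δ) := by
      refine (norm_nsmul_le).trans ?_
      rw [innerSL_apply_norm]
      push_cast
      linarith
    calc |deriv Real.smoothTransition ((‖x‖ ^ 2 - ρ ^ 2) / D)| * (D⁻¹ * ‖(2 : ℕ) • innerSL ℝ x‖)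
        ≤ c * (D⁻¹ * (2 * (ρ + δ))) := by
          gcongr
          exact hc _
      _ = 2 * c * ((ρ + δ) / D) := by field_simp
      _ ≤ 2 * c * (1 / δ) := by
          gcongr 2 * c * ?_
          rw [div_le_div_iff₀ hD0 hδ]
          nlinarith
      _ = _ := by ring

lemma norm_gradient_pow_le {χ : Euc d → ℝ} (hχ : ContDiff ℝ ∞ χ) (h0 : ∀ x, 0 ≤ χ x) (N : ℕ)
    (x : Euc d) : ‖∇ (fun y => χ y ^ N) x‖ ≤ N * χ x ^ (N - 1) * ‖∇ χ x‖ := by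
  have h1 := ((hχ.differentiable (by simp) x).hasFDerivAt.pow N)
  have h2 : fderiv ℝ (fun y => χ y ^ N) x = _ := h1.fderiv
  rw [norm_gradient, norm_gradient, h2, norm_smul, Real.norm_eq_abs, abs_of_nonneg]
  · simp
  · have := h0 x
    positivity

/-- Young's inequality for the cross term in the local energy estimate. -/
lemma young_cross_term {p : ℝ} (hp : 1 ≤ p) {N : ℕ} (hN : p ≤ N) {χ b g : ℝ} (hχ0 : 0 ≤ χ)
    (hχ1 : χ ≤ 1) (hb : 0 ≤ b) (hg : 0 ≤ g) :
    χ ^ (N - 1) * b * g ^ (p - 1) ≤ χ ^ N * g ^ p / 2 + 2 ^ (p - 1) * b ^ p := by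
  have hp0 : 0 < p := by linarith
  have hN1 : 1 ≤ N := by
    have : (1 : ℝ) ≤ N := hp.trans hN
    exact_mod_cast this
  -- If `2b ≤ χ g`, the left-hand side is absorbed into half of `χ^N g^p`; otherwise `χ g ≤ 2b`
  -- bounds it by a power of `b` alone.
  rcases le_total (2 * b) (χ * g) with h | h
  · have e1 : χ ^ N = χ ^ (N - 1) * χ := by rw [← pow_succ, Nat.sub_add_cancel hN1]
    have e2 : g ^ p = g * g ^ (p - 1) := by
      rcases hg.eq_or_lt with rfl | hg'
      · rw [Real.zero_rpow hp0.ne', zero_mul]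
      · rw [Real.rpow_sub_one hg'.ne']
        field_simp
    have h2 : χ ^ (N - 1) * b * g ^ (p - 1) ≤ χ ^ (N - 1) * (χ * g / 2) * g ^ (p - 1) := by
      gcongr
      linarith
    have h3 : 0 ≤ 2 ^ (p - 1) * b ^ p := by positivity
    rw [e1, e2]
    linarith
  · have h1 : χ ^ (N - 1) ≤ χ ^ (p - 1) := by
      rw [← Real.rpow_natCast]
      rcases hχ0.eq_or_lt with rfl | h'
      · rcases eq_or_lt_of_le hN1 with h4 | h4
        · rw [← h4]
          have : p = 1 := le_antisymm (by rw [← h4] at hN; simpa using hN) hp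
          rw [this]; simp
        · rw [Real.zero_rpow (by
            have : 0 < N - 1 := by omega
            exact_mod_cast this.ne')]
          exact Real.rpow_nonneg le_rfl _
      · refine Real.rpow_le_rpow_of_exponent_ge h' hχ1 ?_
        rw [Nat.cast_sub hN1]
        push_cast
        linarith
    have h2 : (χ * g) ^ (p - 1) ≤ (2 * b) ^ (p - 1) :=
      Real.rpow_le_rpow (by positivity) h (by linarith)
    rw [Real.mul_rpow hχ0 hg, Real.mul_rpow (by norm_num) hb] at h2
    have e2 : b ^ p = b * b ^ (p - 1) := by
      rcases hb.eq_or_lt with rfl | hg'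
      · rw [Real.zero_rpow hp0.ne', zero_mul]
      · rw [Real.rpow_sub_one hg'.ne']
        field_simp
    have h3 : 0 ≤ χ ^ N * g ^ p / 2 := by positivity
    calc χ ^ (N - 1) * b * g ^ (p - 1) ≤ χ ^ (p - 1) * b * g ^ (p - 1) := by gcongr
      _ = b * (χ ^ (p - 1) * g ^ (p - 1)) := by ring
      _ ≤ b * (2 ^ (p - 1) * b ^ (p - 1)) := by gcongr
      _ = 2 ^ (p - 1) * b ^ p := by rw [e2]; ring
      _ ≤ _ := by linarith

/-! ### The local energy estimate for the flow -/

section Flow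

variable {p T : ℝ} {u u' : ℝ → Lp ℝ 2 (volume : Measure (Euc d))} {G : ℝ → Euc d → Euc d}

lemma IsFlow.memLp (hp : 2 ≤ p) (hF : IsFlow p T u u' G fun t x => flux p (G t x)) :
    ∀ᵐ t ∂(volume.restrict (Ioo 0 T)), MemLp (u t) (ENNReal.ofReal p) volume := by
  filter_upwards [hF.grad, hF.memG] with t h1 h2
  exact memLp_of_gradient h1 hp (Lp.memLp _) h2

lemma aemeasurable_setLIntegral_of_continuousOn {T : ℝ} (hT : 0 ≤ T)
    {u : ℝ → Lp ℝ 2 (volume : Measure (Euc d))} (hu : ContinuousOn u (Icc 0 T)) (S : Set (Euc d))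
    (q : ℝ) : AEMeasurable (fun t => ∫⁻ x in S, ‖u t x‖ₑ ^ q) (volume.restrict (Ioo 0 T)) := by
  obtain ⟨U, hU, hUu⟩ := exists_stronglyMeasurable_of_continuousOn hT hu
  refine ⟨fun t => ∫⁻ x in S, ‖U t x‖ₑ ^ q, ?_, ?_⟩
  · exact (hU.enorm.pow_const q).lintegral_prod_right'
  · filter_upwards [ae_restrict_mem measurableSet_Ioo] with t ht
    refine lintegral_congr_ae (ae_restrict_of_ae ?_)
    filter_upwards [hUu t (Ioo_subset_Icc_self ht)] with x hx
    rw [hx]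

/-- Lower bound for the integrand obtained by testing with a power of a cutoff function. -/
lemma half_integral_le_testIntegrand (hp : 2 ≤ p) {v : ℝ → Lp ℝ 2 (volume : Measure (Euc d))}
    {N : ℕ} (hN : p ≤ N) {χ : Euc d → ℝ} (hχ : ContDiff ℝ ∞ χ) (hχ0 : ∀ x, 0 ≤ χ x)
    (hχ1 : ∀ x, χ x ≤ 1) {C : ℝ} (hχ2 : ∀ x, ‖∇ χ x‖ ≤ C) {S : Set (Euc d)} (hS : MeasurableSet S)
    (hχS : ∀ x, x ∉ S → ∇ χ x = 0) {t : ℝ} (hG : MemLp (G t) (ENNReal.ofReal p) volume)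
    (hv : MemLp (v t) (ENNReal.ofReal p) volume) :
    (∫ x, χ x ^ N * ‖G t x‖ ^ p) / 2 ≤
      testIntegrand v G (fun t x => flux p (G t x)) (fun s => s) (fun _ => 1) (fun x => χ x ^ N) t
        + 2 ^ (p - 1) * (N * C) ^ p * (∫⁻ x in S, ‖v t x‖ₑ ^ p).toReal := by
  have hp0 : 0 < p := by linarith
  have hC0 : 0 ≤ C := (norm_nonneg _).trans (hχ2 0)
  have hi : ∀ {H : Type} [NormedAddCommGroup H] {f : Euc d → H},
      MemLp f (ENNReal.ofReal p) volume → Integrable (fun x => ‖f x‖ ^ p) volume := fun hf => by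
    have := hf.integrable_norm_rpow (by simpa using hp0) ENNReal.ofReal_ne_top
    rwa [ENNReal.toReal_ofReal hp0.le] at this
  have hζ : ContDiff ℝ ∞ fun x => χ x ^ N := hχ.pow N
  have hζ1 : ∀ x, χ x ^ N ≤ 1 := fun x => pow_le_one₀ (hχ0 x) (hχ1 x)
  have hgr : ∀ x, ‖∇ (fun x => χ x ^ N) x‖ ≤ N * χ x ^ (N - 1) * ‖∇ χ x‖ :=
    norm_gradient_pow_le hχ hχ0 N
  have hgr2 : ∀ x, ‖∇ (fun x => χ x ^ N) x‖ ≤ N * C := fun x => by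
    refine (hgr x).trans ?_
    have h1 : χ x ^ (N - 1) ≤ 1 := pow_le_one₀ (hχ0 x) (hχ1 x)
    have := hχ0 x
    calc N * χ x ^ (N - 1) * ‖∇ χ x‖ ≤ N * 1 * C := by
          gcongr
          exact hχ2 x
      _ = _ := by ring
  have i1 : Integrable (fun x => χ x ^ N * ‖G t x‖ ^ p) volume := by
    refine (hi hG).bdd_mul (c := 1) hζ.continuous.aestronglyMeasurable
      (Eventually.of_forall fun x => ?_)
    rw [Real.norm_eq_abs, abs_of_nonneg (pow_nonneg (hχ0 x) N)]
    exact hζ1 x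
  have i2 : Integrable (S.indicator fun x => ‖v t x‖ ^ p) volume := (hi hv).indicator hS
  have i3 : Integrable (fun x => inner ℝ (flux p (G t x))
      ((χ x ^ N) • (1 : ℝ) • G t x + v t x • ∇ (fun x => χ x ^ N) x)) volume := by
    refine integrable_inner_of_memLp (Real.HolderConjugate.conjExponent (by linarith : 1 < p))
      (MemLp.add ?_ ?_) (memLp_flux hp hG)
    · simp only [one_smul]
      refine MemLp.of_le_mul (c := 1) hG (hζ.continuous.aestronglyMeasurable.smul hG.1)
        (Eventually.of_forall fun x => ?_)
      rw [norm_smul, Real.norm_eq_abs, abs_of_nonneg (pow_nonneg (hχ0 x) N)]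
      gcongr
      exact hζ1 x
    · refine MemLp.of_le_mul (c := N * C) hv (hv.1.smul (continuous_gradient hζ).aestronglyMeasurable)
        (Eventually.of_forall fun x => ?_)
      rw [norm_smul, mul_comm]
      gcongr
      exact hgr2 x
  have e : (∫⁻ x in S, ‖v t x‖ₑ ^ p).toReal = ∫ x, S.indicator (fun x => ‖v t x‖ ^ p) x := by
    rw [integral_indicator hS, integral_eq_lintegral_of_nonneg_ae
      (Eventually.of_forall fun x => by positivity) (hi hv).integrableOn.1]
    congr 1
    refine lintegral_congr fun x => ?_
    rw [← ENNReal.ofReal_rpow_of_nonneg (norm_nonneg _) hp0.le, ofReal_norm]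
  rw [e, ← sub_le_iff_le_add, ← integral_const_mul, ← integral_div, testIntegrand,
    ← integral_sub (i1.div_const 2) (i2.const_mul _)]
  refine integral_mono ((i1.div_const 2).sub (i2.const_mul _)) i3 fun x => ?_
  simp only
  rw [one_smul, inner_add_right, real_inner_smul_right, real_inner_smul_right, inner_flux_self hp]
  -- On `S` the cross term is absorbed by Young's inequality with `b = N C ‖v‖`; off `S` the
  -- gradient of the cutoff vanishes and no cross term remains.
  by_cases hx : x ∈ S
  · rw [indicator_of_mem hx]
    have h1 := abs_real_inner_le_norm (flux p (G t x)) (∇ (fun x => χ x ^ N) x)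
    rw [norm_flux hp] at h1
    have h2 := young_cross_term (by linarith : 1 ≤ p) hN (hχ0 x) (hχ1 x)
      (by positivity : 0 ≤ N * C * ‖v t x‖) (norm_nonneg (G t x))
    have h3 : |v t x * inner ℝ (flux p (G t x)) (∇ (fun x => χ x ^ N) x)|
        ≤ χ x ^ (N - 1) * (N * C * ‖v t x‖) * ‖G t x‖ ^ (p - 1) := by
      have h0 := hχ0 x
      rw [abs_mul, ← Real.norm_eq_abs (v t x)]
      calc ‖v t x‖ * |inner ℝ (flux p (G t x)) (∇ (fun x => χ x ^ N) x)|
          ≤ ‖v t x‖ * (‖G t x‖ ^ (p - 1) * (N * χ x ^ (N - 1) * C)) := by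
            gcongr
            refine h1.trans ?_
            gcongr
            refine (hgr x).trans ?_
            gcongr
            exact hχ2 x
        _ = _ := by ring
    rw [Real.mul_rpow (by positivity) (norm_nonneg _)] at h2
    have h4 := neg_abs_le (v t x * inner ℝ (flux p (G t x)) (∇ (fun x => χ x ^ N) x))
    linarith
  · have h0 : ∇ (fun x => χ x ^ N) x = 0 := by
      have := hgr x
      rw [hχS x hx, norm_zero, mul_zero] at this
      exact norm_le_zero_iff.1 this
    rw [indicator_of_notMem hx, h0, inner_zero_right]
    have := mul_nonneg (pow_nonneg (hχ0 x) N) (Real.rpow_nonneg (norm_nonneg (G t x)) p)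
    linarith

/-- The constant in the local energy estimate. -/
lemma exists_local_energy (d : ℕ) (hp : 2 ≤ p) : ∃ C : ℝ, 0 < C ∧
    ∀ (T : ℝ) (u u' : ℝ → Lp ℝ 2 (volume : Measure (Euc d))) (G : ℝ → Euc d → Euc d)
      (_ : IsFlow p T u u' G fun t x => flux p (G t x)) (t : ℝ) (_ : 0 < t) (_ : t ≤ T)
      (ρ δ : ℝ) (_ : 0 ≤ ρ) (_ : 0 < δ) (_ : ∀ᵐ x, x ∈ tail d ρ → u 0 x = 0),
      (∫⁻ x in tail d (ρ + δ), ‖u t x‖ₑ ^ (2 : ℝ) ≤ ENNReal.ofReal (C * δ ^ (-p)) *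
        ∫⁻ τ in Ioo 0 t, ∫⁻ x in tail d ρ, ‖u τ x‖ₑ ^ p) ∧
      ∫⁻ τ in Ioo 0 t, ∫⁻ x in tail d (ρ + δ), ‖G τ x‖ₑ ^ p ≤ ENNReal.ofReal (C * δ ^ (-p)) *
        ∫⁻ τ in Ioo 0 t, ∫⁻ x in tail d ρ, ‖u τ x‖ₑ ^ p := by
  have hp0 : 0 < p := by linarith
  obtain ⟨c, hc0, hc⟩ := exists_abs_deriv_smoothTransition_le
  obtain ⟨N, hN⟩ := exists_nat_ge p
  have hN0 : (0 : ℝ) < N := by linarith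
  -- The leading `2` undoes the halves in `s²/2` and in Young's inequality; `N` comes from
  -- differentiating `χ^N`, and `2c` from the gradient bound `2c/δ` of the cutoff.
  refine ⟨2 * (2 ^ (p - 1) * (N * (2 * c)) ^ p), by positivity, ?_⟩
  intro T u u' G hF t ht0 ht ρ δ hρ hδ h0
  set Q := ∫⁻ τ in Ioo 0 t, ∫⁻ x in tail d ρ, ‖u τ x‖ₑ ^ p with hQ
  set c' : ℝ := 2 ^ (p - 1) * (N * (2 * c / δ)) ^ p with hc'
  have hc'0 : 0 < c' := by positivity
  have ec : 2 * (2 ^ (p - 1) * (N * (2 * c)) ^ p) * δ ^ (-p) = 2 * c' := by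
    rw [hc', Real.rpow_neg hδ.le, ← mul_div_assoc, Real.div_rpow (by positivity) hδ.le]
    ring
  rw [ec]
  -- An infinite right-hand side is trivial; finiteness makes the error term `D` integrable in time.
  by_cases hQt : Q = ⊤
  · rw [hQt, ENNReal.mul_top (by simpa using hc'0)]
    exact ⟨le_top, le_top⟩
  set χ : Euc d → ℝ := annularCutoff ρ δ with hχ
  have hχd : ContDiff ℝ ∞ χ := annularCutoff_contDiff ρ δ
  have hχ0 := annularCutoff_nonneg (d := d) ρ δ
  have hχ1 := annularCutoff_le_one (d := d) ρ δ
  have hχ2 := norm_gradient_annularCutoff_le (d := d) hc hρ hδ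
  set D : ℝ → ℝ := fun τ => c' * (∫⁻ x in tail d ρ, ‖u τ x‖ₑ ^ p).toReal with hD
  have hDm : AEMeasurable (fun τ => ∫⁻ x in tail d ρ, ‖u τ x‖ₑ ^ p) (volume.restrict (Ioo 0 t)) :=
    aemeasurable_setLIntegral_of_continuousOn ht0.le (hF.cont.mono (Icc_subset_Icc_right ht)) _ _
  have hDi : IntegrableOn D (Ioo 0 t) :=
    (integrable_toReal_of_lintegral_ne_top hDm hQt).const_mul c'
  have hD0 : ∀ τ, 0 ≤ D τ := fun τ => by positivity
  have hkey : ∀ᵐ τ ∂(volume.restrict (Ioo 0 T)), (∫ x, χ x ^ N * ‖G τ x‖ ^ p) / 2 ≤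
      testIntegrand u G (fun t x => flux p (G t x)) (fun s => s) (fun _ => 1) (fun x => χ x ^ N) τ
        + D τ := by
    filter_upwards [hF.memG, hF.memLp hp] with τ h1 h2
    exact half_integral_le_testIntegrand hp hN hχd hχ0 hχ1 hχ2 (measurableSet_tail ρ)
      (fun x hx => gradient_annularCutoff_eq_zero hρ hδ hx) h1 h2
  have hζ0 : ∀ x, 0 ≤ χ x ^ N := fun x => pow_nonneg (hχ0 x) N
  have hζ1 : ∀ x, χ x ^ N ≤ 1 := fun x => pow_le_one₀ (hχ0 x) (hχ1 x)
  have hmain := hF.test_lintegral hp convexTriple_sq (ζ := fun x => χ x ^ N) (Z := 1)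
    (C := N * (2 * c / δ)) (hχd.pow N) hζ0 hζ1
    (fun x => by
      refine (norm_gradient_pow_le hχd hχ0 N x).trans ?_
      have h1 : χ x ^ (N - 1) ≤ 1 := pow_le_one₀ (hχ0 x) (hχ1 x)
      have := hχ0 x
      calc N * χ x ^ (N - 1) * ‖∇ χ x‖ ≤ N * 1 * (2 * c / δ) := by
            gcongr
            exact hχ2 x
        _ = _ := by ring)
    ht0 ht hDi hD0 (by
      filter_upwards [hkey] with τ hτ
      refine le_trans ?_ hτ
      have : 0 ≤ ∫ x, χ x ^ N * ‖G τ x‖ ^ p := integral_nonneg fun x =>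
        mul_nonneg (hζ0 x) (by positivity)
      linarith)
  have e0 : ∫ x, χ x ^ N * ((u 0 x) ^ 2 / 2) = 0 := by
    refine integral_eq_zero_of_ae ?_
    filter_upwards [h0] with x hx
    by_cases hxt : x ∈ tail d ρ
    · simp [hx hxt]
    · have : χ x = 0 := annularCutoff_eq_zero hρ hδ hxt
      have hN' : N ≠ 0 := by exact_mod_cast hN0.ne'
      simp [this, hN']
  have eD : ENNReal.ofReal (∫ τ in Ioo 0 t, D τ) ≤ ENNReal.ofReal c' * Q := by
    rw [ofReal_integral_eq_lintegral_ofReal hDi (Eventually.of_forall hD0), hQ,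
      ← lintegral_const_mul' _ _ ENNReal.ofReal_ne_top]
    refine lintegral_mono fun τ => ?_
    simp only [hD]
    rw [ENNReal.ofReal_mul hc'0.le]
    gcongr
    exact ENNReal.ofReal_toReal_le
  rw [e0, zero_add] at hmain
  replace hmain := hmain.trans eD
  rw [← two_mul_ofReal, mul_assoc]
  constructor
  · have hi := integrable_mul_j convexTriple_sq (ζ := fun x => χ x ^ N) (Z := 1)
      (hχd.pow N).continuous hζ0 hζ1 (Lp.memLp (u t))
    refine le_trans ?_ (mul_le_mul_right (le_self_add.trans hmain) 2)
    rw [ofReal_integral_eq_lintegral_ofReal hi (Eventually.of_forall fun x =>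
      mul_nonneg (hζ0 x) (convexTriple_sq.j_nonneg _)),
      ← lintegral_const_mul' _ _ (by simp)]
    refine le_trans ?_ (setLIntegral_le_lintegral (tail d (ρ + δ)) _)
    refine setLIntegral_mono' (measurableSet_tail _) fun x hx => ?_
    have : χ x = 1 := annularCutoff_eq_one hρ hδ hx
    rw [this, one_pow, one_mul, Real.enorm_eq_ofReal_abs,
      ENNReal.ofReal_rpow_of_nonneg (abs_nonneg _) (by norm_num), Real.rpow_two, sq_abs]
    rw [two_mul_ofReal]
    refine ENNReal.ofReal_le_ofReal ?_
    linarith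
  · refine le_trans ?_ (mul_le_mul_right (le_add_self.trans hmain) 2)
    rw [← lintegral_const_mul' _ _ (by simp)]
    refine lintegral_mono_ae ?_
    filter_upwards [ae_restrict_of_ae_restrict_of_subset (Ioo_subset_Ioo_right ht) hkey,
      ae_restrict_of_ae_restrict_of_subset (Ioo_subset_Ioo_right ht) hF.memG] with τ hτ hG
    have hGi : Integrable (fun x => ‖G τ x‖ ^ p) volume := by
      have := hG.integrable_norm_rpow (by simpa using hp0) ENNReal.ofReal_ne_top
      rwa [ENNReal.toReal_ofReal hp0.le] at this
    have i1 : Integrable (fun x => χ x ^ N * ‖G τ x‖ ^ p) volume := by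
      refine hGi.bdd_mul (c := 1) (hχd.pow N).continuous.aestronglyMeasurable
        (Eventually.of_forall fun x => ?_)
      rw [Real.norm_eq_abs, abs_of_nonneg (hζ0 x)]
      exact hζ1 x
    rw [two_mul_ofReal]
    refine le_trans ?_ (ENNReal.ofReal_le_ofReal (by linarith : ∫ x, χ x ^ N * ‖G τ x‖ ^ p ≤ _))
    rw [ofReal_integral_eq_lintegral_ofReal i1 (Eventually.of_forall fun x =>
      mul_nonneg (hζ0 x) (by positivity))]
    refine le_trans ?_ (setLIntegral_le_lintegral (tail d (ρ + δ)) _)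
    refine setLIntegral_mono' (measurableSet_tail _) fun x hx => ?_
    have : χ x = 1 := annularCutoff_eq_one hρ hδ hx
    rw [this, one_pow, one_mul, ← ENNReal.ofReal_rpow_of_nonneg (norm_nonneg _) hp0.le, ofReal_norm]

end Flow

end PLaplace

namespace PLaplace

open Filter Topology Metric ContinuousLinearMap
open scoped ENNReal NNReal Convolution Gradient

variable {d : ℕ} {p T : ℝ} {u u' : ℝ → Lp ℝ 2 (volume : Measure (Euc d))} {G : ℝ → Euc d → Euc d}

/-! ### Finite speed of propagation -/

lemma exists_small_rpow {a A q : ℝ} (ha : 0 < a) (hA : 0 < A) (hq : 0 < q) :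
    ∃ θ : ℝ, 0 < θ ∧ θ ≤ 1 / 2 ∧ A * θ ^ q ≤ a := by
  refine ⟨min (1 / 2) ((a / A) ^ (1 / q)), by positivity, min_le_left _ _, ?_⟩
  have h := Real.rpow_le_rpow (by positivity) (min_le_right (1 / 2) ((a / A) ^ (1 / q))) hq.le
  rw [← Real.rpow_mul (by positivity), one_div_mul_cancel hq.ne', Real.rpow_one,
    le_div_iff₀ hA] at h
  linarith

/-- The energy of the flow up to time `t` outside the ball of radius `ρ` is at most `b`. -/
def TailBound (p t : ℝ) (u : ℝ → Lp ℝ 2 (volume : Measure (Euc d))) (G : ℝ → Euc d → Euc d)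
    (ρ b : ℝ) : Prop :=
  (∀ s ∈ Icc 0 t, ∫⁻ x in tail d ρ, ‖u s x‖ₑ ^ (2 : ℝ) ≤ ENNReal.ofReal b) ∧
    ∫⁻ τ in Ioo 0 t, ∫⁻ x in tail d ρ, ‖G τ x‖ₑ ^ p ≤ ENNReal.ofReal b

lemma TailBound.mono {t ρ b ρ' b' : ℝ} (h : TailBound p t u G ρ b) (hρ : ρ ≤ ρ') (hb : b ≤ b') :
    TailBound p t u G ρ' b' :=
  ⟨fun s hs => ((lintegral_mono_set (tail_subset hρ)).trans (h.1 s hs)).trans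
    (ENNReal.ofReal_le_ofReal hb), ((lintegral_mono fun _ => lintegral_mono_set
      (tail_subset hρ)).trans h.2).trans (ENNReal.ofReal_le_ofReal hb)⟩

lemma TailBound.of_tendsto {t ρ b₀ : ℝ} {b : ℕ → ℝ} (h : ∀ n, TailBound p t u G ρ (b n))
    (hb : Tendsto b atTop (𝓝 b₀)) : TailBound p t u G ρ b₀ := by
  have hb' := (ENNReal.continuous_ofReal.tendsto b₀).comp hb
  exact ⟨fun s hs => ge_of_tendsto' hb' fun n => (h n).1 s hs, ge_of_tendsto' hb' fun n => (h n).2⟩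

lemma lintegral_enorm_rpow_two_eq (f : Lp ℝ 2 (volume : Measure (Euc d))) :
    ∫⁻ x, ‖f x‖ₑ ^ (2 : ℝ) = ENNReal.ofReal (‖f‖ ^ 2) := by
  have h2 : ENNReal.ofReal 2 = 2 := by simp
  have hm : MemLp f (ENNReal.ofReal 2) volume := by
    rw [h2]
    exact Lp.memLp f
  rw [← ofReal_integral_norm_rpow two_pos hm, norm_sq_eq_integral]
  simp

lemma IsFlow.tailBound (hp : 2 ≤ p) (hF : IsFlow p T u u' G fun t x => flux p (G t x)) {t : ℝ}
    (ht0 : 0 < t) (ht : t ≤ T) (ρ : ℝ) : TailBound p t u G ρ (‖u 0‖ ^ 2) := by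
  constructor
  · intro s hs
    refine (setLIntegral_le_lintegral _ _).trans ?_
    rw [lintegral_enorm_rpow_two_eq]
    refine ENNReal.ofReal_le_ofReal ?_
    have := hF.norm_le hp ⟨hs.1, hs.2.trans ht⟩
    gcongr
  · calc ∫⁻ τ in Ioo 0 t, ∫⁻ x in tail d ρ, ‖G τ x‖ₑ ^ p
        ≤ ∫⁻ τ in Ioo 0 T, ∫⁻ x, ‖G τ x‖ₑ ^ p :=
          (lintegral_mono fun _ => setLIntegral_le_lintegral _ _).trans
            (lintegral_mono_set (Ioo_subset_Ioo_right ht))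
      _ ≤ ENNReal.ofReal (‖u 0‖ ^ 2 / 2) := hF.energy hp (ht0.trans_le ht)
      _ ≤ _ := ENNReal.ofReal_le_ofReal (by nlinarith [sq_nonneg ‖u 0‖])

lemma volume_ball_eq_ofReal {ε : ℝ} (hε : 0 < ε) :
    volume (ball (0 : Euc d) ε) = ENNReal.ofReal (ε ^ d * (volume (ball (0 : Euc d) 1)).toReal) := by
  rw [Measure.addHaar_ball_of_pos _ _ hε, finrank_euclideanSpace_fin,
    ENNReal.ofReal_mul (by positivity), ENNReal.ofReal_toReal measure_ball_lt_top.ne]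

/-- The local energy estimate between `ρ + δ` and `ρ + 2δ`, where `|u|^p` beyond `ρ + δ` is bounded
at scale `θδ` by the gradient and the `L^q` norm beyond `ρ`. The old bound `b` acquires the small
factor `θ^p`, at the price of a negative power of `θ` on the `L^q` term. It is iterated with `q = 1`
and with `q = 2`. -/
lemma exists_tailBound_step (d : ℕ) (hp : 2 ≤ p) {q : ℝ} (hq : 1 ≤ q) (hqp : q ≤ p) :
    ∃ C : ℝ, 0 < C ∧
    ∀ (T : ℝ) (u u' : ℝ → Lp ℝ 2 (volume : Measure (Euc d))) (G : ℝ → Euc d → Euc d)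
      (_ : IsFlow p T u u' G fun t x => flux p (G t x)) (t : ℝ) (_ : 0 < t) (_ : t ≤ T)
      (ρ δ θ b m : ℝ) (_ : 0 ≤ ρ) (_ : 0 < δ) (_ : 0 < θ) (_ : θ ≤ 1) (_ : 0 ≤ b) (_ : 0 ≤ m)
      (_ : ∀ᵐ x, x ∈ tail d ρ → u 0 x = 0) (_ : TailBound p t u G ρ b)
      (_ : ∀ s ∈ Icc 0 t, ∫⁻ x in tail d ρ, ‖u s x‖ₑ ^ q ≤ ENNReal.ofReal m),
      TailBound p t u G (ρ + 2 * δ) (C * (θ ^ p * b + θ ^ (-(d * (p - q) / q)) *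
        (δ ^ (-(p + d * (p - q) / q)) * t * m ^ (p / q)))) := by
  have hp0 : 0 < p := by linarith
  have hq0 : 0 < q := by linarith
  obtain ⟨C₀, hC₀, hloc⟩ := exists_local_energy d hp
  set w₁ := (volume (ball (0 : Euc d) 1)).toReal with hw
  have hw0 : 0 < w₁ := ENNReal.toReal_pos (measure_ball_pos _ _ one_pos).ne' measure_ball_lt_top.ne
  set Ω := w₁⁻¹ ^ ((p - q) / q) with hΩ
  have hΩ0 : 0 < Ω := by positivity
  refine ⟨C₀ * 2 ^ (p - 1) * (1 + Ω), by positivity, ?_⟩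
  intro T u u' G hF t ht0 ht ρ δ θ b m hρ hδ hθ hθ1 hb hm h0 hT hmq
  set κ := d * (p - q) / q with hκ
  have hε : 0 < θ * δ := by positivity
  have e1 : ((volume (ball (0 : Euc d) (θ * δ)))⁻¹) ^ ((p - q) / q)
      = ENNReal.ofReal ((θ * δ) ^ (-κ) * Ω) := by
    rw [volume_ball_eq_ofReal hε, ← ENNReal.ofReal_inv_of_pos (by positivity),
      ENNReal.ofReal_rpow_of_pos (by positivity), mul_inv, Real.mul_rpow (by positivity)
      (by positivity), ← Real.rpow_natCast, ← Real.rpow_neg hε.le, ← Real.rpow_mul hε.le]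
    congr 3
    rw [hκ]; ring
  have h2 : (2 : ℝ≥0∞) ^ (p - 1) = ENNReal.ofReal (2 ^ (p - 1)) := by
    rw [← ENNReal.ofReal_rpow_of_pos two_pos]; simp
  have hQ : ∫⁻ τ in Ioo 0 t, ∫⁻ x in tail d (ρ + δ), ‖u τ x‖ₑ ^ p ≤ ENNReal.ofReal
      (2 ^ (p - 1) * ((θ * δ) ^ p * b + (θ * δ) ^ (-κ) * Ω * m ^ (p / q) * t)) := by
    calc ∫⁻ τ in Ioo 0 t, ∫⁻ x in tail d (ρ + δ), ‖u τ x‖ₑ ^ p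
        ≤ ∫⁻ τ in Ioo 0 t, (ENNReal.ofReal (2 ^ (p - 1) * (θ * δ) ^ p) *
            (∫⁻ x in tail d ρ, ‖G τ x‖ₑ ^ p)
            + ENNReal.ofReal (2 ^ (p - 1) * ((θ * δ) ^ (-κ) * Ω * m ^ (p / q)))) := by
          refine lintegral_mono_ae ?_
          filter_upwards [ae_restrict_of_ae_restrict_of_subset (Ioo_subset_Ioo_right ht) hF.grad,
            ae_restrict_mem measurableSet_Ioo] with τ hτ hτm
          have h3 := setLIntegral_rpow_le_gradient_add hτ hq hqp hε
            (measurableSet_tail (ρ + δ)) (measurableSet_tail ρ) (fun x hx y hy => by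
              have hx' : ρ + δ < ‖x‖ := hx
              have h4 := norm_sub_norm_le x (-y)
              rw [sub_neg_eq_add, norm_neg] at h4
              have h5 : θ * δ ≤ δ := mul_le_of_le_one_left hδ.le hθ1
              show ρ < ‖x + y‖
              linarith)
          refine h3.trans ?_
          rw [e1, h2, mul_add, ← mul_assoc, ENNReal.ofReal_rpow_of_pos hε,
            ← ENNReal.ofReal_mul (by positivity)]
          gcongr _ + ?_
          rw [ENNReal.ofReal_mul (by positivity : (0 : ℝ) ≤ 2 ^ (p - 1)),
            ENNReal.ofReal_mul (by positivity : (0 : ℝ) ≤ (θ * δ) ^ (-κ) * Ω)]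
          gcongr _ * (_ * ?_)
          rw [← ENNReal.ofReal_rpow_of_nonneg hm (by positivity)]
          exact ENNReal.rpow_le_rpow (hmq τ (Ioo_subset_Icc_self hτm)) (by positivity)
      _ ≤ ENNReal.ofReal (2 ^ (p - 1) * (θ * δ) ^ p) * ENNReal.ofReal b +
            ENNReal.ofReal (2 ^ (p - 1) * ((θ * δ) ^ (-κ) * Ω * m ^ (p / q)))
              * ENNReal.ofReal t := by
          rw [lintegral_add_right _ measurable_const,
            lintegral_const_mul' _ _ ENNReal.ofReal_ne_top, lintegral_const,
            Measure.restrict_apply MeasurableSet.univ, univ_inter, Real.volume_Ioo, sub_zero]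
          gcongr _ * ?_ + _
          exact hT.2
      _ = _ := by
          rw [← ENNReal.ofReal_mul (by positivity), ← ENNReal.ofReal_mul (by positivity),
            ← ENNReal.ofReal_add (by positivity) (by positivity)]
          congr 1
          ring
  -- The factor `δ^(-p)` from the cutoff cancels `δ^p` from the averaging scale, so the coefficient
  -- of `b` does not depend on `δ`.
  have hval : C₀ * δ ^ (-p) *
      (2 ^ (p - 1) * ((θ * δ) ^ p * b + (θ * δ) ^ (-κ) * Ω * m ^ (p / q) * t))
      ≤ C₀ * 2 ^ (p - 1) * (1 + Ω) * (θ ^ p * b + θ ^ (-κ) * (δ ^ (-(p + κ)) * t * m ^ (p / q))) := by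
    have e2 : δ ^ (-p) * δ ^ p = 1 := by rw [← Real.rpow_add hδ]; simp
    have e3 : δ ^ (-(p + κ)) = δ ^ (-p) * δ ^ (-κ) := by
      rw [← Real.rpow_add hδ]; congr 1; ring
    rw [Real.mul_rpow hθ.le hδ.le, Real.mul_rpow hθ.le hδ.le, e3]
    have e4 : C₀ * δ ^ (-p) *
        (2 ^ (p - 1) * (θ ^ p * δ ^ p * b + θ ^ (-κ) * δ ^ (-κ) * Ω * m ^ (p / q) * t))
        = C₀ * 2 ^ (p - 1) * ((δ ^ (-p) * δ ^ p) * (θ ^ p * b)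
          + Ω * (θ ^ (-κ) * (δ ^ (-p) * δ ^ (-κ) * t * m ^ (p / q)))) := by ring
    rw [e4, e2, one_mul, mul_assoc _ (1 + Ω)]
    gcongr
    have n1 : 0 ≤ θ ^ p * b := by positivity
    have n2 : 0 ≤ θ ^ (-κ) * (δ ^ (-p) * δ ^ (-κ) * t * m ^ (p / q)) := by positivity
    have n3 := mul_nonneg hΩ0.le n1
    linarith
  have h0' : ∀ᵐ x, x ∈ tail d (ρ + δ) → u 0 x = 0 :=
    h0.mono fun x hx hx' => hx (tail_subset (by linarith) hx')
  have hfin : ∀ s, s ≤ t → ENNReal.ofReal (C₀ * δ ^ (-p)) *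
      ∫⁻ τ in Ioo 0 s, ∫⁻ x in tail d (ρ + δ), ‖u τ x‖ₑ ^ p ≤ ENNReal.ofReal
      (C₀ * 2 ^ (p - 1) * (1 + Ω) *
        (θ ^ p * b + θ ^ (-κ) * (δ ^ (-(p + κ)) * t * m ^ (p / q)))) := by
    intro s hs
    refine le_trans ?_ (ENNReal.ofReal_le_ofReal hval)
    rw [ENNReal.ofReal_mul (by positivity : 0 ≤ C₀ * δ ^ (-p))]
    gcongr _ * ?_
    exact (lintegral_mono_set (Ioo_subset_Ioo_right hs)).trans hQ
  have er : ρ + 2 * δ = ρ + δ + δ := by ring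
  rw [er]
  refine ⟨fun s hs => ?_, ?_⟩
  · rcases hs.1.eq_or_lt with rfl | hs0
    · have : ∫⁻ x in tail d (ρ + δ + δ), ‖u 0 x‖ₑ ^ (2 : ℝ) = 0 := by
        rw [setLIntegral_congr_fun_ae (g := fun _ => 0) (measurableSet_tail _), lintegral_zero]
        filter_upwards [h0'] with x hx hx'
        rw [hx (tail_subset (by linarith) hx')]
        simp
      rw [this]
      exact bot_le
    · exact ((hloc T u u' G hF s hs0 (hs.2.trans ht) (ρ + δ) δ (by positivity) hδ h0').1).trans
        (hfin s hs.2)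
  · exact ((hloc T u u' G hF t ht0 ht (ρ + δ) δ (by positivity) hδ h0').2).trans (hfin t le_rfl)

/-- Decay of the energy away from the initial support in terms of the `L^1` norm. -/
lemma exists_tailBound_of_mass (d : ℕ) (hp : 2 ≤ p) : ∃ C : ℝ, 0 < C ∧
    ∀ (T : ℝ) (u u' : ℝ → Lp ℝ 2 (volume : Measure (Euc d))) (G : ℝ → Euc d → Euc d)
      (_ : IsFlow p T u u' G fun t x => flux p (G t x)) (t : ℝ) (_ : 0 < t) (_ : t ≤ T)
      (ρ r M : ℝ) (_ : 0 ≤ ρ) (_ : 0 < r) (_ : 0 ≤ M) (_ : ∀ᵐ x, x ∈ tail d ρ → u 0 x = 0)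
      (_ : ∫⁻ x, ‖u 0 x‖ₑ ≤ ENNReal.ofReal M),
      TailBound p t u G (ρ + r) (C * (r ^ (-(p + d * (p - 1))) * t * M ^ p)) := by
  have hp0 : 0 < p := by linarith
  obtain ⟨C, hC, hstep⟩ := exists_tailBound_step d hp (le_refl (1 : ℝ)) (by linarith)
  simp only [div_one] at hstep
  set κ : ℝ := d * (p - 1) with hκ
  have hκ0 : 0 ≤ κ := mul_nonneg d.cast_nonneg (by linarith)
  -- Halving `r` multiplies the desired bound by `2^(p+κ)`; this `θ` makes one step contract even
  -- that enlarged bound by `1/2`.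
  obtain ⟨θ, hθ, hθ1, hθ2⟩ := exists_small_rpow (a := 1 / 2) (A := C * 2 ^ (p + κ)) (q := p)
    (by norm_num) (by positivity) hp0
  have h2κ : (1 : ℝ) ≤ 2 ^ (p + κ) := Real.one_le_rpow (by norm_num) (by linarith)
  have hσ : C * θ ^ p ≤ 1 / 2 := by
    refine le_trans ?_ hθ2
    have : 0 < C * θ ^ p := by positivity
    nlinarith
  refine ⟨2 * C * θ ^ (-κ) * 4 ^ (p + κ), by positivity, ?_⟩
  intro T u u' G hF t ht0 ht ρ r M hρ hr hM h0 hM1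
  set C' := 2 * C * θ ^ (-κ) * 4 ^ (p + κ) with hC'
  set b₀ := ‖u 0‖ ^ 2 with hb₀
  have hmass : ∀ ρ, ∀ s ∈ Icc 0 t, ∫⁻ x in tail d ρ, ‖u s x‖ₑ ^ (1 : ℝ) ≤ ENNReal.ofReal M := by
    intro ρ s hs
    simp only [ENNReal.rpow_one]
    exact ((setLIntegral_le_lintegral _ _).trans
      (hF.lintegral_enorm_le hp ⟨hs.1, hs.2.trans ht⟩)).trans hM1
  -- Induction over all radii at once: the bound at distance `r/2`, followed by a step with `δ =
  -- r/4`, reaches distance `r` and halves the share of the crude global energy `b₀`.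
  have key : ∀ n : ℕ, ∀ r, 0 < r → TailBound p t u G (ρ + r)
      ((1 / 2) ^ n * b₀ + C' * (r ^ (-(p + κ)) * t * M ^ p)) := by
    intro n
    induction n with
    | zero =>
      intro r hr
      refine (hF.tailBound hp ht0 ht (ρ + r)).mono le_rfl ?_
      rw [pow_zero, one_mul]
      have : 0 ≤ C' * (r ^ (-(p + κ)) * t * M ^ p) := by positivity
      linarith
    | succ n ih =>
      intro r hr
      have h1 := ih (r / 2) (by positivity)
      have h2 := hstep T u u' G hF t ht0 ht (ρ + r / 2) (r / 4) θ _ M (by positivity)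
        (by positivity) hθ (by linarith) (by positivity) hM
        (h0.mono fun x hx hx' => hx (tail_subset (by linarith) hx')) h1 (hmass _)
      refine h2.mono (by linarith) ?_
      have e1 : (r / 2) ^ (-(p + κ)) = 2 ^ (p + κ) * r ^ (-(p + κ)) := by
        rw [Real.div_rpow hr.le two_pos.le, Real.rpow_neg two_pos.le, div_inv_eq_mul, mul_comm]
      have e2 : (r / 4) ^ (-(p + κ)) = 4 ^ (p + κ) * r ^ (-(p + κ)) := by
        rw [Real.div_rpow hr.le (by norm_num), Real.rpow_neg (by norm_num : (0 : ℝ) ≤ 4),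
          div_inv_eq_mul, mul_comm]
      rw [e1, e2]
      set X := r ^ (-(p + κ)) * t * M ^ p with hX
      have hX0 : 0 ≤ X := by positivity
      have e3 : C * (θ ^ p * ((1 / 2) ^ n * b₀ + C' * (2 ^ (p + κ) * r ^ (-(p + κ)) * t * M ^ p))
          + θ ^ (-κ) * (4 ^ (p + κ) * r ^ (-(p + κ)) * t * M ^ p))
          = (C * θ ^ p) * ((1 / 2) ^ n * b₀) + (C * 2 ^ (p + κ) * θ ^ p) * (C' * X)
            + (C * θ ^ (-κ) * 4 ^ (p + κ)) * X := by rw [hX]; ring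
      rw [e3]
      have e4 : C * θ ^ (-κ) * 4 ^ (p + κ) = C' / 2 := by rw [hC']; ring
      rw [e4, pow_succ]
      have n1 : (C * θ ^ p) * ((1 / 2) ^ n * b₀) ≤ 1 / 2 * ((1 / 2) ^ n * b₀) := by gcongr
      have n2 : (C * 2 ^ (p + κ) * θ ^ p) * (C' * X) ≤ 1 / 2 * (C' * X) := by
        have : 0 ≤ C' * X := by positivity
        gcongr
      linarith
  refine TailBound.of_tendsto (fun n => key n r hr) ?_
  have := ((tendsto_pow_atTop_nhds_zero_of_lt_one (by norm_num : (0 : ℝ) ≤ 1 / 2)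
    (by norm_num)).mul_const b₀).add_const (C' * (r ^ (-(p + κ)) * t * M ^ p))
  simpa using this

/-- Small energy outside a ball vanishes outside a slightly larger ball. -/
lemma exists_tailBound_zero (d : ℕ) (hp : 2 < p) : ∃ c : ℝ, 0 < c ∧
    ∀ (T : ℝ) (u u' : ℝ → Lp ℝ 2 (volume : Measure (Euc d))) (G : ℝ → Euc d → Euc d)
      (_ : IsFlow p T u u' G fun t x => flux p (G t x)) (t : ℝ) (_ : 0 < t) (_ : t ≤ T)
      (ρ r b : ℝ) (_ : 0 ≤ ρ) (_ : 0 < r) (_ : 0 ≤ b) (_ : ∀ᵐ x, x ∈ tail d ρ → u 0 x = 0)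
      (_ : TailBound p t u G ρ b) (_ : t * r ^ (-(p + d * (p - 2) / 2)) * b ^ ((p - 2) / 2) ≤ c),
      TailBound p t u G (ρ + r) 0 := by
  have hp0 : 0 < p := by linarith
  obtain ⟨C, hC, hstep⟩ := exists_tailBound_step d hp.le (by norm_num : (1 : ℝ) ≤ 2) hp.le
  set κ : ℝ := d * (p - 2) / 2 with hκ
  have hκ0 : 0 ≤ κ := div_nonneg (mul_nonneg d.cast_nonneg (by linarith)) two_pos.le
  set a : ℝ := (p - 2) / 2 with ha
  have ha0 : 0 < a := div_pos (by linarith) two_pos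
  -- `σ` is the decay factor of the energy per step: with `2^(p+κ) σ^a ≤ 1`, the smallness condition
  -- survives replacing `(r, b)` by `(r/2, σ b)`. Then `θ` and `c` each bound one of the two terms
  -- of a step by `σ b / 2`.
  obtain ⟨σ, hσ, hσ1, hσ2⟩ := exists_small_rpow (a := 1) (A := 2 ^ (p + κ)) (q := a) one_pos
    (by positivity) ha0
  obtain ⟨θ, hθ, hθ1, hθ2⟩ := exists_small_rpow (a := σ / 2) (A := C) (q := p) (by positivity)
    hC hp0
  set c : ℝ := σ / (2 * C * θ ^ (-κ) * 4 ^ (p + κ)) with hc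
  have hc0 : 0 < c := by positivity
  refine ⟨c, hc0, ?_⟩
  intro T u u' G hF t ht0 ht ρ r b hρ hr hb h0 hT hcond
  -- Successive steps advance by `r/2, r/4, …`, never beyond `ρ + r` in total, while the energy
  -- shrinks like `σ^n`.
  have key : ∀ n : ℕ, ∀ ρ r b, 0 ≤ ρ → 0 < r → 0 ≤ b → (∀ᵐ x, x ∈ tail d ρ → u 0 x = 0) →
      TailBound p t u G ρ b → t * r ^ (-(p + κ)) * b ^ a ≤ c →
      TailBound p t u G (ρ + r) (σ ^ n * b) := by
    intro n
    induction n with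
    | zero =>
      intro ρ r b hρ hr hb h0 hT hcond
      exact hT.mono (by linarith) (by simp)
    | succ n ih =>
      intro ρ r b hρ hr hb h0 hT hcond
      have h1 := hstep T u u' G hF t ht0 ht ρ (r / 4) θ b b hρ (by positivity) hθ (by linarith) hb
        hb h0 hT hT.1
      have e2 : (r / 4) ^ (-(p + κ)) = 4 ^ (p + κ) * r ^ (-(p + κ)) := by
        rw [Real.div_rpow hr.le (by norm_num), Real.rpow_neg (by norm_num : (0 : ℝ) ≤ 4),
          div_inv_eq_mul, mul_comm]
      have e1 : (r / 2) ^ (-(p + κ)) = 2 ^ (p + κ) * r ^ (-(p + κ)) := by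
        rw [Real.div_rpow hr.le two_pos.le, Real.rpow_neg two_pos.le, div_inv_eq_mul, mul_comm]
      -- Superlinearity: since `a > 0`, the extra factor `b^a` is what the smallness condition
      -- controls.
      have e3 : b ^ (p / 2) = b * b ^ a := by
        rcases hb.eq_or_lt with rfl | hb'
        · rw [Real.zero_rpow (by positivity), zero_mul]
        · rw [← Real.rpow_one_add' hb]
          · congr 1; rw [ha]; ring
          · linarith
      have h2 : TailBound p t u G (ρ + r / 2) (σ * b) := by
        refine h1.mono (by linarith) ?_
        rw [e2, e3]
        have e4 : C * (θ ^ p * b + θ ^ (-κ) * (4 ^ (p + κ) * r ^ (-(p + κ)) * t * (b * b ^ a)))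
            = b * (C * θ ^ p + C * θ ^ (-κ) * 4 ^ (p + κ) * (t * r ^ (-(p + κ)) * b ^ a)) := by
          ring
        have e5 : C * θ ^ (-κ) * 4 ^ (p + κ) * (t * r ^ (-(p + κ)) * b ^ a) ≤ σ / 2 := by
          calc C * θ ^ (-κ) * 4 ^ (p + κ) * (t * r ^ (-(p + κ)) * b ^ a)
              ≤ C * θ ^ (-κ) * 4 ^ (p + κ) * c := by gcongr
            _ = σ / 2 := by
                rw [hc]
                have : C * θ ^ (-κ) * 4 ^ (p + κ) ≠ 0 := by positivity
                field_simp
        rw [e4, mul_comm σ]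
        gcongr
        linarith
      have h3 := ih (ρ + r / 2) (r / 2) (σ * b) (by positivity) (by positivity) (by positivity)
        (h0.mono fun x hx hx' => hx (tail_subset (by linarith) hx')) h2 (by
          rw [e1, Real.mul_rpow hσ.le hb]
          calc t * (2 ^ (p + κ) * r ^ (-(p + κ))) * (σ ^ a * b ^ a)
              = (2 ^ (p + κ) * σ ^ a) * (t * r ^ (-(p + κ)) * b ^ a) := by ring
            _ ≤ 1 * c := by gcongr
            _ = c := one_mul c)
      exact h3.mono (by linarith) (le_of_eq (by ring))
  refine TailBound.of_tendsto (fun n => key n ρ r b hρ hr hb h0 hT hcond) ?_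
  simpa using (tendsto_pow_atTop_nhds_zero_of_lt_one hσ.le (by linarith : σ < 1)).mul_const b

/-- The support of a solution with initial mass `M` grows at most like
`(t M ^ (p - 2)) ^ (1 / (d (p - 2) + p))`. -/
lemma exists_propagation (d : ℕ) (hp : 2 < p) : ∃ C : ℝ, 0 < C ∧
    ∀ (T : ℝ) (u u' : ℝ → Lp ℝ 2 (volume : Measure (Euc d))) (G : ℝ → Euc d → Euc d)
      (_ : IsFlow p T u u' G fun t x => flux p (G t x)) (t : ℝ) (_ : 0 < t) (_ : t ≤ T)
      (R M : ℝ) (_ : 0 ≤ R) (_ : 0 < M) (_ : ∀ᵐ x, x ∈ tail d R → u 0 x = 0)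
      (_ : ∫⁻ x, ‖u 0 x‖ₑ ≤ ENNReal.ofReal M),
      ∀ᵐ x, x ∈ tail d (R + propagationRadius d p C M t) → u t x = 0 := by
  have hp0 : 0 < p := by linarith
  obtain ⟨C₁, hC₁, hmass⟩ := exists_tailBound_of_mass d hp.le
  obtain ⟨c, hc, hzero⟩ := exists_tailBound_zero d hp
  set a : ℝ := (p - 2) / 2 with ha
  have ha0 : 0 < a := div_pos (by linarith) two_pos
  set l : ℝ := d * (p - 2) + p with hl
  have hd0 : (0 : ℝ) ≤ d := d.cast_nonneg
  have hl0 : 0 < l := by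
    have : 0 ≤ d * (p - 2) := mul_nonneg hd0 (by linarith)
    linarith
  -- With `r = C₀ t^{1/l} M^{(p-2)/l}` the smallness condition, applied to the decay obtained from
  -- the mass, holds with equality for this `C₀`.
  set C₀ : ℝ := (C₁ ^ a / c) ^ (1 / (l * (1 + a))) with hC₀
  have hC₀0 : 0 < C₀ := by positivity
  have hC₀e : C₁ ^ a * (C₀ ^ (-l)) ^ (1 + a) = c := by
    rw [← Real.rpow_mul hC₀0.le, hC₀, ← Real.rpow_mul (by positivity)]
    have : 1 / (l * (1 + a)) * (-l * (1 + a)) = -1 := by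
      field_simp
    rw [this, Real.rpow_neg_one]
    field_simp
  refine ⟨2 * C₀, by positivity, ?_⟩
  intro T u u' G hF t ht0 ht R M hR hM h0 hM1
  set r : ℝ := C₀ * t ^ (1 / l) * M ^ ((p - 2) / l) with hr
  have hr0 : 0 < r := by positivity
  -- One `r` is spent on the decay of the energy and another on its extinction, hence the constant
  -- `2 * C₀`.
  have hrad : propagationRadius d p (2 * C₀) M t = r + r := by
    rw [propagationRadius, hr]; ring
  have hrl : r ^ (-l) = C₀ ^ (-l) * (t⁻¹ * (M ^ (p - 2))⁻¹) := by
    rw [hr, Real.mul_rpow (by positivity) (by positivity), Real.mul_rpow (by positivity)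
      (by positivity), ← Real.rpow_mul ht0.le, ← Real.rpow_mul hM.le]
    have e1 : 1 / l * -l = -1 := by field_simp
    have e2 : (p - 2) / l * -l = -(p - 2) := by field_simp
    rw [e1, e2, Real.rpow_neg_one, Real.rpow_neg hM.le, mul_assoc]
  clear_value r
  have h1 := hmass T u u' G hF t ht0 ht R r M hR hr0 hM.le h0 hM1
  have h2 := hzero T u u' G hF t ht0 ht (R + r) r _ (by positivity) hr0 (by positivity)
    (h0.mono fun x hx hx' => hx (tail_subset (by linarith) hx')) h1 (by
      refine le_of_eq (Eq.trans ?_ hC₀e)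
      have hMp : M ^ p = M ^ (p - 2) * M ^ (2 : ℝ) := by
        rw [← Real.rpow_add hM]; congr 1; ring
      have e1 : r ^ (-(p + d * (p - 1))) * t * M ^ p
          = C₀ ^ (-l) * (r ^ (-(d : ℝ)) * M ^ (2 : ℝ)) := by
        have : r ^ (-(p + d * (p - 1))) = r ^ (-l) * r ^ (-(d : ℝ)) := by
          rw [← Real.rpow_add hr0]; congr 1; rw [hl]; ring
        rw [this, hrl, hMp]
        have : M ^ (p - 2) ≠ 0 := by positivity
        field_simp
      have e2 : (r ^ (-(d : ℝ)) * M ^ (2 : ℝ)) ^ a = r ^ (-(d * a)) * M ^ (p - 2) := by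
        rw [Real.mul_rpow (by positivity) (by positivity), ← Real.rpow_mul hr0.le,
          ← Real.rpow_mul hM.le]
        congr 2 <;> rw [ha] <;> ring
      have e3 : r ^ (-(p + d * (p - 2) / 2)) * r ^ (-(d * a)) = r ^ (-l) := by
        rw [← Real.rpow_add hr0]; congr 1; rw [ha, hl]; ring
      rw [e1, Real.mul_rpow hC₁.le (by positivity), Real.mul_rpow (by positivity) (by positivity),
        e2]
      calc t * r ^ (-(p + d * (p - 2) / 2)) *
            (C₁ ^ a * ((C₀ ^ (-l)) ^ a * (r ^ (-(d * a)) * M ^ (p - 2))))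
          = C₁ ^ a * (C₀ ^ (-l)) ^ a *
            ((r ^ (-(p + d * (p - 2) / 2)) * r ^ (-(d * a))) * t * M ^ (p - 2)) := by ring
        _ = C₁ ^ a * (C₀ ^ (-l)) ^ a * C₀ ^ (-l) := by
            rw [e3, hrl]
            have : M ^ (p - 2) ≠ 0 := by positivity
            field_simp
        _ = C₁ ^ a * (C₀ ^ (-l)) ^ (1 + a) := by
            rw [Real.rpow_add (by positivity), Real.rpow_one]; ring)
  have h3 := h2.1 t ⟨ht0.le, le_rfl⟩
  rw [ENNReal.ofReal_zero, nonpos_iff_eq_zero, add_assoc, ← hrad] at h3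
  rw [setLIntegral_eq_zero_iff' (measurableSet_tail _)
    ((Lp.memLp (u t)).1.enorm.pow_const _).restrict] at h3
  filter_upwards [h3] with x hx hx'
  have := hx hx'
  rw [ENNReal.rpow_eq_zero_iff_of_pos two_pos, enorm_eq_zero] at this
  exact this

end PLaplace

namespace PLaplace

open Filter Topology Metric ContinuousLinearMap
open scoped ENNReal NNReal Convolution Gradient

variable {d : ℕ} {p T : ℝ} {u u' : ℝ → Lp ℝ 2 (volume : Measure (Euc d))} {G : ℝ → Euc d → Euc d}

/-! ### Space-time integrals on the cylinder -/

lemma memLp_of_ae_eq_zero_tail {F : Type*} [NormedAddCommGroup F] {f : Euc d → F} {q r : ℝ≥0∞}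
    (hf : MemLp f q volume) {R : ℝ} (h0 : ∀ᵐ x, x ∈ tail d R → f x = 0) (hr : r ≤ q) :
    MemLp f r volume := by
  have e : (closedBall (0 : Euc d) R).indicator f =ᵐ[volume] f := by
    filter_upwards [h0] with x hx
    by_cases hxR : x ∈ closedBall (0 : Euc d) R
    · rw [indicator_of_mem hxR]
    · rw [indicator_of_notMem hxR, hx]
      simpa [tail] using hxR
  refine MemLp.ae_eq e ?_
  exact (hf.indicator measurableSet_closedBall).mono_exponent_of_measure_support_ne_top
    (fun x hx => indicator_of_notMem hx f) measure_closedBall_lt_top.ne hr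

lemma lintegral_rpow_le_rpow_mul_measure {X : Type*} [MeasurableSpace X] {μ : Measure X}
    {f : X → ℝ≥0∞} (hf : AEMeasurable f μ) {r s : ℝ} (hr : 0 ≤ r) (hrs : r < s) :
    ∫⁻ x, f x ^ r ∂μ ≤ (∫⁻ x, f x ^ s ∂μ) ^ (r / s) * μ univ ^ (1 - r / s) := by
  have hs : 0 < s := hr.trans_lt hrs
  -- The exponent `r = 0` occurs for `r = p - 4` with `p = 4`, where Hölder's inequality with
  -- exponent `s / r` makes no sense.
  rcases hr.eq_or_lt with rfl | hr0
  · simp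
  have hc := Real.HolderConjugate.conjExponent ((one_lt_div hr0).2 hrs)
  have h := ENNReal.lintegral_mul_le_Lp_mul_Lq μ hc (hf.pow_const r) (g := 1) aemeasurable_const
  simp only [Pi.mul_apply, Pi.one_apply, mul_one, ENNReal.one_rpow, lintegral_one,
    ← ENNReal.rpow_mul, mul_div_cancel₀ s hr0.ne'] at h
  have e1 : 1 / (s / r) = r / s := by rw [one_div_div]
  have e2 : 1 / (s / r).conjExponent = 1 - r / s := by
    have := hc.inv_add_inv_eq_one
    rw [← e1, one_div, one_div]
    linarith
  rwa [e1, e2] at h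

lemma enorm_norm_rpow {F : Type*} [NormedAddCommGroup F] (x : F) {r : ℝ} (hr : 0 ≤ r) :
    ‖‖x‖ ^ r‖ₑ = ‖x‖ₑ ^ r := by
  rw [Real.enorm_eq_ofReal (by positivity), ← ENNReal.ofReal_rpow_of_nonneg (norm_nonneg _) hr,
    ofReal_norm]

lemma integrable_of_lintegral_le {X F : Type*} [MeasurableSpace X] [NormedAddCommGroup F]
    {μ : Measure X} {f : X → F} (hf : AEStronglyMeasurable f μ) {c : ℝ} (hc : 0 ≤ c)
    (h : ∫⁻ x, ‖f x‖ₑ ∂μ ≤ ENNReal.ofReal c) : Integrable f μ ∧ ∫ x, ‖f x‖ ∂μ ≤ c := by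
  refine ⟨⟨hf, h.trans_lt ENNReal.ofReal_lt_top⟩, ?_⟩
  rw [integral_norm_eq_lintegral_enorm hf]
  exact ENNReal.toReal_le_of_le_ofReal hc h

lemma cylinderMeasure_restrict (T : ℝ) (S : Set (Euc d)) :
    (cylinderMeasure d T).restrict (univ ×ˢ S)
      = (volume.restrict (Ioo 0 T)).prod (volume.restrict S) := by
  rw [cylinderMeasure, ← Measure.prod_restrict, Measure.restrict_univ]

lemma cylinderMeasure_univ_prod (hT : 0 ≤ T) (ρ : ℝ) :
    (cylinderMeasure d T).restrict (univ ×ˢ closedBall (0 : Euc d) ρ) univ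
      = ENNReal.ofReal (T * (volume (closedBall (0 : Euc d) ρ)).toReal) := by
  rw [cylinderMeasure_restrict, ← univ_prod_univ, Measure.prod_prod,
    Measure.restrict_apply_univ, Measure.restrict_apply_univ, Real.volume_Ioo, sub_zero,
    ENNReal.ofReal_mul hT, ENNReal.ofReal_toReal measure_closedBall_lt_top.ne]

/-- Vanishing is known only slice by slice; Tonelli's theorem makes this sufficient for restricting
the integral to a cylinder over a ball. -/
lemma lintegral_cylinderMeasure_eq {f : ℝ × Euc d → ℝ≥0∞}
    (hf : AEMeasurable f (cylinderMeasure d T)) {ρ : ℝ}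
    (h0 : ∀ᵐ t ∂(volume.restrict (Ioo 0 T)), ∀ᵐ x, x ∈ tail d ρ → f (t, x) = 0) :
    ∫⁻ z, f z ∂(cylinderMeasure d T)
      = ∫⁻ z in univ ×ˢ closedBall (0 : Euc d) ρ, f z ∂(cylinderMeasure d T) := by
  have hf' := hf.restrict (s := univ ×ˢ closedBall (0 : Euc d) ρ)
  rw [cylinderMeasure_restrict] at hf' ⊢
  rw [lintegral_prod _ hf', cylinderMeasure, lintegral_prod _ hf]
  refine lintegral_congr_ae ?_
  filter_upwards [h0] with t ht
  rw [← lintegral_indicator measurableSet_closedBall]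
  refine lintegral_congr_ae ?_
  filter_upwards [ht] with x hx
  by_cases hxR : x ∈ closedBall (0 : Euc d) ρ
  · rw [indicator_of_mem hxR]
  · rw [indicator_of_notMem hxR, hx]
    simpa [tail] using hxR

/-- Integrals of powers of the gradient below `p`, from the energy inequality. -/
lemma IsFlow.lintegral_gradient_rpow_le (hp : 2 ≤ p)
    (hF : IsFlow p T u u' G fun t x => flux p (G t x)) (hT : 0 < T)
    (hG : AEStronglyMeasurable (fun z : ℝ × Euc d => G z.1 z.2) (cylinderMeasure d T)) {r : ℝ}
    (hr : 0 ≤ r) (hrp : r < p) (ρ : ℝ) :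
    ∫⁻ z in univ ×ˢ closedBall (0 : Euc d) ρ, ‖G z.1 z.2‖ₑ ^ r ∂(cylinderMeasure d T)
      ≤ ENNReal.ofReal ((‖u 0‖ ^ 2 / 2) ^ (r / p)
        * (T * (volume (closedBall (0 : Euc d) ρ)).toReal) ^ (1 - r / p)) := by
  have hp0 : 0 < p := by linarith
  refine (lintegral_rpow_le_rpow_mul_measure hG.restrict.enorm hr hrp).trans ?_
  rw [cylinderMeasure_univ_prod hT.le,
    ENNReal.ofReal_mul (p := (‖u 0‖ ^ 2 / 2) ^ (r / p)) (by positivity),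
    ← ENNReal.ofReal_rpow_of_nonneg (by positivity) (by positivity),
    ← ENNReal.ofReal_rpow_of_nonneg (by positivity) (by
      rw [sub_nonneg, div_le_one hp0]; exact hrp.le)]
  gcongr ?_ ^ (r / p) * _
  refine (setLIntegral_le_lintegral _ _).trans (le_trans (le_of_eq ?_) (hF.energy hp hT))
  exact lintegral_prod _ (hG.enorm.pow_const p)

lemma aestronglyMeasurable_wgrad_of_continuousOn (hT : 0 ≤ T) (hu : ContinuousOn u (Icc 0 T)) :
    AEStronglyMeasurable (fun z : ℝ × Euc d => wgrad (u z.1) z.2) (cylinderMeasure d T) := by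
  obtain ⟨U, hU, hUu⟩ := exists_stronglyMeasurable_of_continuousOn hT hu
  refine aestronglyMeasurable_wgrad_of_stronglyMeasurable (f := fun t => u t) hU ?_
    (Eventually.of_forall fun t => (Lp.memLp (u t)).locallyIntegrable (by norm_num))
  filter_upwards [ae_restrict_mem measurableSet_Ioo] with t ht
  exact (hUu t (Ioo_subset_Icc_self ht)).symm

/-- The power `p / 2` of the modulus of the gradient has a square integrable spatial gradient. -/
lemma IsFlow.hasWeakGradient_rpow_half (hp : 2 ≤ p)
    (hF : IsFlow p T u u' G fun t x => flux p (G t x)) (hT : 0 < T)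
    (hG : AEStronglyMeasurable (fun z : ℝ × Euc d => G z.1 z.2) (cylinderMeasure d T))
    {D : Euc d → Euc d} (hD : HasWeakGradient (u 0) D) (hD2 : MemLp D 2 volume) :
    IsSpatialGradient T (fun t x => ‖G t x‖ ^ (p / 2)) (fun t => wgrad fun x => ‖G t x‖ ^ (p / 2)) ∧
      ∫⁻ z, ‖wgrad (fun x => ‖G z.1 x‖ ^ (p / 2)) z.2‖ₑ ^ (2 : ℝ) ∂(cylinderMeasure d T)
        ≤ ENNReal.ofReal (d * p ^ 2 / 8 * lpNormReal D 2 ^ 2) := by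
  have hm : AEStronglyMeasurable (fun z : ℝ × Euc d => ‖G z.1 z.2‖ ^ (p / 2))
      (cylinderMeasure d T) :=
    (Real.continuous_rpow_const (by positivity : 0 ≤ p / 2)).comp_aestronglyMeasurable hG.norm
  have hl : ∀ᵐ t ∂(volume.restrict (Ioo 0 T)),
      LocallyIntegrable (fun x => ‖G t x‖ ^ (p / 2)) volume := by
    filter_upwards [hF.memG] with t ht
    have h1 := ht.norm_rpow_div (ENNReal.ofReal (p / 2))
    rw [ENNReal.toReal_ofReal (by positivity)] at h1
    refine h1.locallyIntegrable ?_
    rw [← ENNReal.ofReal_div_of_pos (by positivity)]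
    have : p / (p / 2) = 2 := by field_simp
    rw [this]
    norm_num
  have hDe : ∫⁻ x, ‖D x‖ₑ ^ (2 : ℝ) = ENNReal.ofReal (lpNormReal D 2 ^ 2) := by
    have h2 : ENNReal.ofReal 2 = 2 := by simp
    rw [← eLpNorm_ofReal_rpow two_pos, h2, lpNormReal, ENNReal.ofReal_pow ENNReal.toReal_nonneg,
      ENNReal.ofReal_toReal hD2.2.ne]
    norm_cast
  obtain ⟨h1, h2⟩ := hasWeakGradient_of_lintegral_sub_le (f := fun t x => ‖G t x‖ ^ (p / 2)) hm hl
    (C := ENNReal.ofReal (p ^ 2 / 8) * ENNReal.ofReal (lpNormReal D 2 ^ 2))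
    (ENNReal.mul_ne_top ENNReal.ofReal_ne_top ENNReal.ofReal_ne_top) fun z => by
      refine (hF.lintegral_rpow_half_sub_le hp hT z).trans ?_
      rw [mul_assoc, ← hDe, mul_comm (∫⁻ x, ‖D x‖ₑ ^ (2 : ℝ))]
      gcongr _ * ?_
      exact lintegral_translate_sub_rpow_le hD (by norm_num) z
  have hwm := aestronglyMeasurable_wgrad hm hl
  refine ⟨⟨hwm, h1⟩, ?_⟩
  rw [cylinderMeasure, lintegral_prod _ (hwm.enorm.pow_const 2)]
  refine h2.trans (le_of_eq ?_)
  rw [← ENNReal.ofReal_mul (by positivity), ← ENNReal.ofReal_natCast,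
    ← ENNReal.ofReal_mul (by positivity)]
  congr 1
  ring

/-- The gradient of `|∇u| ^ (p - 2)` in terms of the gradient of `|∇u| ^ (p / 2)`. -/
lemma IsSpatialGradient_rpow_sub_two (hp : 4 ≤ p) {K : ℝ → Euc d → Euc d}
    (hG : AEStronglyMeasurable (fun z : ℝ × Euc d => G z.1 z.2) (cylinderMeasure d T))
    (hK : IsSpatialGradient T (fun t x => ‖G t x‖ ^ (p / 2)) K) {L : ℝ} (hL : 0 ≤ L)
    (hGL : ∀ᵐ t ∂(volume.restrict (Ioo 0 T)), ∀ᵐ x, ‖G t x‖ ≤ L) :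
    IsSpatialGradient T (fun t x => ‖G t x‖ ^ (p - 2))
      (fun t x => (2 * (p - 2) / p * ‖G t x‖ ^ ((p - 4) / 2)) • K t x) := by
  have hp0 : 0 < p := by linarith
  refine ⟨?_, ?_⟩
  · have h1 : AEStronglyMeasurable (fun z : ℝ × Euc d =>
        2 * (p - 2) / p * ‖G z.1 z.2‖ ^ ((p - 4) / 2)) (cylinderMeasure d T) :=
      ((Real.continuous_rpow_const (by linarith : 0 ≤ (p - 4) / 2)).comp_aestronglyMeasurable
        hG.norm).const_mul _
    exact h1.smul hK.1
  · filter_upwards [hK.2, hGL] with t h1 h2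
    -- `|∇u|^{p-2}` is the power `2(p-2)/p` of `|∇u|^{p/2}`. This exponent is at least `1` exactly
    -- when `p ≥ 4`, and the Lipschitz bound `L` supplies the upper bound for the chain rule.
    have h3 := HasWeakGradient_rpow h1 (α := 2 * (p - 2) / p) (m := L ^ (p / 2))
      (by rw [le_div_iff₀ hp0]; linarith) (fun x => by positivity) (by positivity) (by
        filter_upwards [h2] with x hx
        gcongr)
    have e1 : p / 2 * (2 * (p - 2) / p) = p - 2 := by field_simp
    have e2 : p / 2 * (2 * (p - 2) / p - 1) = (p - 4) / 2 := by field_simp; ring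
    simp only [← Real.rpow_mul (norm_nonneg _), e1, e2] at h3
    exact h3

lemma propagationRadius_nonneg {C m t : ℝ} (hC : 0 ≤ C) (hm : 0 ≤ m) (ht : 0 ≤ t) :
    0 ≤ propagationRadius d p C m t := by
  rw [propagationRadius]; positivity

lemma propagationRadius_mono (hp : 2 ≤ p) {C m s t : ℝ} (hC : 0 ≤ C) (hm : 0 ≤ m) (hs : 0 ≤ s)
    (hst : s ≤ t) : propagationRadius d p C m s ≤ propagationRadius d p C m t := by
  have h1 : 0 ≤ 1 / (d * (p - 2) + p) := by
    have : 0 ≤ d * (p - 2) := mul_nonneg d.cast_nonneg (by linarith)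
    positivity
  rw [propagationRadius, propagationRadius]
  gcongr

lemma ae_norm_le_of_memLp_top {X F : Type*} [MeasurableSpace X] [NormedAddCommGroup F]
    {μ : Measure X} {f : X → F} (hf : MemLp f ⊤ μ) : ∀ᵐ x ∂μ, ‖f x‖ ≤ (eLpNorm f ⊤ μ).toReal := by
  have h := hf.2.ne
  rw [eLpNorm_exponent_top] at h ⊢
  filter_upwards [ae_le_eLpNormEssSup (f := f) (μ := μ)] with x hx
  rw [← toReal_enorm]
  exact ENNReal.toReal_mono h hx

/-- Joint measurability is what upgrades a bound on almost every slice to a bound almost everywhere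
on the product. -/
lemma memLp_top_cylinderMeasure
    (hG : AEStronglyMeasurable (fun z : ℝ × Euc d => G z.1 z.2) (cylinderMeasure d T)) {L : ℝ}
    (hGL : ∀ᵐ t ∂(volume.restrict (Ioo 0 T)), ∀ᵐ x, ‖G t x‖ ≤ L) :
    MemLp (fun z : ℝ × Euc d => G z.1 z.2) ⊤ (cylinderMeasure d T) := by
  refine memLp_top_of_bound hG L ?_
  have h1 : ∀ᵐ z ∂(cylinderMeasure d T), ‖hG.mk _ z‖ ≤ L := by
    have hms : MeasurableSet {z : ℝ × Euc d | ‖hG.mk _ z‖ ≤ L} :=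
      measurableSet_le hG.stronglyMeasurable_mk.norm.measurable measurable_const
    refine (Measure.ae_prod_iff_ae_ae hms).2 ?_
    filter_upwards [hGL, Measure.ae_ae_of_ae_prod hG.ae_eq_mk] with t h1 h2
    filter_upwards [h1, h2] with x h3 h4
    rwa [← h4]
  filter_upwards [h1, hG.ae_eq_mk] with z h2 h3
  rwa [h3]

/-- The left-hand side is what Cauchy–Schwarz delivers: the chain rule constant times the square
roots of the bounds for `∬ |∇u|^{p-4}` and `∬ |∇(|∇u|^{p/2})|²`. The exponents of `2` add up to `2/p
- 2`. -/
lemma rpow_bound_eq (hp : 4 ≤ p) {N W D : ℝ} (hN : 0 ≤ N) (hW : 0 ≤ W) (hD : 0 ≤ D) (d : ℕ) :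
    2 * (p - 2) / p * ((((N ^ 2 / 2) ^ ((p - 4) / p) * W ^ (1 - (p - 4) / p)) ^ (1 / 2 : ℝ))
      * (d * p ^ 2 / 8 * D ^ 2) ^ (1 / 2 : ℝ))
      = √d * (p - 2) / 2 * (2 * W) ^ (2 / p) * N ^ ((p - 4) / p) * D := by
  have hp0 : 0 < p := by linarith
  have e1 : (N ^ 2 / 2) ^ ((p - 4) / p) ^ (1 : ℕ) = N ^ (2 * ((p - 4) / p)) * 2 ^ (-((p - 4) / p)) := by
    rw [pow_one, Real.div_rpow (by positivity) two_pos.le, Real.rpow_neg two_pos.le,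
      Real.rpow_mul hN, Real.rpow_two, div_eq_mul_inv]
  rw [pow_one] at e1
  have e2 : (d * p ^ 2 / 8 * D ^ 2 : ℝ) ^ (1 / 2 : ℝ) = √d * p * D * 2 ^ (-(3 / 2) : ℝ) := by
    have h8 : (2 : ℝ) ^ (-(3 / 2) : ℝ) = (1 / 8) ^ (1 / 2 : ℝ) := by
      rw [show (1 / 8 : ℝ) = 2 ^ (-3 : ℝ) by rw [Real.rpow_neg two_pos.le]; norm_num,
        ← Real.rpow_mul two_pos.le]
      norm_num
    have h9 : (d * p ^ 2 / 8 * D ^ 2 : ℝ) = d * (p * D) ^ 2 * (1 / 8) := by ring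
    rw [h8, h9, Real.mul_rpow (by positivity) (by norm_num), Real.mul_rpow (by positivity)
      (by positivity), ← Real.sqrt_eq_rpow, ← Real.sqrt_eq_rpow ((p * D) ^ 2),
      Real.sqrt_sq (by positivity)]
    ring
  rw [e1, e2, Real.mul_rpow (by positivity) (by positivity), Real.mul_rpow (by positivity)
    (by positivity), ← Real.rpow_mul hN, ← Real.rpow_mul two_pos.le, ← Real.rpow_mul hW,
    Real.mul_rpow two_pos.le hW]
  have a1 : 2 * ((p - 4) / p) * (1 / 2) = (p - 4) / p := by ring
  have a2 : (1 - (p - 4) / p) * (1 / 2) = 2 / p := by field_simp; ring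
  have a3 : (2 : ℝ) ^ (-((p - 4) / p) * (1 / 2)) * 2 ^ (-(3 / 2) : ℝ) = 2 ^ (2 / p) / 4 := by
    rw [← Real.rpow_add two_pos, eq_div_iff (by norm_num),
      show (4 : ℝ) = 2 ^ (2 : ℝ) by norm_num, ← Real.rpow_add two_pos]
    congr 1
    field_simp
    ring
  rw [a1, a2]
  calc 2 * (p - 2) / p * (N ^ ((p - 4) / p) * 2 ^ (-((p - 4) / p) * (1 / 2)) * W ^ (2 / p)
        * (√d * p * D * 2 ^ (-(3 / 2) : ℝ)))
      = 2 * (p - 2) / p * p * √d * N ^ ((p - 4) / p) * W ^ (2 / p) * D *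
        (2 ^ (-((p - 4) / p) * (1 / 2)) * 2 ^ (-(3 / 2) : ℝ)) := by ring
    _ = _ := by
        rw [a3]
        field_simp
        ring

end PLaplace

/-! ### Assembly of the theorem -/

open PLaplace

theorem theorem3p1 (d : ℕ) (hd : 1 ≤ d) (p : ℝ) (hp : 4 ≤ p) :
    ∃ C : ℝ, 0 < C ∧
      ∀ (R : ℝ) (_ : 0 ≤ R)
        (u₀ : Lp ℝ 2 (volume : Measure (EuclideanSpace ℝ (Fin d))))
        (Du₀ : EuclideanSpace ℝ (Fin d) → EuclideanSpace ℝ (Fin d))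
        (_ : SupportedInBall u₀ R)
        (_ : HasWeakGradient u₀ Du₀) (_ : MemLp Du₀ ⊤ volume)
        (T : ℝ) (_ : 0 < T)
        (u : ℝ → Lp ℝ 2 (volume : Measure (EuclideanSpace ℝ (Fin d))))
        (_ : IsWeakSolution p T u₀ u),
        -- `C` is an admissible constant for the propagation of supports
        (∀ t ∈ Icc 0 T,
          SupportedInBall (u t) (2 * R + propagationRadius d p C (lpNormReal u₀ 1) t)) ∧
        ∃ Du : ℝ → EuclideanSpace ℝ (Fin d) → EuclideanSpace ℝ (Fin d),
          IsSpatialGradient T (fun t => u t) Du ∧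
          -- `∇u ∈ L^∞(0,T; L^∞)`
          MemLp (fun z : ℝ × EuclideanSpace ℝ (Fin d) => Du z.1 z.2) ⊤ (cylinderMeasure d T) ∧
          -- bound on `∫∫ |∇u|^{p-2}`
          (Integrable (fun z : ℝ × EuclideanSpace ℝ (Fin d) => ‖Du z.1 z.2‖ ^ (p - 2))
              (cylinderMeasure d T) ∧
            ∫ z, ‖Du z.1 z.2‖ ^ (p - 2) ∂(cylinderMeasure d T) ≤
              (T * supportVolume d R (propagationRadius d p C (lpNormReal u₀ 1) T)) ^ (2 / p)
                * lpNormReal u₀ 2 ^ (2 * (p - 2) / p)) ∧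
          -- bound on `∫∫ |∇(|∇u|^{p-2})|`
          (∃ H : ℝ → EuclideanSpace ℝ (Fin d) → EuclideanSpace ℝ (Fin d),
            IsSpatialGradient T (fun t x => ‖Du t x‖ ^ (p - 2)) H ∧
            Integrable (fun z : ℝ × EuclideanSpace ℝ (Fin d) => H z.1 z.2)
              (cylinderMeasure d T) ∧
            ∫ z, ‖H z.1 z.2‖ ∂(cylinderMeasure d T) ≤
              Real.sqrt d * (p - 2) / 2
                * (2 * T * supportVolume d R
                    (propagationRadius d p C (lpNormReal u₀ 1) T)) ^ (2 / p)
                * lpNormReal u₀ 2 ^ ((p - 4) / p) * lpNormReal Du₀ 2) ∧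
          -- bound on `∫∫ |∇(|∇u|^{p/2})|²`
          (∃ K : ℝ → EuclideanSpace ℝ (Fin d) → EuclideanSpace ℝ (Fin d),
            IsSpatialGradient T (fun t x => ‖Du t x‖ ^ (p / 2)) K ∧
            MemLp (fun z : ℝ × EuclideanSpace ℝ (Fin d) => K z.1 z.2) 2
              (cylinderMeasure d T) ∧
            ∫ z, ‖K z.1 z.2‖ ^ 2 ∂(cylinderMeasure d T) ≤
              d * p ^ 2 / 8 * lpNormReal Du₀ 2 ^ 2) := by
  have hp2 : 2 ≤ p := by linarith
  have hp0 : 0 < p := by linarith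
  obtain ⟨C, hC, hprop⟩ := exists_propagation d (by linarith : 2 < p)
  refine ⟨C, hC, ?_⟩
  intro R hR u₀ Du₀ hsupp hDu hDtop T hT u hu
  obtain ⟨u', hF⟩ := IsWeakSolution_isFlow hp2 hu
  have hu0 : u 0 = u₀ := hu.2.1
  subst hu0
  set G : ℝ → Euc d → Euc d := fun t => wgrad (u t) with hGdef
  set M := lpNormReal (u 0) 1 with hM
  have hM0 : 0 ≤ M := ENNReal.toReal_nonneg
  -- Bounded support puts `u₀` in `L¹`, so the real number `M` is its norm and not the default value
  -- of an infinite one.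
  have hu1 : MemLp (u 0) 1 volume := memLp_of_ae_eq_zero_tail (Lp.memLp _) hsupp (by norm_num)
  have hMe : ∫⁻ x, ‖u 0 x‖ₑ = ENNReal.ofReal M := by
    rw [hM, lpNormReal, ENNReal.ofReal_toReal hu1.2.ne, eLpNorm_one_eq_lintegral_enorm]
  have hS : ∀ t ∈ Icc 0 T, ∀ᵐ x, x ∈ tail d (2 * R + propagationRadius d p C M t) →
      u t x = 0 := by
    intro t ht
    have hrad : 0 ≤ propagationRadius d p C M t := propagationRadius_nonneg hC.le hM0 ht.1
    rcases ht.1.eq_or_lt with rfl | ht0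
    · filter_upwards [hsupp] with x hx hx'
      exact hx (tail_subset (by linarith) hx')
    -- The propagation estimate needs positive mass; zero mass means `u₀ = 0`, and then `u` vanishes
    -- by decay of the `L²` norm.
    rcases hM0.eq_or_lt with hM00 | hM00
    · rw [← hM00, ENNReal.ofReal_zero, lintegral_eq_zero_iff' hu1.1.enorm] at hMe
      have h0 : u 0 = 0 := by
        rw [Lp.eq_zero_iff_ae_eq_zero]
        filter_upwards [hMe] with x hx
        simpa using hx
      have h1 : u t = 0 := by
        have := hF.norm_le hp2 ht
        rw [h0, norm_zero] at this
        exact norm_le_zero_iff.1 this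
      rw [h1]
      filter_upwards [Lp.coeFn_zero ℝ 2 (volume : Measure (Euc d))] with x hx _
      simp
    · filter_upwards [hprop T u u' G hF t ht0 ht.2 R M hR hM00 hsupp hMe.le] with x hx hx'
      exact hx (tail_subset (by linarith) hx')
  refine ⟨hS, ?_⟩
  set ρ := 2 * R + propagationRadius d p C M T with hρ
  set V := supportVolume d R (propagationRadius d p C M T) with hV
  have hV0 : 0 ≤ V := ENNReal.toReal_nonneg
  have hVe : (volume (Metric.closedBall (0 : Euc d) ρ)).toReal = V := rfl
  have hG0 : ∀ᵐ t ∂(volume.restrict (Ioo 0 T)), ∀ᵐ x, x ∈ tail d ρ → G t x = 0 := by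
    filter_upwards [hF.grad, ae_restrict_mem measurableSet_Ioo] with t h1 ht
    refine ae_eq_zero_of_hasWeakGradient h1 (isOpen_tail ρ) ?_
    filter_upwards [hS t (Ioo_subset_Icc_self ht)] with x hx hx'
    have := propagationRadius_mono (d := d) hp2 hC.le hM0 ht.1.le ht.2.le
    exact hx (tail_subset (by linarith) hx')
  set L := (eLpNorm Du₀ ⊤ volume).toReal with hL
  have hL0 : 0 ≤ L := ENNReal.toReal_nonneg
  have hGL : ∀ᵐ t ∂(volume.restrict (Ioo 0 T)), ∀ᵐ x, ‖G t x‖ ≤ L :=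
    hF.gradient_le hp2 hL0
      fun h => translate_sub_le_of_gradient_le hDu (ae_norm_le_of_memLp_top hDtop) h
  have hGm : AEStronglyMeasurable (fun z : ℝ × Euc d => G z.1 z.2) (cylinderMeasure d T) :=
    aestronglyMeasurable_wgrad_of_continuousOn hT.le hF.cont
  -- The gradient of `u₀` is bounded and vanishes outside the ball of radius `R`, hence it is square
  -- integrable.
  have hD2 : MemLp Du₀ 2 volume := memLp_of_ae_eq_zero_tail hDtop
    (ae_eq_zero_of_hasWeakGradient hDu (isOpen_tail R) hsupp) le_top
  obtain ⟨hK, hK2⟩ := hF.hasWeakGradient_rpow_half hp2 hT hGm hDu hD2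
  set K : ℝ → Euc d → Euc d := fun t => wgrad fun x => ‖G t x‖ ^ (p / 2) with hKdef
  have hK0 : ∀ᵐ t ∂(volume.restrict (Ioo 0 T)), ∀ᵐ x, x ∈ tail d ρ → K t x = 0 := by
    filter_upwards [hK.2, hG0] with t h1 h2
    refine ae_eq_zero_of_hasWeakGradient h1 (isOpen_tail ρ) ?_
    filter_upwards [h2] with x hx hx'
    rw [hx hx', norm_zero, Real.zero_rpow (by positivity)]
  set N := lpNormReal (u 0) 2 with hN
  have hN0 : 0 ≤ N := ENNReal.toReal_nonneg
  have hNe : ‖u 0‖ = N := rfl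
  set D := lpNormReal Du₀ 2 with hDn
  have hDn0 : 0 ≤ D := ENNReal.toReal_nonneg
  have hH := IsSpatialGradient_rpow_sub_two hp hGm hK hL0 hGL
  refine ⟨G, ⟨hGm, hF.grad⟩, memLp_top_cylinderMeasure hGm hGL, ?_, ⟨_, hH, ?_⟩, K, hK, ?_, ?_⟩
  · have hm : AEStronglyMeasurable (fun z : ℝ × Euc d => ‖G z.1 z.2‖ ^ (p - 2))
        (cylinderMeasure d T) :=
      (Real.continuous_rpow_const (by linarith : 0 ≤ p - 2)).comp_aestronglyMeasurable hGm.norm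
    have h1 := integrable_of_lintegral_le hm (c := (T * V) ^ (2 / p) * N ^ (2 * (p - 2) / p))
      (by positivity) (by
        simp only [enorm_norm_rpow _ (by linarith : 0 ≤ p - 2)]
        rw [lintegral_cylinderMeasure_eq (hGm.enorm.pow_const _) (ρ := ρ) (by
          filter_upwards [hG0] with t ht
          filter_upwards [ht] with x hx hx'
          rw [hx hx', enorm_zero, ENNReal.zero_rpow_of_pos (by linarith)])]
        refine (hF.lintegral_gradient_rpow_le hp2 hT hGm (by linarith) (by linarith) ρ).trans
          (ENNReal.ofReal_le_ofReal ?_)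
        have e1 : 1 - (p - 2) / p = 2 / p := by field_simp; ring
        have e2 : N ^ (2 * (p - 2) / p) = (N ^ 2) ^ ((p - 2) / p) := by
          rw [← Real.rpow_two, ← Real.rpow_mul hN0, mul_div_assoc]
        rw [hVe, hNe, e1, e2, mul_comm]
        have : 0 ≤ (p - 2) / p := div_nonneg (by linarith) hp0.le
        -- The energy bound carries `N²/2`; replacing it by `N²` gives the stated constant.
        gcongr
        linarith [sq_nonneg N])
    simp only [Real.norm_of_nonneg (Real.rpow_nonneg (norm_nonneg _) _)] at h1
    exact h1
  · refine integrable_of_lintegral_le hH.1 (by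
      have : 0 ≤ p - 2 := by linarith
      positivity) ?_
    have hα : 0 ≤ 2 * (p - 2) / p := div_nonneg (by linarith) hp0.le
    have he : 0 ≤ (p - 4) / 2 := by linarith
    have e1 : ∀ z : ℝ × Euc d, ‖(2 * (p - 2) / p * ‖G z.1 z.2‖ ^ ((p - 4) / 2)) • K z.1 z.2‖ₑ
        = ENNReal.ofReal (2 * (p - 2) / p) *
          (‖G z.1 z.2‖ₑ ^ ((p - 4) / 2) * ‖K z.1 z.2‖ₑ) := fun z => by
      rw [enorm_smul, enorm_mul, enorm_norm_rpow _ he, Real.enorm_eq_ofReal hα, mul_assoc]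
    rw [lintegral_cylinderMeasure_eq hH.1.enorm (ρ := ρ) (by
      filter_upwards [hK0] with t ht
      filter_upwards [ht] with x hx hx'
      simp only [hx hx', smul_zero, enorm_zero])]
    simp only [e1]
    rw [lintegral_const_mul' _ _ ENNReal.ofReal_ne_top, mul_assoc 2 T V,
      ← rpow_bound_eq hp hN0 (mul_nonneg hT.le hV0) hDn0 d, ENNReal.ofReal_mul hα]
    gcongr _ * ?_
    -- Cauchy–Schwarz on the cylinder over the ball containing all supports: the square of the first
    -- factor is `|∇u|^{p-4}`, bounded by the energy through Hölder, and the second is the gradient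
    -- of `|∇u|^{p/2}`.
    have hcs := ENNReal.lintegral_mul_le_Lp_mul_Lq
      ((cylinderMeasure d T).restrict (univ ×ˢ Metric.closedBall (0 : Euc d) ρ))
      Real.HolderConjugate.two_two (hGm.restrict.enorm.pow_const ((p - 4) / 2)) hK.1.restrict.enorm
    refine hcs.trans ?_
    rw [ENNReal.ofReal_mul (by positivity), ← ENNReal.ofReal_rpow_of_nonneg (by positivity)
      (by norm_num), ← ENNReal.ofReal_rpow_of_nonneg (by positivity) (by norm_num)]
    have e2 : (p - 4) / 2 * 2 = p - 4 := by ring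
    simp only [← ENNReal.rpow_mul, e2]
    gcongr ?_ ^ _ * ?_ ^ _
    · have := hF.lintegral_gradient_rpow_le hp2 hT hGm (r := p - 4) (by linarith) (by linarith) ρ
      rwa [hVe, hNe] at this
    · exact (setLIntegral_le_lintegral _ _).trans hK2
  · refine ⟨hK.1, ?_⟩
    have h2 : ENNReal.ofReal 2 = 2 := by simp
    have h3 := eLpNorm_ofReal_rpow two_pos (μ := cylinderMeasure d T)
      (fun z : ℝ × Euc d => K z.1 z.2)
    rw [h2] at h3
    have h4 := hK2.trans_lt ENNReal.ofReal_lt_top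
    rw [← h3] at h4
    by_contra h5
    rw [top_le_iff.1 (not_lt.1 h5), ENNReal.top_rpow_of_pos two_pos] at h4
    exact lt_irrefl _ h4
  · have hm : AEStronglyMeasurable (fun z : ℝ × Euc d => ‖K z.1 z.2‖ ^ 2) (cylinderMeasure d T) :=
      hK.1.norm.pow 2
    have h1 := (integrable_of_lintegral_le hm (c := d * p ^ 2 / 8 * D ^ 2) (by positivity) (by
      simp only [← Real.rpow_two, enorm_norm_rpow _ (zero_le_two : (0 : ℝ) ≤ 2)]
      simp only [Real.rpow_two]
      exact hK2)).2
    simpa only [norm_pow, norm_norm] using h1
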